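/- Let $n\ge 1$, let $q=e^{\pi i s}$ with $0<s<2$, $s\ne 1$, and put $[x]=\frac{q^{x}-q^{-x}}{q-q^{-1}}=\frac{\sin(\pi s x)}{\sin(\pi s)}$ (where $q^{x}=e^{\pi i s x}$), $[X]_k!=[X][X-1]\cdots[X-k]$ for integers $k\ge 0$ and $[X]_{-1}!=1$. Write $\{x\}\in\{\pm1\}$ for the sign of a nonzero real number. Let $\lambda=(\lambda_1,\dots,\lambda_n)\in\mathbb R^n$ with $\lambda_i-\lambda_{i+1}\in\mathbb Z_{\ge 0}$, and assume that $q$ is generic in the sense that $[k]\neq 0$ for all integers $1\le k\le \lambda_1-\lambda_n+n-2$ (for example, $q$ is not a root of unity). $U_q(\mathfrak{gl}_n)$ is the algebra generated by $e_i,f_i$ ($1\le i<n$) and $K_j^{\pm1}$ ($1\le j\le n$), the $K_j$ commuting, with $K_je_i=q^{\delta_{j,i}-\delta_{j,i+1}}e_iK_j$, $K_jf_i=q^{-\delta_{j,i}+\delta_{j,i+1}}f_iK_j$, $[e_i,f_j]=\delta_{ij}\frac{K_iK_{i+1}^{-1}-K_i^{-1}K_{i+1}}{q-q^{-1}}$,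 and the $q$-Serre relations. Then there is a finite-dimensional irreducible module $L(\lambda)$ containing a vector $v\ne0$ with $e_iv=0$ and $K_jv=q^{\lambda_j}v$, that carries a Hermitian form $(\cdot,\cdot)$ for which $e_i$ and $f_i$ are adjoint, $K_j$ and $K_j^{-1}$ are adjoint, and $(v,v)>0$. For every such module and form the following holds. Let $V_\mu\subseteq L(\lambda)$ be the span of all $f_{i_1}\cdots f_{i_r}v$ with $\lambda-\alpha_{i_1}-\cdots-\alpha_{i_r}=\mu$, where $\alpha_i=\varepsilon_i-\varepsilon_{i+1}$. Then $L(\lambda)=\bigoplus_{\mu}V_\mu$, and every nonzero $V_\mu$ is equal to $\{x: K_jx=q^{\mu_j}x \text{ for all } j\}$. The signature $s(V_\mu)$ is the sum of the signs of the norms of the vectors of an orthogonal basis of $V_\mu$ (vectors of norm $0$ counting $0$), and $ch_s(L(\lambda))=\sum_\mu s(V_\mu)e^{\mu}$. A Gelfand–Tsetlin pattern $\Lambda$ with top row $\lambda$ is an array $(\lambda_{m,i})_{1\le i\le m\le n}$ with $\lambda_{n,i}=\lambda_i$, $\lambda_{m,i}-\lambda_{m-1,i}\in\mathbb Z_{\ge0}$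 and $\lambda_{m-1,i}-\lambda_{m,i+1}\in\mathbb Z_{\ge0}$. Put $\nu_{m,i}=i-\lambda_{m,i}-1$, $\nu_i=i-\lambda_i-1$, and $$\mathrm{wt}(\Lambda)=\Big(\lambda_{1,1},\ \lambda_{2,1}+\lambda_{2,2}-\lambda_{1,1},\ \dots,\ \sum_{i=1}^{n}\lambda_{i}-\sum_{i=1}^{n-1}\lambda_{n-1,i}\Big).$$ Let $s_q(\Lambda)$ be $$\prod_{1\le i\le m<n}\Big\{\prod_{i<j\le m}[\nu_{m,i}-\nu_{m,j}][\nu_i-\nu_{m,j}]\Big\}(-1)^{\nu_{m,i}-\nu_i}\big\{[\nu_{m,i}-\nu_i]_{(\lambda_i-\lambda_{m,i}-1)}!\big\}\Big\{\prod_{i<j\le m+1}[\nu_{m,i}-\nu_{m+1,j}]_{(\lambda_i-\lambda_{m,i}-1)}!\Big\}\Big\{\prod_{i\le j\le m-1}[\nu_{m,i}-\nu_{m-1,j}-1]_{(\lambda_i-\lambda_{m,i}-1)}!\Big\}.$$ Then: 1. $s_q(\Lambda)\in\{1,-1\}$ for every $\Lambda$, and $$s_q(\Lambda)=\prod_{1\le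 i\le m<n}\Big\{\prod_{i<j\le m}[\nu_{m,j}-\nu_{m,i}][\nu_{m,j}-\nu_i]\Big\}\big\{[\nu_{m,i}-\nu_i]_{(\lambda_i-\lambda_{m,i}-1)}!\big\}\Big\{\prod_{i<j\le m+1}[\nu_{m+1,j}-\nu_i-1]_{(\lambda_i-\lambda_{m,i}-1)}!\Big\}\Big\{\prod_{i\le j\le m-1}[\nu_{m-1,j}-\nu_i]_{(\lambda_i-\lambda_{m,i}-1)}!\Big\},$$ where the arguments $\nu_{m+1,j}-\nu_i-1$ and $\nu_{m-1,j}-\nu_i$ can also be written as $\nu_{m+1,j}-\nu_{m,i}+(\lambda_i-\lambda_{m,i}-1)$ and $\nu_{m-1,j}-\nu_{m,i}+(\lambda_i-\lambda_{m,i})$. 2. $L(\lambda)$ has a Gelfand–Tsetlin basis, that is, a basis $\{\zeta_\Lambda\}$ indexed by the patterns $\Lambda$ with top row $\lambda$ such that for all $1\le m\le n$ the $U_q(\mathfrak{gl}_m)$-submodule generated by $\zeta_\Lambda$ is irreducible with highest weight $(\lambda_{m,1},\dots,\lambda_{m,m})$, where $U_q(\mathfrak{gl}_m)\subseteq U_q(\mathfrak{gl}_n)$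 is the subalgebra generated by the $e_i,f_i$ with $i<m$ and the $K_j^{\pm1}$ with $j\le m$. Every such basis is orthogonal, satisfies $\zeta_\Lambda\in V_{\mathrm{wt}(\Lambda)}$, and the sign of $(\zeta_\Lambda,\zeta_\Lambda)$ is $s_q(\Lambda)$. 3. $$ch_s(L(\lambda))=\sum_{\Lambda}s_q(\Lambda)\,e^{\mathrm{wt}(\Lambda)},$$ the sum being over all Gelfand–Tsetlin patterns $\Lambda$ with top row $\lambda$. -/

import Mathlib

open scoped ComplexConjugate

/-! ### q-numbers -/

/-- `q ^ x` for `q = exp (π i s)` and a real exponent `x`. -/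
noncomputable def qPow (s x : ℝ) : ℂ := Complex.exp ((Real.pi * s * x : ℝ) * Complex.I)

/-- The q-number `[x] = (q ^ x - q ^ (-x)) / (q - q⁻¹) = sin (π s x) / sin (π s)`. -/
noncomputable def qNum (s x : ℝ) : ℝ := Real.sin (Real.pi * s * x) / Real.sin (Real.pi * s)

theorem qNum_eq (s x : ℝ) :
    (qNum s x : ℂ) = (qPow s x - qPow s (-x)) / (qPow s 1 - qPow s (-1)) := by
  have key : ∀ y : ℝ, qPow s y - qPow s (-y) =
      2 * Complex.I * (Real.sin (Real.pi * s * y) : ℂ) := by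
    intro y
    unfold qPow
    rw [Complex.ofReal_sin, Complex.sin]
    have h : ((Real.pi * s * -y : ℝ) : ℂ) * Complex.I =
        -((Real.pi * s * y : ℝ) : ℂ) * Complex.I := by
      push_cast; ring
    rw [h]
    linear_combination (-(Complex.exp (-((Real.pi * s * y : ℝ) : ℂ) * Complex.I) -
      Complex.exp (((Real.pi * s * y : ℝ) : ℂ) * Complex.I))) * Complex.I_mul_I
  rw [key, key, mul_div_mul_left _ _ (mul_ne_zero two_ne_zero Complex.I_ne_zero)]
  simp [qNum]

/-- The q-falling factorial `[x] [x - 1] ⋯ [x - (r - 1)]` with `r` factors.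
In the notation `[X]_k! = [X] [X - 1] ⋯ [X - k]` this is `[x]_{r-1}!`. -/
noncomputable def qFall (s x : ℝ) (r : ℕ) : ℝ := ∏ t ∈ Finset.range r, qNum s (x - t)

/-- The sign of a real number, as an integer. -/
noncomputable def sgn (x : ℝ) : ℤ := (SignType.sign x : ℤ)

/-! ### The quantum group -/

/-- Generators of `U_q(gl_n)`; the index `i` of `E i`, `F i` runs over `0, …, n - 2`, and the
index of `K j` and of its inverse over `0, …, n - 1`. -/
inductive UqGen (n : ℕ) : Type
  | E (i : Fin (n - 1)) : UqGen n
  | F (i : Fin (n - 1)) : UqGen n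
  | K (j : Fin n) : UqGen n
  | Kinv (j : Fin n) : UqGen n

/-- The position `i` in `{0, …, n - 1}`. -/
def lowPos {n : ℕ} (i : Fin (n - 1)) : Fin n := ⟨i, by omega⟩

/-- The position `i + 1` in `{0, …, n - 1}`. -/
def highPos {n : ℕ} (i : Fin (n - 1)) : Fin n := ⟨i + 1, by omega⟩

/-- The simple root `α_i = ε_i - ε_{i+1}` in `ℝ ^ n`. -/
noncomputable def simpleRoot {n : ℕ} (i : Fin (n - 1)) : Fin n → ℝ :=
  Pi.single (lowPos i) 1 - Pi.single (highPos i) 1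

namespace UqGen

/-- The generators as elements of the free algebra. -/
noncomputable def e {n : ℕ} (i : Fin (n - 1)) : FreeAlgebra ℂ (UqGen n) :=
  FreeAlgebra.ι ℂ (UqGen.E i)

noncomputable def f {n : ℕ} (i : Fin (n - 1)) : FreeAlgebra ℂ (UqGen n) :=
  FreeAlgebra.ι ℂ (UqGen.F i)

noncomputable def k {n : ℕ} (j : Fin n) : FreeAlgebra ℂ (UqGen n) :=
  FreeAlgebra.ι ℂ (UqGen.K j)

noncomputable def kinv {n : ℕ} (j : Fin n) : FreeAlgebra ℂ (UqGen n) :=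
  FreeAlgebra.ι ℂ (UqGen.Kinv j)

end UqGen

open UqGen in
/-- The defining (Drinfeld–Jimbo) relations of `U_q(gl_n)`, `q = exp (π i s)`. -/
inductive UqRel (n : ℕ) (s : ℝ) : FreeAlgebra ℂ (UqGen n) → FreeAlgebra ℂ (UqGen n) → Prop
  | k_kinv (j : Fin n) : UqRel n s (k j * kinv j) 1
  | kinv_k (j : Fin n) : UqRel n s (kinv j * k j) 1
  | k_comm (j l : Fin n) : UqRel n s (k j * k l) (k l * k j)
  | k_e (j : Fin n) (i : Fin (n - 1)) :
      UqRel n s (k j * e i) (qPow s (simpleRoot i j) • (e i * k j))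
  | k_f (j : Fin n) (i : Fin (n - 1)) :
      UqRel n s (k j * f i) (qPow s (-simpleRoot i j) • (f i * k j))
  | e_f_same (i : Fin (n - 1)) :
      UqRel n s (e i * f i - f i * e i)
        ((qPow s 1 - qPow s (-1))⁻¹ •
          (k (lowPos i) * kinv (highPos i) - kinv (lowPos i) * k (highPos i)))
  | e_f_ne (i j : Fin (n - 1)) (hij : i ≠ j) : UqRel n s (e i * f j) (f j * e i)
  | e_far (i j : Fin (n - 1)) (hij : (i : ℕ) + 1 < j) : UqRel n s (e i * e j) (e j * e i)
  | f_far (i j : Fin (n - 1)) (hij : (i : ℕ) + 1 < j) : UqRel n s (f i * f j) (f j * f i)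
  | e_serre (i j : Fin (n - 1)) (hij : (i : ℕ) + 1 = j ∨ (j : ℕ) + 1 = i) :
      UqRel n s
        (e i * e i * e j - (qPow s 1 + qPow s (-1)) • (e i * e j * e i) + e j * e i * e i) 0
  | f_serre (i j : Fin (n - 1)) (hij : (i : ℕ) + 1 = j ∨ (j : ℕ) + 1 = i) :
      UqRel n s
        (f i * f i * f j - (qPow s 1 + qPow s (-1)) • (f i * f j * f i) + f j * f i * f i) 0

/-- The quantum group `U_q(gl_n)` for `q = exp (π i s)`. -/
def Uq (n : ℕ) (s : ℝ) : Type := RingQuot (UqRel n s)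

namespace Uq

noncomputable instance (n : ℕ) (s : ℝ) : Ring (Uq n s) :=
  inferInstanceAs (Ring (RingQuot (UqRel n s)))

noncomputable instance (n : ℕ) (s : ℝ) : Algebra ℂ (Uq n s) :=
  inferInstanceAs (Algebra ℂ (RingQuot (UqRel n s)))

/-- The quotient map from the free algebra. -/
noncomputable def mk (n : ℕ) (s : ℝ) : FreeAlgebra ℂ (UqGen n) →ₐ[ℂ] Uq n s :=
  RingQuot.mkAlgHom ℂ (UqRel n s)

/-- The image of a generator in `U_q(gl_n)`. -/
noncomputable def gen {n : ℕ} (s : ℝ) (g : UqGen n) : Uq n s :=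
  mk n s (FreeAlgebra.ι ℂ g)

noncomputable def E {n : ℕ} (s : ℝ) (i : Fin (n - 1)) : Uq n s := gen s (UqGen.E i)

noncomputable def F {n : ℕ} (s : ℝ) (i : Fin (n - 1)) : Uq n s := gen s (UqGen.F i)

noncomputable def K {n : ℕ} (s : ℝ) (j : Fin n) : Uq n s := gen s (UqGen.K j)

noncomputable def Kinv {n : ℕ} (s : ℝ) (j : Fin n) : Uq n s := gen s (UqGen.Kinv j)

/-- The subalgebra `U_q(gl_m)` of `U_q(gl_n)`, generated by the `e_i`, `f_i` with `i < m - 1`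
and the `K_j`, `K_j⁻¹` with `j < m` (indices from `0`). -/
noncomputable def sub (n : ℕ) (s : ℝ) (m : ℕ) : Subalgebra ℂ (Uq n s) :=
  Algebra.adjoin ℂ
    ({x | ∃ i : Fin (n - 1), (i : ℕ) + 1 < m ∧ (x = E s i ∨ x = F s i)} ∪
      {x | ∃ j : Fin n, (j : ℕ) < m ∧ (x = K s j ∨ x = Kinv s j)})

end Uq

/-! ### Gelfand–Tsetlin patterns -/

/-- Gelfand–Tsetlin patterns with top row `lam`: triangular arrays whose row `m` (`1 ≤ m ≤ n`)
has the `m` entries `entry m i`, `0 ≤ i < m` (the second index starts at `0`), whose row `n` is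
`lam`, and which satisfy the interlacing conditions, all the differences there being
nonnegative integers.  Outside of the triangle `entry` is set to `0`. -/
@[ext] structure GTPattern {n : ℕ} (lam : Fin n → ℝ) where
  entry : ℕ → ℕ → ℝ
  top : ∀ i : Fin n, entry n i = lam i
  upper : ∀ m i : ℕ, i < m → m < n → ∃ k : ℕ, entry (m + 1) i - entry m i = k
  lower : ∀ m i : ℕ, i < m → m < n → ∃ k : ℕ, entry m i - entry (m + 1) (i + 1) = k
  outside : ∀ m i : ℕ, ¬(i < m ∧ m ≤ n) → entry m i = 0

namespace GTPattern

variable {n : ℕ} {lam : Fin n → ℝ}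

theorem exists_drop (P : GTPattern lam) (c m i : ℕ) (hm : m + c = n) (hi : i < m) :
    ∃ k : ℕ, P.entry n i - P.entry m i = k := by
  induction c generalizing m with
  | zero => exact ⟨0, by simp at hm; subst hm; simp⟩
  | succ c ih =>
    obtain ⟨k, hk⟩ := ih (m + 1) (by omega) (by omega)
    obtain ⟨l, hl⟩ := P.upper m i hi (by omega)
    exact ⟨k + l, by push_cast; linarith⟩

theorem entry_ge (P : GTPattern lam) (c m i : ℕ) (hm : m + c = n) (hi : i < m) :
    P.entry n (i + c) ≤ P.entry m i := by
  induction c generalizing m i with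
  | zero => simp at hm; subst hm; simp
  | succ c ih =>
    have h := ih (m + 1) (i + 1) (by omega) (by omega)
    obtain ⟨l, hl⟩ := P.lower m i hi (by omega)
    have hl0 : (0 : ℝ) ≤ l := Nat.cast_nonneg l
    have e : i + (c + 1) = i + 1 + c := by ring
    rw [e]
    linarith

instance : Finite (GTPattern lam) := by
  classical
  set C : ℝ := ∑ i, ∑ j, |lam i - lam j| with hC
  have bound : ∀ i j, lam i - lam j ≤ C := by
    intro i j
    calc lam i - lam j ≤ |lam i - lam j| := le_abs_self _
      _ ≤ ∑ j, |lam i - lam j| :=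
        Finset.single_le_sum (f := fun j => |lam i - lam j|) (fun _ _ => abs_nonneg _)
          (Finset.mem_univ j)
      _ ≤ C := Finset.single_le_sum (f := fun i => ∑ j, |lam i - lam j|)
          (fun _ _ => Finset.sum_nonneg fun _ _ => abs_nonneg _) (Finset.mem_univ i)
  have key : ∀ (P : GTPattern lam) (m i : ℕ), i < m → m ≤ n →
      ∃ k : ℕ, k ≤ ⌊C⌋₊ ∧ P.entry n i - P.entry m i = k := by
    intro P m i hi hm
    obtain ⟨k, hk⟩ := P.exists_drop (n - m) m i (by omega) hi
    refine ⟨k, ?_, hk⟩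
    have h1 := P.entry_ge (n - m) m i (by omega) hi
    have h2 := P.top ⟨i, by omega⟩
    have h3 := P.top ⟨i + (n - m), by omega⟩
    have h4 := bound ⟨i, by omega⟩ ⟨i + (n - m), by omega⟩
    simp only at h2 h3
    apply Nat.le_floor
    linarith
  let Φ : GTPattern lam → (Fin (n + 1) → Fin n → Fin (⌊C⌋₊ + 1)) := fun P m i =>
    if h : (i : ℕ) < m then
      ⟨(key P m i h (by omega)).choose,
        Nat.lt_succ_of_le (key P m i h (by omega)).choose_spec.1⟩
    else 0
  refine Finite.of_injective Φ ?_
  intro P Q hPQ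
  ext m i
  by_cases h : i < m ∧ m ≤ n
  · have h0 := congrFun (congrFun hPQ ⟨m, by omega⟩) ⟨i, by omega⟩
    have hlt : i < m := h.1
    simp only [Φ, hlt, dif_pos, Fin.mk.injEq] at h0
    have hP := (key P m i h.1 h.2).choose_spec.2
    have hQ := (key Q m i h.1 h.2).choose_spec.2
    rw [h0] at hP
    have tP := P.top ⟨i, by omega⟩
    have tQ := Q.top ⟨i, by omega⟩
    simp only at tP tQ
    linarith
  · rw [P.outside m i h, Q.outside m i h]

noncomputable instance : Fintype (GTPattern lam) := Fintype.ofFinite _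

/-- The coefficient `ν_{m,i}`.  With the second index starting at `0` it is
`(i + 1) - λ_{m,i} - 1 = i - λ_{m,i}`; the coefficient `ν_i` is `ν_{n,i}`. -/
noncomputable def nu (P : GTPattern lam) (m i : ℕ) : ℝ := i - P.entry m i

/-- The nonnegative integer `λ_i - λ_{m,i}`. -/
noncomputable def drop (P : GTPattern lam) (m i : ℕ) : ℕ := ⌊P.entry n i - P.entry m i⌋₊

/-- The weight of a pattern: its `k`-th coordinate is the difference of the sums of two
consecutive rows. -/
noncomputable def wt (P : GTPattern lam) : Fin n → ℝ := fun k =>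
  ∑ i ∈ Finset.range (k + 1), P.entry (k + 1) i - ∑ i ∈ Finset.range k, P.entry k i

/-- The sign `s_q` attached to a pattern. -/
noncomputable def signQ (s : ℝ) (P : GTPattern lam) : ℤ :=
  ∏ m ∈ Finset.range n, ∏ i ∈ Finset.range m,
    (sgn (∏ j ∈ Finset.Ico (i + 1) m,
        qNum s (P.nu m i - P.nu m j) * qNum s (P.nu n i - P.nu m j)) *
      (-1) ^ P.drop m i *
      sgn (qFall s (P.nu m i - P.nu n i) (P.drop m i)) *
      sgn (∏ j ∈ Finset.Ico (i + 1) (m + 1),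
        qFall s (P.nu m i - P.nu (m + 1) j) (P.drop m i)) *
      sgn (∏ j ∈ Finset.Ico i (m - 1),
        qFall s (P.nu m i - P.nu (m - 1) j - 1) (P.drop m i)))

/-- The first simplified form of the sign. -/
noncomputable def signQ' (s : ℝ) (P : GTPattern lam) : ℤ :=
  ∏ m ∈ Finset.range n, ∏ i ∈ Finset.range m,
    (sgn (∏ j ∈ Finset.Ico (i + 1) m,
        qNum s (P.nu m j - P.nu m i) * qNum s (P.nu m j - P.nu n i)) *
      sgn (qFall s (P.nu m i - P.nu n i) (P.drop m i)) *
      sgn (∏ j ∈ Finset.Ico (i + 1) (m + 1),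
        qFall s (P.nu (m + 1) j - P.nu m i + (P.drop m i - 1)) (P.drop m i)) *
      sgn (∏ j ∈ Finset.Ico i (m - 1),
        qFall s (P.nu (m - 1) j - P.nu m i + P.drop m i) (P.drop m i)))

/-- The second simplified form of the sign. -/
noncomputable def signQ'' (s : ℝ) (P : GTPattern lam) : ℤ :=
  ∏ m ∈ Finset.range n, ∏ i ∈ Finset.range m,
    (sgn (∏ j ∈ Finset.Ico (i + 1) m,
        qNum s (P.nu m j - P.nu m i) * qNum s (P.nu m j - P.nu n i)) *
      sgn (qFall s (P.nu m i - P.nu n i) (P.drop m i)) *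
      sgn (∏ j ∈ Finset.Ico (i + 1) (m + 1),
        qFall s (P.nu (m + 1) j - P.nu n i - 1) (P.drop m i)) *
      sgn (∏ j ∈ Finset.Ico i (m - 1),
        qFall s (P.nu (m - 1) j - P.nu n i) (P.drop m i)))

end GTPattern

/-! ### Signatures of Hermitian forms -/

section Signature

variable {V : Type*} [AddCommGroup V] [Module ℂ V]

/-- A basis of the subspace `W` that is orthogonal for the form `B`. -/
def IsOrthogonalBasis (B : V →ₗ⋆[ℂ] V →ₗ[ℂ] ℂ) {W : Submodule ℂ V} {ι : Type*}
    (b : Module.Basis ι ℂ W) : Prop :=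
  ∀ i j, i ≠ j → B (b i) (b j) = 0

open scoped Classical in
/-- The signature of `B` on the finite-dimensional subspace `W`: the sum of the signs of the
norms of the vectors of an orthogonal basis (independent of the basis, see `signature_eq`). -/
noncomputable def signature (B : V →ₗ⋆[ℂ] V →ₗ[ℂ] ℂ) (W : Submodule ℂ V) : ℤ :=
  if h : ∃ b : Module.Basis (Fin (Module.finrank ℂ W)) ℂ W, IsOrthogonalBasis B b then
    ∑ i, sgn (B (h.choose i) (h.choose i)).re
  else 0

theorem norm_eq_sum (B : V →ₗ⋆[ℂ] V →ₗ[ℂ] ℂ) {W : Submodule ℂ V} {ι : Type*} [Fintype ι]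
    (b : Module.Basis ι ℂ W) (hb : IsOrthogonalBasis B b) (w : W) :
    (B w w).re = ∑ i, Complex.normSq (b.repr w i) * (B (b i) (b i)).re := by
  classical
  have hw : (w : V) = ∑ i, b.repr w i • (b i : V) := by
    have h := congrArg (Submodule.subtype W) (b.sum_repr w)
    rw [map_sum] at h
    simpa using h.symm
  have h1 : B w w = ∑ i, ((Complex.normSq (b.repr w i) : ℝ) : ℂ) * B (b i) (b i) := by
    rw [hw]
    simp only [map_sum, LinearMap.sum_apply, LinearMap.map_smulₛₗ, LinearMap.smul_apply,
      smul_eq_mul, RingHom.id_apply]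
    refine Finset.sum_congr rfl fun i _ => ?_
    rw [Finset.sum_eq_single i]
    · rw [Complex.normSq_eq_conj_mul_self]; ring
    · intro j _ hj
      rw [hb j i hj]; simp
    · simp
  rw [h1, Complex.re_sum]
  refine Finset.sum_congr rfl fun i _ => ?_
  rw [Complex.re_ofReal_mul]

theorem card_pos_le (B : V →ₗ⋆[ℂ] V →ₗ[ℂ] ℂ) {W : Submodule ℂ V} {ι κ : Type*}
    [Fintype ι] [Fintype κ] (b : Module.Basis ι ℂ W) (c : Module.Basis κ ℂ W)
    (hb : IsOrthogonalBasis B b) (hc : IsOrthogonalBasis B c) (t : ℝ) :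
    Fintype.card {i // 0 < t * (B (b i) (b i)).re} ≤
      Fintype.card {k // 0 < t * (B (c k) (c k)).re} := by
  classical
  let f : W →ₗ[ℂ] ({k // 0 < t * (B (c k) (c k)).re} → ℂ) :=
    LinearMap.pi fun k => c.coord k
  let g : ({i // 0 < t * (B (b i) (b i)).re} → ℂ) →ₗ[ℂ] W :=
    Fintype.linearCombination ℂ fun i => b i
  have inj : Function.Injective (f ∘ₗ g) := by
    rw [← LinearMap.ker_eq_bot, LinearMap.ker_eq_bot']
    intro x hx
    set w := g x with hw
    have hcoord : ∀ k, 0 < t * (B (c k) (c k)).re → c.repr w k = 0 := by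
      intro k hk
      have := congrFun hx ⟨k, hk⟩
      simpa [f] using this
    have hle : t * (B w w).re ≤ 0 := by
      rw [norm_eq_sum B c hc w, Finset.mul_sum]
      refine Finset.sum_nonpos fun k _ => ?_
      by_cases hk : 0 < t * (B (c k) (c k)).re
      · simp [hcoord k hk]
      · push Not at hk
        have := mul_nonpos_of_nonneg_of_nonpos (Complex.normSq_nonneg (c.repr w k)) hk
        linarith
    have hrepr : ∀ i, b.repr w i = if h : 0 < t * (B (b i) (b i)).re then x ⟨i, h⟩ else 0 := by
      intro i
      simp only [hw, g, Fintype.linearCombination_apply, map_sum, map_smul,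
        Module.Basis.repr_self, Finsupp.coe_finsetSum, Finset.sum_apply, Finsupp.smul_apply,
        smul_eq_mul]
      split_ifs with h
      · rw [Finset.sum_eq_single ⟨i, h⟩]
        · simp
        · intro j _ hj
          have : (j : ι) ≠ i := fun e => hj (Subtype.ext e)
          simp [this]
        · simp
      · refine Finset.sum_eq_zero fun j _ => ?_
        have : (j : ι) ≠ i := fun e => h (e ▸ j.2)
        simp [this]
    rw [norm_eq_sum B b hb w, Finset.mul_sum] at hle
    have hterm : ∀ i ∈ Finset.univ,
        0 ≤ t * (Complex.normSq (b.repr w i) * (B (b i) (b i)).re) := by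
      intro i _
      by_cases h : 0 < t * (B (b i) (b i)).re
      · have := mul_nonneg (Complex.normSq_nonneg (b.repr w i)) h.le
        linarith
      · rw [hrepr i, dif_neg h]; simp
    have hzero := (Finset.sum_eq_zero_iff_of_nonneg hterm).1
      (le_antisymm hle (Finset.sum_nonneg hterm))
    funext i
    have h0 := hzero i (Finset.mem_univ _)
    rw [hrepr i, dif_pos i.2] at h0
    have h1 : Complex.normSq (x i) * (t * (B (b i) (b i)).re) = 0 := by linarith
    rcases mul_eq_zero.1 h1 with h2 | h2
    · simpa using Complex.normSq_eq_zero.1 h2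
    · exact absurd h2 i.2.ne'
  have := LinearMap.finrank_le_finrank_of_injective inj
  simpa using this

theorem sum_sgn {ι : Type*} [Fintype ι] (x : ι → ℝ) :
    ∑ i, sgn (x i) =
      (Fintype.card {i // 0 < (1 : ℝ) * x i} : ℤ) - Fintype.card {i // 0 < (-1 : ℝ) * x i} := by
  classical
  rw [Fintype.card_subtype, Fintype.card_subtype, Finset.card_filter, Finset.card_filter]
  push_cast
  rw [← Finset.sum_sub_distrib]
  refine Finset.sum_congr rfl fun i _ => ?_
  rcases lt_trichotomy (x i) 0 with h | h | h
  · simp [sgn, sign_neg h, h, not_lt.2 h.le]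
  · simp [sgn, h]
  · simp [sgn, sign_pos h, h, not_lt.2 h.le]

/-- Sylvester's law of inertia: the signature can be computed in any orthogonal basis. -/
theorem signature_eq (B : V →ₗ⋆[ℂ] V →ₗ[ℂ] ℂ) {W : Submodule ℂ V} {ι : Type*} [Fintype ι]
    (b : Module.Basis ι ℂ W) (hb : IsOrthogonalBasis B b) :
    signature B W = ∑ i, sgn (B (b i) (b i)).re := by
  classical
  have h : ∃ b : Module.Basis (Fin (Module.finrank ℂ W)) ℂ W, IsOrthogonalBasis B b := by
    let e : ι ≃ Fin (Module.finrank ℂ W) :=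
      Fintype.equivFinOfCardEq (Module.finrank_eq_card_basis b).symm
    refine ⟨b.reindex e, fun i j hij => ?_⟩
    simp only [Module.Basis.reindex_apply]
    exact hb _ _ fun h => hij (e.symm.injective h)
  rw [signature, dif_pos h, sum_sgn, sum_sgn]
  have hc := h.choose_spec
  rw [le_antisymm (card_pos_le B h.choose b hc hb 1)
      (card_pos_le B b h.choose hb hc 1),
    le_antisymm (card_pos_le B h.choose b hc hb (-1))
      (card_pos_le B b h.choose hb hc (-1))]

end Signature

/-! ### Highest weight modules, forms, weight spaces, Gelfand–Tsetlin bases -/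

section HighestWeight

variable {n : ℕ} {V : Type*} [AddCommGroup V] [Module ℂ V]

/-- `v` is a nonzero vector of weight `mu` killed by all `e_i` that belong to `U_q(gl_m)`,
where only the first `m` coordinates of `mu` matter. -/
structure IsHighestWeightVector (n : ℕ) (s : ℝ) {V : Type*} [AddCommGroup V] [Module ℂ V]
    [Module (Uq n s) V] (m : ℕ) (mu : ℕ → ℝ) (v : V) : Prop where
  ne_zero : v ≠ 0
  e_smul : ∀ i : Fin (n - 1), (i : ℕ) + 1 < m → Uq.E s i • v = 0
  k_smul : ∀ j : Fin n, (j : ℕ) < m → Uq.K s j • v = qPow s (mu j) • v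

/-- `V` is the irreducible module `L(lam)` with highest weight vector `v`. -/
structure IsIrreducibleHighestWeight {n : ℕ} (s : ℝ) (lam : Fin n → ℝ) (V : Type*)
    [AddCommGroup V] [Module ℂ V] [Module (Uq n s) V] (v : V) : Prop where
  simple : IsSimpleModule (Uq n s) V
  ne_zero : v ≠ 0
  e_smul : ∀ i : Fin (n - 1), Uq.E s i • v = 0
  k_smul : ∀ j : Fin n, Uq.K s j • v = qPow s (lam j) • v

/-- The standard (contravariant) Hermitian form: `e_i` and `f_i` are adjoint to each other, `K_j`
is adjoint to `K_j⁻¹` (the Cartan part acts unitarily, as `|q| = 1`), and the highest weight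
vector has positive norm. -/
structure IsStandardForm (n : ℕ) (s : ℝ) {V : Type*} [AddCommGroup V] [Module ℂ V]
    [Module (Uq n s) V] (v : V) (B : V →ₗ⋆[ℂ] V →ₗ[ℂ] ℂ) : Prop where
  hermitian : ∀ x y : V, B y x = conj (B x y)
  adjoint_e : ∀ (i : Fin (n - 1)) (x y : V), B (Uq.E s i • x) y = B x (Uq.F s i • y)
  adjoint_k : ∀ (j : Fin n) (x y : V), B (Uq.K s j • x) y = B x (Uq.Kinv s j • y)
  pos : 0 < (B v v).re

/-- The weight space of weight `mu` of a module generated by a vector `v` of highest weight `lam`: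
the span of the `f_{i_1} ⋯ f_{i_r} v` with `lam - α_{i_1} - ⋯ - α_{i_r} = mu`. -/
def weightSpace (s : ℝ) (lam : Fin n → ℝ) (v : V) [Module (Uq n s) V] (mu : Fin n → ℝ) :
    Submodule ℂ V :=
  Submodule.span ℂ {x | ∃ l : List (Fin (n - 1)),
    x = (l.map (Uq.F s)).prod • v ∧ mu = lam - (l.map simpleRoot).sum}

/-- The formal exponential `e^mu`; formal integer combinations of such exponentials are regarded
as functions from weights to integers. -/
noncomputable def formalExp (mu : Fin n → ℝ) : (Fin n → ℝ) → ℤ :=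
  open scoped Classical in Pi.single mu 1

/-- The signature character `∑_mu s(V_mu) e^mu`. -/
noncomputable def signatureCharacter (s : ℝ) (lam : Fin n → ℝ) (v : V) [Module (Uq n s) V]
    (B : V →ₗ⋆[ℂ] V →ₗ[ℂ] ℂ) : (Fin n → ℝ) → ℤ :=
  fun mu => signature B (weightSpace s lam v mu)

/-- A Gelfand–Tsetlin basis: a basis indexed by patterns such that, for every `m`, the vector of
index `P` generates an irreducible `U_q(gl_m)`-module whose highest weight is row `m` of `P`. -/
def IsGTBasis (s : ℝ) {lam : Fin n → ℝ} [Module (Uq n s) V]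
    (b : Module.Basis (GTPattern lam) ℂ V) : Prop :=
  ∀ (P : GTPattern lam) (m : ℕ), 1 ≤ m → m ≤ n →
    IsSimpleModule (Uq.sub n s m) (Submodule.span (Uq.sub n s m) {b P}) ∧
    ∃ w ∈ Submodule.span (Uq.sub n s m) {b P}, IsHighestWeightVector n s m (P.entry m) w

end HighestWeight

/-! The proof builds the module explicitly and then shows that every other one is a copy of it.
Since the entries of a pattern differ from the first entry of the top row by integers, everything is
done with integral patterns. On the vector space with basis the patterns, `raiseOp` and `lowerOp`
move single entries of one row, with coefficients that are products of q-numbers divided by the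
q-differences of that row. Genericity keeps every denominator nonzero, and no square roots occur:
the basis is orthogonal but not normalized, because a norm may be negative.

Norms. The form is declared diagonal, with norms `patternNorm` built from q-factorials so that
raising and lowering are adjoint (`patternNorm_add`). Its sign is s_q: falling factorials are
quotients of q-factorials, and in the product over rows the factors comparing a row with the top row
cancel telescopically (`sgn_patternNorm`).

Relations. For two moves at different positions the products of coefficients agree in both orders.
The diagonal part of the commutator of e_i and f_i is a Lagrange interpolation identity for
q-numbers (`sum_prod_qNum_div`, `sum_raise_lower`). The Serre relations are not computed. A Serre
element in the raising operators commutes with all lowering operators and kills the top vector, and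
lowering operators generate the whole space from that vector; hence it is 0. The relations for
lowering operators follow by adjointness, the form being nondegenerate.

Irreducibility. Fix rows m, m + 1, ... of a pattern. The patterns with these rows span a block
stable under U_q(gl_m). The key fact (`isMaxBelow_of_raiseOp_eq_zero`) is that a vector killed by
the raising operators below row m involves only patterns whose lower rows are as large as possible,
so a block contains one such vector up to scalars. With the nondegenerate form this makes every
block irreducible (`eq_blockSpace`). For m = n the block is the whole model; for smaller m it shows
that the patterns form a Gelfand–Tsetlin basis.

Uniqueness. In an irreducible highest weight module with a contravariant form, the form determines
the annihilator of the highest weight vector, because matrix coefficients can be computed from the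
relations and adjointness alone. So any such module is isometric to the model up to a positive
factor (`exists_isometry`). A vector of a Gelfand–Tsetlin basis is forced, row by row from the top,
into smaller and smaller blocks, and for m = 1 the block is a line (`exists_eq_smul_patVec`). Hence
each such basis is a rescaling of the pattern basis, and the signs of its norms are s_q. Sorting the
patterns by weight gives the signature character by Sylvester's law. -/

/-! ### q-numbers: algebra -/

section QNumbers

variable {s : ℝ}

theorem qPow_add (s x y : ℝ) : qPow s (x + y) = qPow s x * qPow s y := by
  unfold qPow
  rw [← Complex.exp_add]
  congr 1
  push_cast
  ring

theorem qPow_zero (s : ℝ) : qPow s 0 = 1 := by simp [qPow]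

theorem qPow_ne_zero (s x : ℝ) : qPow s x ≠ 0 := Complex.exp_ne_zero _

theorem qPow_mul_neg (s x : ℝ) : qPow s x * qPow s (-x) = 1 := by
  rw [← qPow_add, add_neg_cancel, qPow_zero]

theorem qPow_sum (s : ℝ) {ι : Type*} (S : Finset ι) (x : ι → ℝ) :
    qPow s (∑ i ∈ S, x i) = ∏ i ∈ S, qPow s (x i) := by
  classical
  induction S using Finset.induction_on with
  | empty => simp [qPow_zero]
  | insert a S ha ih => rw [Finset.sum_insert ha, Finset.prod_insert ha, qPow_add, ih]

theorem conj_qPow (s x : ℝ) : conj (qPow s x) = qPow s (-x) := by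
  unfold qPow
  rw [← Complex.exp_conj]
  congr 1
  simp

theorem qNum_zero (s : ℝ) : qNum s 0 = 0 := by simp [qNum]

theorem qNum_neg (s x : ℝ) : qNum s (-x) = -qNum s x := by
  simp [qNum, Real.sin_neg, neg_div]

theorem qNum_sub_comm (s x y : ℝ) : qNum s (x - y) = -qNum s (y - x) := by
  rw [← qNum_neg, neg_sub]

theorem qNum_one (hs : Real.sin (Real.pi * s) ≠ 0) : qNum s 1 = 1 := by
  simp [qNum, hs]

theorem qPow_one_sub_ne_zero (hs : Real.sin (Real.pi * s) ≠ 0) :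
    qPow s 1 - qPow s (-1) ≠ 0 := by
  intro h
  have h1 := qNum_eq s 1
  rw [h, qNum_one hs] at h1
  simp at h1

/-- The difference of the two monic polynomials with roots Z and Y has degree below the number of
nodes, so Lagrange interpolation at the Y k recovers it. The identity is its value at 0, up to the
common factor (-1)^|S| ∏ Y j. -/
theorem sum_prod_sub_div {ι : Type*} [DecidableEq ι] (S : Finset ι) (Y Z : ι → ℂ)
    (hY0 : ∀ i ∈ S, Y i ≠ 0) (hinj : Set.InjOn Y S) :
    ∑ k ∈ S, (∏ j ∈ S, (Z j - Y k)) / (Y k * ∏ j ∈ S.erase k, (Y j - Y k)) =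
      (∏ j ∈ S, Z j) / (∏ j ∈ S, Y j) - 1 := by
  rcases S.eq_empty_or_nonempty with rfl | hne
  · simp
  set p : Polynomial ℂ := Lagrange.nodal S Z - Lagrange.nodal S Y with hp
  have hdeg : p.degree < S.card := by
    rw [← Lagrange.degree_nodal (s := S) (v := Z)]
    apply Polynomial.degree_sub_lt_left
    · rw [Lagrange.degree_nodal, Lagrange.degree_nodal]
    · exact Lagrange.nodal_ne_zero
    · rw [Lagrange.nodal_monic.leadingCoeff, Lagrange.nodal_monic.leadingCoeff]
  have hint := Lagrange.eq_interpolate hinj hdeg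
  have h0 := congrArg (Polynomial.eval 0) hint
  rw [Lagrange.interpolate_apply, Polynomial.eval_finsetSum] at h0
  have hPY : ∏ j ∈ S, Y j ≠ 0 := Finset.prod_ne_zero_iff.2 hY0
  have hsgn : ∀ W : ι → ℂ, ∏ j ∈ S, (0 - W j) = (-1) ^ S.card * ∏ j ∈ S, W j := by
    intro W
    simp only [zero_sub]
    rw [← Finset.prod_const, ← Finset.prod_mul_distrib]
    simp
  have hl : Polynomial.eval 0 p = (-1) ^ S.card * (∏ j ∈ S, Z j - ∏ j ∈ S, Y j) := by
    rw [hp, Polynomial.eval_sub, Lagrange.eval_nodal, Lagrange.eval_nodal, hsgn, hsgn]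
    ring
  have hr : ∀ k ∈ S, Polynomial.eval 0 (Polynomial.C (Polynomial.eval (Y k) p) *
      Lagrange.basis S Y k) = (-1) ^ S.card * (∏ j ∈ S, Y j) *
        ((∏ j ∈ S, (Z j - Y k)) / (Y k * ∏ j ∈ S.erase k, (Y j - Y k))) := by
    intro k hk
    have e1 : Polynomial.eval (Y k) p = (-1) ^ S.card * ∏ j ∈ S, (Z j - Y k) := by
      rw [hp, Polynomial.eval_sub, Lagrange.eval_nodal_at_node hk, Lagrange.eval_nodal, sub_zero,
        ← Finset.prod_const, ← Finset.prod_mul_distrib]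
      exact Finset.prod_congr rfl fun j _ => by ring
    have e2 : Polynomial.eval 0 (Lagrange.basis S Y k) =
        (∏ j ∈ S.erase k, Y j) / ∏ j ∈ S.erase k, (Y j - Y k) := by
      rw [Lagrange.basis, Polynomial.eval_prod, ← Finset.prod_div_distrib]
      refine Finset.prod_congr rfl fun j hj => ?_
      simp only [Lagrange.basisDivisor, Polynomial.eval_mul, Polynomial.eval_C,
        Polynomial.eval_sub, Polynomial.eval_X, zero_sub]
      rw [← neg_sub (Y k) (Y j), div_neg, div_eq_mul_inv]
      ring
    rw [Polynomial.eval_mul, Polynomial.eval_C, e1, e2, ← Finset.mul_prod_erase S Y hk]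
    have := hY0 k hk
    field_simp
  rw [hl, Finset.sum_congr rfl hr, ← Finset.mul_sum, mul_assoc] at h0
  have h1 := mul_left_cancel₀ (pow_ne_zero _ (by norm_num)) h0
  rw [div_sub_one hPY, eq_div_iff hPY, h1, mul_comm]

/-- Up to a monomial, a q-number of a difference is a difference of the nodes q^(2x); in this form
interpolation applies. -/
theorem qPow_two_mul_sub (s x y : ℝ) :
    qPow s (x - y) - qPow s (-(x - y)) =
      qPow s (-x - y) * (qPow s (2 * x) - qPow s (2 * y)) := by
  rw [mul_sub, ← qPow_add, ← qPow_add]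
  congr 2 <;> ring

/-- This is `sum_prod_sub_div` for Y = q^(2y), Z = q^(2z). In term k the monomials collect to q^(∑ y
- ∑ z) divided by q^(2 y k), which is the extra factor Y k in the denominators there. -/
theorem sum_prod_qNum_div_of_ne (hs : Real.sin (Real.pi * s) ≠ 0) {ι : Type*} [DecidableEq ι]
    (S : Finset ι) (y z : ι → ℝ)
    (hy : ∀ j ∈ S, ∀ k ∈ S, j ≠ k → qNum s (y j - y k) ≠ 0) :
    ∑ k ∈ S, (∏ j ∈ S, qNum s (z j - y k)) / (∏ j ∈ S.erase k, qNum s (y j - y k)) =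
      qNum s (∑ j ∈ S, z j - ∑ j ∈ S, y j) := by
  have hD := qPow_one_sub_ne_zero hs
  set D := qPow s 1 - qPow s (-1) with hDdef
  apply Complex.ofReal_injective
  have hinj : Set.InjOn (fun j => qPow s (2 * y j)) S := by
    intro j hj k hk hjk
    by_contra hne
    apply hy j hj k hk hne
    apply Complex.ofReal_injective
    rw [qNum_eq, qPow_two_mul_sub]
    simp only at hjk
    simp [hjk]
  have key := sum_prod_sub_div S (fun j => qPow s (2 * y j)) (fun j => qPow s (2 * z j))
    (fun _ _ => qPow_ne_zero _ _) hinj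
  have hq : ∀ x y : ℝ, (qNum s (x - y) : ℂ) =
      qPow s (-x - y) * ((qPow s (2 * x) - qPow s (2 * y)) / D) := by
    intro x y
    rw [qNum_eq, qPow_two_mul_sub, mul_div_assoc]
  have hterm : ∀ k ∈ S, (((∏ j ∈ S, qNum s (z j - y k)) /
      (∏ j ∈ S.erase k, qNum s (y j - y k)) : ℝ) : ℂ) =
      qPow s (∑ j ∈ S, y j - ∑ j ∈ S, z j) / D *
      ((∏ j ∈ S, (qPow s (2 * z j) - qPow s (2 * y k))) /
        (qPow s (2 * y k) * ∏ j ∈ S.erase k, (qPow s (2 * y j) - qPow s (2 * y k)))) := by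
    intro k hk
    push_cast
    simp only [hq]
    rw [Finset.prod_mul_distrib, Finset.prod_mul_distrib, Finset.prod_div_distrib,
      Finset.prod_div_distrib, Finset.prod_const, Finset.prod_const, ← qPow_sum, ← qPow_sum,
      Finset.card_erase_of_mem hk]
    have hN : S.card = (S.card - 1) + 1 := by
      have := Finset.card_pos.2 ⟨k, hk⟩
      omega
    have hsum : qPow s (∑ j ∈ S, (-z j - y k)) * qPow s (2 * y k) =
        qPow s (∑ j ∈ S, y j - ∑ j ∈ S, z j) * qPow s (∑ j ∈ S.erase k, (-y j - y k)) := by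
      rw [← qPow_add, ← qPow_add]
      congr 1
      have := Finset.add_sum_erase S (fun j => -y j - y k) hk
      have h2 : ∑ j ∈ S.erase k, (-y j - y k) = ∑ j ∈ S, (-y j - y k) + 2 * y k := by
        linarith
      rw [h2]
      simp only [Finset.sum_sub_distrib, Finset.sum_neg_distrib]
      ring
    have hP : ∏ j ∈ S.erase k, (qPow s (2 * y j) - qPow s (2 * y k)) ≠ 0 := by
      refine Finset.prod_ne_zero_iff.2 fun j hj => ?_
      rw [Finset.mem_erase] at hj
      exact sub_ne_zero.2 fun h => hj.1 (hinj hj.2 hk h)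
    have hE := qPow_ne_zero s (∑ j ∈ S.erase k, (-y j - y k))
    have hE2 := qPow_ne_zero s (2 * y k)
    have hpow : D ^ S.card = D ^ (S.card - 1) * D := by
      rw [← pow_succ, ← hN]
    rw [hpow]
    have hDp : D ^ (S.card - 1) ≠ 0 := pow_ne_zero _ hD
    generalize ∏ j ∈ S.erase k, (qPow s (2 * y j) - qPow s (2 * y k)) = R at hP ⊢
    generalize ∏ j ∈ S, (qPow s (2 * z j) - qPow s (2 * y k)) = R'
    generalize qPow s (2 * y k) = a at hsum hE2 ⊢
    field_simp
    linear_combination R' * hsum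
  rw [Complex.ofReal_sum, Finset.sum_congr rfl hterm, ← Finset.mul_sum, key, hq, ← qPow_sum,
    ← qPow_sum, ← Finset.mul_sum, ← Finset.mul_sum]
  have h1 : qPow s (-∑ j ∈ S, z j - ∑ j ∈ S, y j) * qPow s (2 * ∑ j ∈ S, y j) =
      qPow s (∑ j ∈ S, y j - ∑ j ∈ S, z j) := by
    rw [← qPow_add]; congr 1; ring
  have hE2 := qPow_ne_zero s (2 * ∑ j ∈ S, y j)
  rw [← h1]
  generalize qPow s (2 * ∑ j ∈ S, y j) = a at hE2 ⊢
  field_simp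

/-- Indices with z = y are inert: their own term has a factor [0] in the numerator, hence is 0 even
if its denominator is 0, and in the other terms their factors cancel. On the remaining indices the
nodes are distinct. In the application, interlacing forces z = y exactly where nodes collide. -/
theorem sum_prod_qNum_div (hs : Real.sin (Real.pi * s) ≠ 0) {ι : Type*} [DecidableEq ι]
    (S : Finset ι) (y z : ι → ℝ)
    (hy : ∀ j ∈ S, ∀ k ∈ S, j ≠ k → qNum s (y j - y k) = 0 → z j = y j ∧ z k = y k) :
    ∑ k ∈ S, (∏ j ∈ S, qNum s (z j - y k)) /
        (∏ j ∈ S, if j = k then 1 else qNum s (y j - y k)) =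
      qNum s (∑ j ∈ S, z j - ∑ j ∈ S, y j) := by
  classical
  set T := S.filter fun j => z j ≠ y j with hT
  have hTS : T ⊆ S := Finset.filter_subset _ _
  have hout : ∀ j ∈ S, j ∉ T → z j = y j := by
    intro j hj hjT
    by_contra h
    exact hjT (Finset.mem_filter.2 ⟨hj, h⟩)
  have hne : ∀ j ∈ S, ∀ k ∈ T, j ≠ k → qNum s (y j - y k) ≠ 0 := by
    intro j hj k hk hjk h
    exact (Finset.mem_filter.1 hk).2 (hy j hj k (hTS hk) hjk h).2
  have hsum : ∑ j ∈ S, z j - ∑ j ∈ S, y j = ∑ j ∈ T, z j - ∑ j ∈ T, y j := by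
    rw [← Finset.sum_sub_distrib, ← Finset.sum_sub_distrib]
    refine (Finset.sum_subset hTS fun j hj hjT => ?_).symm
    rw [hout j hj hjT, sub_self]
  rw [hsum, ← sum_prod_qNum_div_of_ne hs T y z fun j hj k hk => hne j (hTS hj) k hk]
  refine (Finset.sum_subset_zero_on_sdiff hTS ?_ ?_).symm
  · intro k hk
    rw [Finset.mem_sdiff] at hk
    rw [Finset.prod_eq_zero hk.1, zero_div]
    rw [hout k hk.1 hk.2, sub_self, qNum_zero]
  · intro k hk
    have h1 : ∏ j ∈ S.erase k, (if j = k then 1 else qNum s (y j - y k)) =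
        ∏ j ∈ S.erase k, qNum s (y j - y k) :=
      Finset.prod_congr rfl fun j hj => by rw [if_neg (Finset.ne_of_mem_erase hj)]
    rw [← Finset.mul_prod_erase S (fun j => if j = k then 1 else qNum s (y j - y k)) (hTS hk),
      if_pos rfl, one_mul, h1, ← Finset.prod_sdiff hTS,
      ← Finset.prod_sdiff (Finset.erase_subset_erase k hTS)]
    have h2 : S.erase k \ T.erase k = S \ T := by
      ext j
      simp only [Finset.mem_sdiff, Finset.mem_erase]
      constructor
      · rintro ⟨⟨hjk, hj⟩, h⟩
        exact ⟨hj, fun hjT => h ⟨hjk, hjT⟩⟩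
      · rintro ⟨hj, h⟩
        exact ⟨⟨fun e => h (e ▸ hk), hj⟩, fun h' => h h'.2⟩
    rw [h2]
    have h3 : ∏ j ∈ S \ T, qNum s (z j - y k) = ∏ j ∈ S \ T, qNum s (y j - y k) := by
      refine Finset.prod_congr rfl fun j hj => ?_
      rw [Finset.mem_sdiff] at hj
      rw [hout j hj.1 hj.2]
    rw [h3, mul_div_mul_left]
    refine Finset.prod_ne_zero_iff.2 fun j hj => ?_
    rw [Finset.mem_sdiff] at hj
    exact hne j hj.1 k hk fun e => hj.2 (e ▸ hk)

end QNumbers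

/-! ### Integral patterns -/

/-- `x` is an integral Gelfand–Tsetlin pattern with top row `t`. -/
structure IsIntPattern (n : ℕ) (t : ℕ → ℤ) (x : ℕ → ℕ → ℤ) : Prop where
  top : ∀ i, i < n → x n i = t i
  upper : ∀ m i, i < m → m < n → x m i ≤ x (m + 1) i
  lower : ∀ m i, i < m → m < n → x (m + 1) (i + 1) ≤ x m i
  outside : ∀ m i, ¬(i < m ∧ m ≤ n) → x m i = 0

/-- Integral Gelfand–Tsetlin patterns with top row `t`. -/
abbrev IntPattern (n : ℕ) (t : ℕ → ℤ) : Type := {x : ℕ → ℕ → ℤ // IsIntPattern n t x}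

/-- The q-number of an integer. -/
noncomputable def qInt (s : ℝ) (z : ℤ) : ℝ := qNum s z

/-- The q-factorial `[z] [z - 1] ⋯ [1]` of a natural number (`1` for negative integers). -/
noncomputable def qFac (s : ℝ) (z : ℤ) : ℝ := ∏ k ∈ Finset.range z.toNat, qInt s (k + 1)

/-- The top row `t` is dominant and `[k] ≠ 0` in the range relevant for patterns. -/
structure IsGenericTop (n : ℕ) (s : ℝ) (t : ℕ → ℤ) : Prop where
  sin_ne : Real.sin (Real.pi * s) ≠ 0
  anti : ∀ i, i + 1 < n → t (i + 1) ≤ t i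
  qInt_pos : ∀ k : ℤ, 1 ≤ k → k ≤ t 0 - t (n - 1) + n - 2 → qInt s k ≠ 0

section

variable {n : ℕ} {s : ℝ} {t : ℕ → ℤ} {x : ℕ → ℕ → ℤ}

theorem qInt_neg (s : ℝ) (z : ℤ) : qInt s (-z) = -qInt s z := by
  rw [qInt, Int.cast_neg, qNum_neg, qInt]

theorem qInt_sub_comm (s : ℝ) (z w : ℤ) : qInt s (z - w) = -qInt s (w - z) := by
  rw [← qInt_neg, neg_sub]

theorem qInt_zero (s : ℝ) : qInt s 0 = 0 := by simp [qInt, qNum_zero]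

theorem qFac_zero (s : ℝ) : qFac s 0 = 1 := by simp [qFac]

theorem qFac_succ (s : ℝ) {z : ℤ} (hz : 0 ≤ z) : qFac s (z + 1) = qInt s (z + 1) * qFac s z := by
  obtain ⟨k, rfl⟩ := Int.eq_ofNat_of_zero_le hz
  have h1 : ((k : ℤ) + 1).toNat = k + 1 := by omega
  rw [qFac, h1, Finset.prod_range_succ, mul_comm, qFac, Int.toNat_natCast]

theorem qFac_eq_mul (s : ℝ) {z : ℤ} (hz : 1 ≤ z) : qFac s z = qInt s z * qFac s (z - 1) := by
  have h := qFac_succ s (z := z - 1) (by omega)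
  rwa [sub_add_cancel] at h

/-- For signs a quotient is as good as a product, so this trades falling factorials for
q-factorials. -/
theorem qFall_mul_qFac (s : ℝ) (z : ℤ) (r : ℕ) (h : (r : ℤ) ≤ z) :
    qFall s z r * qFac s (z - r) = qFac s z := by
  induction r with
  | zero => simp [qFall]
  | succ r ih =>
    rw [← ih (by push_cast at h; omega), qFall, Finset.prod_range_succ, ← qFall, mul_assoc]
    congr 1
    rw [qFac_eq_mul s (z := z - r) (by push_cast at h; omega), qInt]
    push_cast
    rw [sub_sub]

namespace IsGenericTop

theorem qInt_ne (hg : IsGenericTop n s t) {z : ℤ} (h0 : z ≠ 0)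
    (h1 : z ≤ t 0 - t (n - 1) + n - 2) (h2 : -z ≤ t 0 - t (n - 1) + n - 2) : qInt s z ≠ 0 := by
  rcases lt_or_gt_of_ne h0 with h | h
  · rw [← neg_neg z, qInt_neg]
    exact neg_ne_zero.2 (hg.qInt_pos _ (by omega) h2)
  · exact hg.qInt_pos _ (by omega) h1

theorem qFac_ne (hg : IsGenericTop n s t) {z : ℤ} (h1 : z ≤ t 0 - t (n - 1) + n - 2) :
    qFac s z ≠ 0 := by
  refine Finset.prod_ne_zero_iff.2 fun k hk => ?_
  rw [Finset.mem_range] at hk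
  exact hg.qInt_pos _ (by omega) (by omega)

end IsGenericTop

namespace IsIntPattern

theorem drop_le (hx : IsIntPattern n t x) (c m i : ℕ) (hm : m + c = n) (hi : i < m) :
    x m i ≤ t i := by
  induction c generalizing m with
  | zero => obtain rfl : m = n := by omega
            exact (hx.top i hi).le
  | succ c ih => exact (hx.upper m i hi (by omega)).trans (ih (m + 1) (by omega) (by omega))

theorem le_top (hx : IsIntPattern n t x) {m i : ℕ} (hi : i < m) (hm : m ≤ n) : x m i ≤ t i :=
  hx.drop_le (n - m) m i (by omega) hi

theorem ge_aux (hx : IsIntPattern n t x) (c m i : ℕ) (hm : m + c = n) (hi : i < m) :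
    t (i + c) ≤ x m i := by
  induction c generalizing m i with
  | zero => obtain rfl : m = n := by omega
            exact (hx.top i hi).ge
  | succ c ih =>
    have h := ih (m + 1) (i + 1) (by omega) (by omega)
    rw [show i + (c + 1) = i + 1 + c by ring]
    exact h.trans (hx.lower m i hi (by omega))

theorem row_succ (hx : IsIntPattern n t x) (hg : IsGenericTop n s t) {m i : ℕ} (hi : i + 1 < m)
    (hm : m ≤ n) : x m (i + 1) ≤ x m i := by
  rcases hm.eq_or_lt with rfl | hm
  · rw [hx.top _ hi, hx.top _ (by omega)]
    exact hg.anti i hi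
  · exact (hx.upper m (i + 1) hi hm).trans (hx.lower m i (by omega) hm)

theorem row_anti (hx : IsIntPattern n t x) (hg : IsGenericTop n s t) {m i j : ℕ} (hij : i ≤ j)
    (hj : j < m) (hm : m ≤ n) : x m j ≤ x m i := by
  induction j, hij using Nat.le_induction with
  | base => exact le_rfl
  | succ j hij ih => exact (hx.row_succ hg hj hm).trans (ih (by omega))

theorem top_anti (hg : IsGenericTop n s t) {i j : ℕ} (hij : i ≤ j) (hj : j < n) : t j ≤ t i := by
  induction j, hij using Nat.le_induction with
  | base => exact le_rfl
  | succ j hij ih => exact (hg.anti j hj).trans (ih (by omega))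

theorem le_max (hx : IsIntPattern n t x) (hg : IsGenericTop n s t) {m i : ℕ} (hi : i < m)
    (hm : m ≤ n) : x m i ≤ t 0 :=
  (hx.le_top hi hm).trans (top_anti hg (Nat.zero_le i) (by omega))

theorem ge_min (hx : IsIntPattern n t x) (hg : IsGenericTop n s t) {m i : ℕ} (hi : i < m)
    (hm : m ≤ n) : t (n - 1) ≤ x m i :=
  (top_anti hg (show i + (n - m) ≤ n - 1 by omega) (by omega)).trans
    (hx.ge_aux (n - m) m i (by omega) hi)

end IsIntPattern

end

/-! ### Real and integral patterns -/

namespace GTPattern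

variable {n : ℕ} {s : ℝ} {lam : Fin n → ℝ}

/-- The first entry of `lam`, to which the entries of integral patterns are relative. -/
noncomputable def baseEntry (lam : Fin n → ℝ) : ℝ := if h : 0 < n then lam ⟨0, h⟩ else 0

/-- The row `lam` relative to its first entry. -/
noncomputable def intTop (lam : Fin n → ℝ) (i : ℕ) : ℤ :=
  if h : i < n then ⌊lam ⟨i, h⟩ - baseEntry lam⌋ else 0

theorem lam_eq (hlam : ∀ i j : Fin n, (j : ℕ) = i + 1 → ∃ k : ℕ, lam i - lam j = k) (i : ℕ)
    (h : i < n) : lam ⟨i, h⟩ = baseEntry lam + intTop lam i := by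
  suffices ∃ k : ℤ, lam ⟨i, h⟩ - baseEntry lam = k by
    obtain ⟨k, hk⟩ := this
    rw [intTop, dif_pos h, hk, Int.floor_intCast]
    linarith
  induction i with
  | zero => exact ⟨0, by simp [baseEntry, h]⟩
  | succ i ih =>
    obtain ⟨k, hk⟩ := ih (by omega)
    obtain ⟨l, hl⟩ := hlam ⟨i, by omega⟩ ⟨i + 1, h⟩ rfl
    exact ⟨k - l, by push_cast; linarith⟩

/-- The entries of a pattern relative to the first entry of its top row. -/
noncomputable def intEntry (P : GTPattern lam) (m i : ℕ) : ℤ :=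
  if i < m ∧ m ≤ n then ⌊P.entry m i - baseEntry lam⌋ else 0

theorem entry_eq (hlam : ∀ i j : Fin n, (j : ℕ) = i + 1 → ∃ k : ℕ, lam i - lam j = k)
    (P : GTPattern lam) {m i : ℕ} (hi : i < m) (hm : m ≤ n) :
    P.entry m i = baseEntry lam + P.intEntry m i := by
  obtain ⟨k, hk⟩ := P.exists_drop (n - m) m i (by omega) hi
  have h1 := P.top ⟨i, by omega⟩
  have h2 := lam_eq hlam i (by omega)
  simp only at h1
  have h3 : P.entry m i - baseEntry lam = ((intTop lam i - k : ℤ) : ℝ) := by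
    push_cast; linarith
  rw [intEntry, if_pos ⟨hi, hm⟩, h3, Int.floor_intCast, ← h3]
  ring

theorem isIntPattern (hlam : ∀ i j : Fin n, (j : ℕ) = i + 1 → ∃ k : ℕ, lam i - lam j = k)
    (P : GTPattern lam) : IsIntPattern n (intTop lam) P.intEntry where
  top i hi := by
    have h1 := P.top ⟨i, hi⟩
    rw [intEntry, if_pos ⟨hi, le_rfl⟩, intTop, dif_pos hi, ← h1]
  upper m i hi hm := by
    obtain ⟨k, hk⟩ := P.upper m i hi hm
    rw [entry_eq hlam P hi hm.le, entry_eq hlam P (by omega : i < m + 1) hm] at hk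
    have : P.intEntry (m + 1) i - P.intEntry m i = k := by
      have h : ((P.intEntry (m + 1) i - P.intEntry m i : ℤ) : ℝ) = ((k : ℤ) : ℝ) := by
        push_cast; linarith
      exact_mod_cast h
    omega
  lower m i hi hm := by
    obtain ⟨k, hk⟩ := P.lower m i hi hm
    rw [entry_eq hlam P hi hm.le, entry_eq hlam P (by omega : i + 1 < m + 1) hm] at hk
    have : P.intEntry m i - P.intEntry (m + 1) (i + 1) = k := by
      have h : ((P.intEntry m i - P.intEntry (m + 1) (i + 1) : ℤ) : ℝ) = ((k : ℤ) : ℝ) := by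
        push_cast; linarith
      exact_mod_cast h
    omega
  outside m i h := by rw [intEntry, if_neg h]

/-- Patterns with real entries correspond to integral patterns. -/
noncomputable def equivInt
    (hlam : ∀ i j : Fin n, (j : ℕ) = i + 1 → ∃ k : ℕ, lam i - lam j = k) :
    GTPattern lam ≃ IntPattern n (intTop lam) where
  toFun P := ⟨P.intEntry, P.isIntPattern hlam⟩
  invFun x :=
    { entry := fun m i => if i < m ∧ m ≤ n then baseEntry lam + x.1 m i else 0
      top := fun i => by
        rw [if_pos ⟨i.2, le_rfl⟩, x.2.top i i.2, ← lam_eq hlam i i.2]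
      upper := fun m i hi hm => by
        rw [if_pos ⟨by omega, by omega⟩, if_pos ⟨hi, hm.le⟩]
        have h := x.2.upper m i hi hm
        refine ⟨(x.1 (m + 1) i - x.1 m i).toNat, ?_⟩
        have h2 : (((x.1 (m + 1) i - x.1 m i).toNat : ℤ) : ℝ) = (x.1 (m + 1) i - x.1 m i : ℤ) := by
          rw [Int.toNat_of_nonneg (by omega)]
        push_cast at h2 ⊢
        rw [h2]; ring
      lower := fun m i hi hm => by
        rw [if_pos ⟨hi, hm.le⟩, if_pos ⟨by omega, by omega⟩]
        have h := x.2.lower m i hi hm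
        refine ⟨(x.1 m i - x.1 (m + 1) (i + 1)).toNat, ?_⟩
        have h2 : (((x.1 m i - x.1 (m + 1) (i + 1)).toNat : ℤ) : ℝ) =
            (x.1 m i - x.1 (m + 1) (i + 1) : ℤ) := by
          rw [Int.toNat_of_nonneg (by omega)]
        push_cast at h2 ⊢
        rw [h2]; ring
      outside := fun m i h => if_neg h }
  left_inv P := by
    ext m i
    simp only
    split_ifs with h
    · exact (entry_eq hlam P h.1 h.2).symm
    · exact (P.outside m i h).symm
  right_inv x := by
    apply Subtype.ext
    funext m i
    simp only [intEntry]
    split_ifs with h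
    · simp
    · exact (x.2.outside m i h).symm

theorem isGenericTop (hs : Real.sin (Real.pi * s) ≠ 0)
    (hlam : ∀ i j : Fin n, (j : ℕ) = i + 1 → ∃ k : ℕ, lam i - lam j = k)
    (hq : ∀ (i j : Fin n) (k : ℕ), 1 ≤ k → (k : ℝ) ≤ lam i - lam j + n - 2 → qNum s k ≠ 0) :
    IsGenericTop n s (intTop lam) where
  sin_ne := hs
  anti i hi := by
    obtain ⟨k, hk⟩ := hlam ⟨i, by omega⟩ ⟨i + 1, hi⟩ rfl
    rw [lam_eq hlam, lam_eq hlam] at hk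
    have h : (intTop lam i - intTop lam (i + 1) : ℤ) = k := by
      have : ((intTop lam i - intTop lam (i + 1) : ℤ) : ℝ) = ((k : ℤ) : ℝ) := by
        push_cast; linarith
      exact_mod_cast this
    omega
  qInt_pos k hk1 hk2 := by
    obtain ⟨l, rfl⟩ := Int.eq_ofNat_of_zero_le (show 0 ≤ k by omega)
    have hn : 0 < n := by
      by_contra h
      have h0 : n = 0 := by omega
      subst h0
      simp at hk2
      omega
    have := hq ⟨0, hn⟩ ⟨n - 1, by omega⟩ l (by omega) (by
      rw [lam_eq hlam, lam_eq hlam]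
      have h : (((l : ℤ) : ℝ)) ≤ ((intTop lam 0 - intTop lam (n - 1) + n - 2 : ℤ) : ℝ) := by
        exact_mod_cast hk2
      push_cast at h
      linarith)
    rw [qInt]
    exact_mod_cast this

end GTPattern

/-! ### Signs -/

section Sign

theorem sgn_mul (x y : ℝ) : sgn (x * y) = sgn x * sgn y := by
  simp [sgn, sign_mul]

theorem sgn_one : sgn 1 = 1 := by simp [sgn]

theorem sgn_prod {ι : Type*} (S : Finset ι) (f : ι → ℝ) :
    sgn (∏ i ∈ S, f i) = ∏ i ∈ S, sgn (f i) := by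
  classical
  induction S using Finset.induction_on with
  | empty => simp [sgn_one]
  | insert a S ha ih => rw [Finset.prod_insert ha, Finset.prod_insert ha, sgn_mul, ih]

theorem sgn_neg (x : ℝ) : sgn (-x) = -sgn x := by
  simp [sgn, Left.sign_neg]

theorem sgn_of_pos {x : ℝ} (hx : 0 < x) : sgn x = 1 := by simp [sgn, sign_pos hx]

theorem sgn_mul_self {x : ℝ} (hx : x ≠ 0) : sgn x * sgn x = 1 := by
  rw [← sgn_mul, sgn_of_pos (mul_self_pos.2 hx)]

theorem sgn_inv (x : ℝ) : sgn x⁻¹ = sgn x := by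
  rcases lt_trichotomy x 0 with h | h | h
  · simp [sgn, sign_neg h, sign_neg (inv_lt_zero.2 h)]
  · simp [h]
  · rw [sgn_of_pos h, sgn_of_pos (inv_pos.2 h)]

theorem sgn_eq_one_or {x : ℝ} (hx : x ≠ 0) : sgn x = 1 ∨ sgn x = -1 := by
  rcases lt_or_gt_of_ne hx with h | h
  · right; simp [sgn, sign_neg h]
  · left; exact sgn_of_pos h

theorem pos_of_sgn_eq_one {x : ℝ} (hx : sgn x = 1) : 0 < x := by
  rcases lt_trichotomy x 0 with h | h | h
  · simp [sgn, sign_neg h] at hx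
  · simp [sgn, h] at hx
  · exact h

/-- Listing the factors in reverse order, each is the negative of the corresponding factor on the
other side. -/
theorem qFall_reflect (s x : ℝ) (r : ℕ) :
    qFall s (-x + (r - 1)) r = (-1) ^ r * qFall s x r := by
  have hpow : (-1 : ℝ) ^ r = ∏ _k ∈ Finset.range r, (-1 : ℝ) := by simp
  rw [qFall, qFall, ← Finset.prod_range_reflect (fun t : ℕ => qNum s (x - t)) r, hpow,
    ← Finset.prod_mul_distrib]
  refine Finset.prod_congr rfl fun k hk => ?_
  rw [Finset.mem_range] at hk
  rw [neg_one_mul, ← qNum_neg]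
  congr 1
  have : ((r - 1 - k : ℕ) : ℝ) = r - 1 - k := by
    rw [Nat.cast_sub (by omega), Nat.cast_sub (by omega)]; simp
  rw [this]; ring

end Sign

/-! ### Agreement of the three expressions for the sign of a pattern. -/

namespace GTPattern

variable {n : ℕ} {lam : Fin n → ℝ}

/-- Each reflected falling factorial costs (-1)^D, where D is the drop. For given m and i there are
(m - i) + (m - 1 - i) of them, an odd number, which absorbs the explicit (-1)^D. The remaining
q-numbers change sign in pairs. -/
theorem signQ_eq_signQ' (s : ℝ) (P : GTPattern lam) : P.signQ s = P.signQ' s := by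
  refine Finset.prod_congr rfl fun m _ => Finset.prod_congr rfl fun i hi => ?_
  rw [Finset.mem_range] at hi
  have h1 : ∀ j, qNum s (P.nu m i - P.nu m j) * qNum s (P.nu n i - P.nu m j) =
      qNum s (P.nu m j - P.nu m i) * qNum s (P.nu m j - P.nu n i) := by
    intro j
    rw [qNum_sub_comm s (P.nu m i), qNum_sub_comm s (P.nu n i)]
    ring
  have h2 : ∀ j, qFall s (P.nu (m + 1) j - P.nu m i + (P.drop m i - 1)) (P.drop m i) =
      (-1) ^ P.drop m i * qFall s (P.nu m i - P.nu (m + 1) j) (P.drop m i) := by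
    intro j
    rw [← qFall_reflect, neg_sub]
  have h3 : ∀ j, qFall s (P.nu (m - 1) j - P.nu m i + P.drop m i) (P.drop m i) =
      (-1) ^ P.drop m i * qFall s (P.nu m i - P.nu (m - 1) j - 1) (P.drop m i) := by
    intro j
    rw [← qFall_reflect]
    congr 1
    ring
  have hs1 : sgn (-1) = -1 := by rw [sgn_neg, sgn_one]
  have hpow : ∀ (k : ℕ), sgn ((-1) ^ k) = (-1) ^ k := by
    intro k
    induction k with
    | zero => simp [sgn_one]
    | succ k ih => rw [pow_succ, sgn_mul, ih, hs1, pow_succ]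
  simp only [h1, h2, h3, Finset.prod_mul_distrib, Finset.prod_const, Nat.card_Ico, sgn_mul,
    ← pow_mul, hpow]
  generalize P.drop m i = D
  have hsign : ((-1 : ℤ)) ^ (D * (m + 1 - (i + 1))) * (-1) ^ (D * (m - 1 - i)) = (-1) ^ D := by
    obtain ⟨k, rfl⟩ : ∃ k, m = i + k + 1 := ⟨m - i - 1, by omega⟩
    rw [show i + k + 1 + 1 - (i + 1) = k + 1 by omega, show i + k + 1 - 1 - i = k by omega,
      ← pow_add, show D * (k + 1) + D * k = 2 * (D * k) + D by ring, pow_add, pow_mul]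
    simp
  rw [← hsign]
  ring

theorem drop_eq (P : GTPattern lam) {m i : ℕ} (hi : i < m) (hm : m ≤ n) :
    (P.drop m i : ℝ) = P.entry n i - P.entry m i := by
  obtain ⟨k, hk⟩ := P.exists_drop (n - m) m i (by omega) hi
  rw [drop, hk, Nat.floor_natCast]

theorem signQ'_eq_signQ'' (s : ℝ) (P : GTPattern lam) : P.signQ' s = P.signQ'' s := by
  refine Finset.prod_congr rfl fun m hm => Finset.prod_congr rfl fun i hi => ?_
  rw [Finset.mem_range] at hi hm
  have h := P.drop_eq hi hm.le
  have h1 : ∀ y, y - P.nu m i + ((P.drop m i : ℝ) - 1) = y - P.nu n i - 1 := by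
    intro y; rw [h, nu, nu]; ring
  have h2 : ∀ y, y - P.nu m i + (P.drop m i : ℝ) = y - P.nu n i := by
    intro y; rw [h, nu, nu]; ring
  simp only [h1, h2]

end GTPattern

/-! ### The norm of a pattern -/

/-- The shifted entries `x_{m,i} - i` of an integral array. -/
def shiftedRow (x : ℕ → ℕ → ℤ) (m i : ℕ) : ℤ := x m i - i

/-- The q-Vandermonde product of a row. -/
noncomputable def rowProd (s : ℝ) (r : ℕ) (u : ℕ → ℤ) : ℝ :=
  ∏ i ∈ Finset.range r, ∏ j ∈ Finset.Ico (i + 1) r, qInt s (u i - u j)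

/-- The product of the q-factorials of the differences `w i - u j` with `i ≤ j < r`. -/
noncomputable def upperProd (s : ℝ) (r : ℕ) (w u : ℕ → ℤ) : ℝ :=
  ∏ i ∈ Finset.range r, ∏ j ∈ Finset.Ico i r, qFac s (w i - u j)

/-- The product of the q-factorials of the numbers `u i - w j - 1` with `i < j ≤ r`. -/
noncomputable def lowerProd (s : ℝ) (r : ℕ) (u w : ℕ → ℤ) : ℝ :=
  ∏ i ∈ Finset.range r, ∏ j ∈ Finset.Ico (i + 1) (r + 1), qFac s (u i - w j - 1)

/-- The contribution of two consecutive rows to the norm of a pattern. -/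
noncomputable def normFactor (s : ℝ) (r : ℕ) (u w : ℕ → ℤ) : ℝ :=
  (rowProd s r u)⁻¹ * upperProd s r w u * (lowerProd s r u w)⁻¹

/-- The norm of the basis vector attached to an integral pattern. -/
noncomputable def patternNorm (n : ℕ) (s : ℝ) (x : ℕ → ℕ → ℤ) : ℝ :=
  (∏ r ∈ Finset.range n, normFactor s r (shiftedRow x r) (shiftedRow x (r + 1))) *
    ∏ i ∈ Finset.range n, ∏ j ∈ Finset.Ico (i + 1) n,
      qFac s (shiftedRow x n i - shiftedRow x n j - 1)

section

variable {n : ℕ} {s : ℝ} {t : ℕ → ℤ} {x : ℕ → ℕ → ℤ}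

namespace IsIntPattern

theorem row_sub_pos (hx : IsIntPattern n t x) (hg : IsGenericTop n s t) {m i j : ℕ} (hij : i < j)
    (hj : j < m) (hm : m ≤ n) : 1 ≤ shiftedRow x m i - shiftedRow x m j := by
  have := hx.row_anti hg hij.le hj hm
  unfold shiftedRow
  omega

theorem row_sub_le (hx : IsIntPattern n t x) (hg : IsGenericTop n s t) {m m' i j : ℕ}
    (hi : i < m) (hm : m ≤ n) (hj : j < m') (hm' : m' ≤ n) :
    shiftedRow x m i - shiftedRow x m' j ≤ t 0 - t (n - 1) + j - i := by
  have h1 := hx.le_max hg hi hm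
  have h2 := hx.ge_min hg hj hm'
  unfold shiftedRow
  omega

theorem upper_sub_nonneg (hx : IsIntPattern n t x) (hg : IsGenericTop n s t) {m i j : ℕ}
    (hij : i ≤ j) (hj : j < m) (hm : m < n) :
    0 ≤ shiftedRow x (m + 1) i - shiftedRow x m j := by
  have h1 := hx.row_anti hg hij hj hm.le
  have h2 := hx.upper m i (by omega) hm
  unfold shiftedRow
  omega

theorem lower_sub_pos (hx : IsIntPattern n t x) (hg : IsGenericTop n s t) {m i j : ℕ}
    (hij : i < j) (hj : j ≤ m) (hm : m < n) :
    1 ≤ shiftedRow x m i - shiftedRow x (m + 1) j := by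
  have h1 := hx.row_anti hg (show i + 1 ≤ j by omega) (show j < m + 1 by omega) hm
  have h2 := hx.lower m i (by omega) hm
  unfold shiftedRow
  omega

theorem rowProd_ne (hx : IsIntPattern n t x) (hg : IsGenericTop n s t) {r : ℕ} (hr : r < n) :
    rowProd s r (shiftedRow x r) ≠ 0 := by
  refine Finset.prod_ne_zero_iff.2 fun i hi => Finset.prod_ne_zero_iff.2 fun j hj => ?_
  rw [Finset.mem_range] at hi
  rw [Finset.mem_Ico] at hj
  have h1 := hx.row_sub_pos hg (show i < j by omega) hj.2 hr.le
  have h2 := hx.row_sub_le hg hi hr.le hj.2 hr.le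
  exact hg.qInt_ne (by omega) (by omega) (by omega)

theorem upperProd_ne (hx : IsIntPattern n t x) (hg : IsGenericTop n s t) {r : ℕ} (hr : r < n) :
    upperProd s r (shiftedRow x (r + 1)) (shiftedRow x r) ≠ 0 := by
  refine Finset.prod_ne_zero_iff.2 fun i hi => Finset.prod_ne_zero_iff.2 fun j hj => ?_
  rw [Finset.mem_range] at hi
  rw [Finset.mem_Ico] at hj
  have h2 := hx.row_sub_le hg (show i < r + 1 by omega) hr hj.2 hr.le
  exact hg.qFac_ne (by omega)

theorem lowerProd_ne (hx : IsIntPattern n t x) (hg : IsGenericTop n s t) {r : ℕ} (hr : r < n) :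
    lowerProd s r (shiftedRow x r) (shiftedRow x (r + 1)) ≠ 0 := by
  refine Finset.prod_ne_zero_iff.2 fun i hi => Finset.prod_ne_zero_iff.2 fun j hj => ?_
  rw [Finset.mem_range] at hi
  rw [Finset.mem_Ico] at hj
  have h2 := hx.row_sub_le hg hi hr.le hj.2 hr
  exact hg.qFac_ne (by omega)

theorem normFactor_ne (hx : IsIntPattern n t x) (hg : IsGenericTop n s t) {r : ℕ} (hr : r < n) :
    normFactor s r (shiftedRow x r) (shiftedRow x (r + 1)) ≠ 0 :=
  mul_ne_zero (mul_ne_zero (inv_ne_zero (hx.rowProd_ne hg hr)) (hx.upperProd_ne hg hr))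
    (inv_ne_zero (hx.lowerProd_ne hg hr))

theorem patternNorm_ne (hx : IsIntPattern n t x) (hg : IsGenericTop n s t) :
    patternNorm n s x ≠ 0 := by
  refine mul_ne_zero (Finset.prod_ne_zero_iff.2 fun r hr =>
    hx.normFactor_ne hg (Finset.mem_range.1 hr)) ?_
  refine Finset.prod_ne_zero_iff.2 fun i hi => Finset.prod_ne_zero_iff.2 fun j hj => ?_
  rw [Finset.mem_range] at hi
  rw [Finset.mem_Ico] at hj
  have h2 := hx.row_sub_le hg hi le_rfl hj.2 le_rfl
  exact hg.qFac_ne (by omega)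

end IsIntPattern

/-! ### The sign of the norm -/

theorem sgn_qFall (hg : IsGenericTop n s t) {z w : ℤ} {r : ℕ} (h : z - r = w) (h0 : 0 ≤ w)
    (h1 : w ≤ t 0 - t (n - 1) + n - 2) :
    sgn (qFall s z r) = sgn (qFac s z) * sgn (qFac s w) := by
  have key := qFall_mul_qFac s z r (by omega)
  rw [h] at key
  rw [← key, sgn_mul, mul_assoc, sgn_mul_self (hg.qFac_ne h1), mul_one]

/-- The sign attached to row `m` and position `i` in terms of q-factorials. -/
noncomputable def rowSign (n : ℕ) (s : ℝ) (x : ℕ → ℕ → ℤ) (m i : ℕ) : ℤ :=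
  (∏ j ∈ Finset.Ico (i + 1) m, sgn (qInt s (shiftedRow x m i - shiftedRow x m j)) *
      sgn (qInt s (shiftedRow x n i - shiftedRow x m j))) *
    sgn (qFac s (shiftedRow x n i - shiftedRow x m i)) *
    (∏ j ∈ Finset.Ico (i + 1) (m + 1), sgn (qFac s (shiftedRow x n i - shiftedRow x (m + 1) j - 1)) *
      sgn (qFac s (shiftedRow x m i - shiftedRow x (m + 1) j - 1))) *
    ∏ j ∈ Finset.Ico i (m - 1), sgn (qFac s (shiftedRow x n i - shiftedRow x (m - 1) j)) *
      sgn (qFac s (shiftedRow x m i - shiftedRow x (m - 1) j))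

theorem sgn_rowProd (s : ℝ) (r : ℕ) (u : ℕ → ℤ) : sgn (rowProd s r u) =
    ∏ i ∈ Finset.range r, ∏ j ∈ Finset.Ico (i + 1) r, sgn (qInt s (u i - u j)) := by
  simp only [rowProd, sgn_prod]

theorem sgn_upperProd (s : ℝ) (r : ℕ) (w u : ℕ → ℤ) : sgn (upperProd s r w u) =
    ∏ i ∈ Finset.range r, ∏ j ∈ Finset.Ico i r, sgn (qFac s (w i - u j)) := by
  simp only [upperProd, sgn_prod]

theorem sgn_lowerProd (s : ℝ) (r : ℕ) (u w : ℕ → ℤ) : sgn (lowerProd s r u w) =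
    ∏ i ∈ Finset.range r, ∏ j ∈ Finset.Ico (i + 1) (r + 1), sgn (qFac s (u i - w j - 1)) := by
  simp only [lowerProd, sgn_prod]

/-- The product of the q-factorials of the numbers `u i - w j - 1` with `i < j < r`. -/
noncomputable def strictProd (s : ℝ) (r : ℕ) (u w : ℕ → ℤ) : ℝ :=
  ∏ i ∈ Finset.range r, ∏ j ∈ Finset.Ico (i + 1) r, qFac s (u i - w j - 1)

theorem sgn_strictProd (s : ℝ) (r : ℕ) (u w : ℕ → ℤ) : sgn (strictProd s r u w) =
    ∏ i ∈ Finset.range r, ∏ j ∈ Finset.Ico (i + 1) r, sgn (qFac s (u i - w j - 1)) := by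
  simp only [strictProd, sgn_prod]

namespace IsIntPattern

theorem top_sub_pos (hx : IsIntPattern n t x) (hg : IsGenericTop n s t) {m i j : ℕ}
    (hij : i < j) (hj : j < m) (hm : m ≤ n) :
    1 ≤ shiftedRow x n i - shiftedRow x m j := by
  have h1 := hx.le_top hj hm
  have h2 := top_anti hg hij.le (by omega : j < n)
  have h3 := hx.top i (by omega)
  unfold shiftedRow
  omega

theorem strictProd_ne (hx : IsIntPattern n t x) (hg : IsGenericTop n s t) {m : ℕ} (hm : m ≤ n) :
    strictProd s m (shiftedRow x n) (shiftedRow x m) ≠ 0 := by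
  refine Finset.prod_ne_zero_iff.2 fun i hi => Finset.prod_ne_zero_iff.2 fun j hj => ?_
  rw [Finset.mem_range] at hi
  rw [Finset.mem_Ico] at hj
  have h2 := hx.row_sub_le hg (show i < n by omega) le_rfl hj.2 hm
  exact hg.qFac_ne (by omega)

theorem upperProd_top_ne (hx : IsIntPattern n t x) (hg : IsGenericTop n s t) {m : ℕ}
    (hm : m < n) : upperProd s m (shiftedRow x n) (shiftedRow x m) ≠ 0 := by
  refine Finset.prod_ne_zero_iff.2 fun i hi => Finset.prod_ne_zero_iff.2 fun j hj => ?_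
  rw [Finset.mem_range] at hi
  rw [Finset.mem_Ico] at hj
  have h2 := hx.row_sub_le hg (show i < n by omega) le_rfl hj.2 hm.le
  exact hg.qFac_ne (by omega)

/-- Off the diagonal, the q-factorial of z is [z] times that of z - 1. This produces the q-numbers
comparing row m with the top row that occur in `rowSign`. -/
theorem sgn_upperProd_top (hx : IsIntPattern n t x) (hg : IsGenericTop n s t) {m : ℕ}
    (hm : m < n) : sgn (upperProd s m (shiftedRow x n) (shiftedRow x m)) =
      (∏ i ∈ Finset.range m, ∏ j ∈ Finset.Ico (i + 1) m,
        sgn (qInt s (shiftedRow x n i - shiftedRow x m j))) *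
      (∏ i ∈ Finset.range m, sgn (qFac s (shiftedRow x n i - shiftedRow x m i))) *
      sgn (strictProd s m (shiftedRow x n) (shiftedRow x m)) := by
  rw [sgn_upperProd, sgn_strictProd, ← Finset.prod_mul_distrib, ← Finset.prod_mul_distrib]
  refine Finset.prod_congr rfl fun i hi => ?_
  rw [Finset.mem_range] at hi
  rw [Finset.prod_eq_prod_Ico_succ_bot hi, mul_right_comm, ← Finset.prod_mul_distrib, mul_comm]
  congr 1
  refine Finset.prod_congr rfl fun j hj => ?_
  rw [Finset.mem_Ico] at hj
  have := hx.top_sub_pos hg (show i < j by omega) hj.2 hm.le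
  rw [qFac_eq_mul s this, sgn_mul]

/-- The bracketed pair and the last two factors are the same two kinds of comparison with the top
row, taken at neighbouring rows. This is what makes the product over m telescope. -/
theorem prod_rowSign (hx : IsIntPattern n t x) (hg : IsGenericTop n s t) {m : ℕ} (hm : m < n) :
    ∏ i ∈ Finset.range m, rowSign n s x m i =
      sgn (rowProd s m (shiftedRow x m)) *
      sgn (lowerProd s m (shiftedRow x m) (shiftedRow x (m + 1))) *
      sgn (upperProd s (m - 1) (shiftedRow x m) (shiftedRow x (m - 1))) *
      (sgn (upperProd s m (shiftedRow x n) (shiftedRow x m)) *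
        sgn (strictProd s m (shiftedRow x n) (shiftedRow x m))) *
      sgn (strictProd s (m + 1) (shiftedRow x n) (shiftedRow x (m + 1))) *
      sgn (upperProd s (m - 1) (shiftedRow x n) (shiftedRow x (m - 1))) := by
  have hupper : ∀ w u : ℕ → ℤ, sgn (upperProd s (m - 1) w u) =
      ∏ i ∈ Finset.range m, ∏ j ∈ Finset.Ico i (m - 1), sgn (qFac s (w i - u j)) := by
    intro w u
    rw [sgn_upperProd]
    rcases m with _ | m
    · simp
    · rw [Finset.prod_range_succ]; simp
  have hstrict : ∀ u w : ℕ → ℤ, sgn (strictProd s (m + 1) u w) =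
      ∏ i ∈ Finset.range m, ∏ j ∈ Finset.Ico (i + 1) (m + 1), sgn (qFac s (u i - w j - 1)) := by
    intro w u
    rw [sgn_strictProd, Finset.prod_range_succ]; simp
  rw [hx.sgn_upperProd_top hg hm, mul_assoc _ (sgn (strictProd s m _ _)),
    sgn_mul_self (hx.strictProd_ne hg hm.le), mul_one, sgn_rowProd, sgn_lowerProd, hupper, hupper,
    hstrict]
  simp only [rowSign, Finset.prod_mul_distrib]
  ring

/-- Nonzero signs square to 1, so comparisons with the top row survive only at the boundary row. -/
theorem prod_prod_rowSign (hx : IsIntPattern n t x) (hg : IsGenericTop n s t) {M : ℕ}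
    (hM : M ≤ n) :
    ∏ m ∈ Finset.range M, ∏ i ∈ Finset.range m, rowSign n s x m i =
      (∏ m ∈ Finset.range M, (sgn (rowProd s m (shiftedRow x m)) *
        sgn (lowerProd s m (shiftedRow x m) (shiftedRow x (m + 1))) *
        sgn (upperProd s (m - 1) (shiftedRow x m) (shiftedRow x (m - 1))))) *
      sgn (upperProd s (M - 1) (shiftedRow x n) (shiftedRow x (M - 1))) *
      sgn (strictProd s M (shiftedRow x n) (shiftedRow x M)) := by
  induction M with
  | zero => simp [upperProd, strictProd, sgn_one]
  | succ M ih =>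
    rw [Finset.prod_range_succ, Finset.prod_range_succ, ih (by omega), hx.prod_rowSign hg hM,
      Nat.add_sub_cancel]
    have h1 := sgn_mul_self (hx.strictProd_ne hg (show M ≤ n by omega))
    have h2 := sgn_mul_self (hx.upperProd_top_ne hg (show M - 1 < n by omega))
    linear_combination (exp := 1)
      (∏ m ∈ Finset.range M, (sgn (rowProd s m (shiftedRow x m)) *
        sgn (lowerProd s m (shiftedRow x m) (shiftedRow x (m + 1))) *
        sgn (upperProd s (m - 1) (shiftedRow x m) (shiftedRow x (m - 1))))) *
      (sgn (rowProd s M (shiftedRow x M)) *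
        sgn (lowerProd s M (shiftedRow x M) (shiftedRow x (M + 1))) *
        sgn (upperProd s (M - 1) (shiftedRow x M) (shiftedRow x (M - 1)))) *
      sgn (upperProd s M (shiftedRow x n) (shiftedRow x M)) *
      sgn (strictProd s (M + 1) (shiftedRow x n) (shiftedRow x (M + 1))) *
      (sgn (upperProd s (M - 1) (shiftedRow x n) (shiftedRow x (M - 1))) *
        sgn (upperProd s (M - 1) (shiftedRow x n) (shiftedRow x (M - 1))) * h1 + h2)

/-- At M = n the boundary terms are the `upperProd` of rows n and n - 1, which the product over m <
n lacks, and the factor of `patternNorm` that depends on the top row only. -/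
theorem sgn_patternNorm (hx : IsIntPattern n t x) (hg : IsGenericTop n s t) :
    sgn (patternNorm n s x) =
      ∏ m ∈ Finset.range n, ∏ i ∈ Finset.range m, rowSign n s x m i := by
  rw [hx.prod_prod_rowSign hg le_rfl, patternNorm, sgn_mul, ← strictProd, sgn_prod]
  congr 1
  -- An index shift: `upperProd` is indexed by the upper of its two rows in one product and by the
  -- lower in the other. The extra term m = 0 is an empty product.
  have h := Finset.prod_range_succ (fun m =>
    sgn (upperProd s (m - 1) (shiftedRow x m) (shiftedRow x (m - 1)))) n
  rw [Finset.prod_range_succ'] at h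
  have h0 : sgn (upperProd s (0 - 1) (shiftedRow x 0) (shiftedRow x (0 - 1))) = 1 := by
    simp [upperProd, sgn_one]
  rw [h0, mul_one] at h
  simp only [Nat.add_sub_cancel] at h
  simp only [normFactor, sgn_mul, sgn_inv, Finset.prod_mul_distrib]
  rw [mul_assoc _ _ (sgn (upperProd s (n - 1) _ _)), ← h]
  ring

end IsIntPattern

/-! ### The sign of a pattern is the sign of its norm. -/

namespace GTPattern

variable {lam : Fin n → ℝ}

/-- Each ν is a constant minus a shifted entry, so the arguments involve only integral differences,
and interlacing makes both q-factorials of each quotient legitimate and nonzero. -/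
theorem signQ''_eq_prod_rowSign (hg : IsGenericTop n s (intTop lam))
    (hlam : ∀ i j : Fin n, (j : ℕ) = i + 1 → ∃ k : ℕ, lam i - lam j = k) (P : GTPattern lam) :
    P.signQ'' s = ∏ m ∈ Finset.range n, ∏ i ∈ Finset.range m, rowSign n s P.intEntry m i := by
  refine Finset.prod_congr rfl fun m hm => Finset.prod_congr rfl fun i hi => ?_
  rw [Finset.mem_range] at hi hm
  have hx := P.isIntPattern hlam
  have hnu : ∀ {k j : ℕ}, j < k → k ≤ n →
      P.nu k j = -baseEntry lam - (shiftedRow P.intEntry k j : ℤ) := by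
    intro k j hj hk
    rw [nu, P.entry_eq hlam hj hk, shiftedRow]
    push_cast; ring
  have hd : (P.drop m i : ℤ) = shiftedRow P.intEntry n i - shiftedRow P.intEntry m i := by
    have h := P.drop_eq hi hm.le
    rw [P.entry_eq hlam hi hm.le, P.entry_eq hlam (by omega : i < n) le_rfl] at h
    have : ((P.drop m i : ℤ) : ℝ) = ((P.intEntry n i - P.intEntry m i : ℤ) : ℝ) := by
      push_cast; linarith
    have h2 : (P.drop m i : ℤ) = P.intEntry n i - P.intEntry m i := by exact_mod_cast this
    rw [h2, shiftedRow, shiftedRow]; ring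
  have hin : i < n := by omega
  have e1 : sgn (∏ j ∈ Finset.Ico (i + 1) m,
        qNum s (P.nu m j - P.nu m i) * qNum s (P.nu m j - P.nu n i)) =
      ∏ j ∈ Finset.Ico (i + 1) m,
        sgn (qInt s (shiftedRow P.intEntry m i - shiftedRow P.intEntry m j)) *
        sgn (qInt s (shiftedRow P.intEntry n i - shiftedRow P.intEntry m j)) := by
    rw [sgn_prod]
    refine Finset.prod_congr rfl fun j hj => ?_
    rw [Finset.mem_Ico] at hj
    rw [sgn_mul, hnu hj.2 hm.le, hnu hi hm.le, hnu hin le_rfl, qInt, qInt]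
    push_cast
    congr 3 <;> ring
  have e2 : sgn (qFall s (P.nu m i - P.nu n i) (P.drop m i)) =
      sgn (qFac s (shiftedRow P.intEntry n i - shiftedRow P.intEntry m i)) := by
    have hz : P.nu m i - P.nu n i =
        ((shiftedRow P.intEntry n i - shiftedRow P.intEntry m i : ℤ) : ℝ) := by
      rw [hnu hi hm.le, hnu hin le_rfl]; push_cast; ring
    have h1 := hx.le_max hg hi hm.le
    rw [hz, sgn_qFall hg (w := 0) (by omega) le_rfl, qFac_zero, sgn_one, mul_one]
    have h1 := hx.le_max hg hi hm.le
    have h2 := hx.ge_min hg hi hm.le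
    omega
  have e3 : sgn (∏ j ∈ Finset.Ico (i + 1) (m + 1),
        qFall s (P.nu (m + 1) j - P.nu n i - 1) (P.drop m i)) =
      ∏ j ∈ Finset.Ico (i + 1) (m + 1),
        sgn (qFac s (shiftedRow P.intEntry n i - shiftedRow P.intEntry (m + 1) j - 1)) *
        sgn (qFac s (shiftedRow P.intEntry m i - shiftedRow P.intEntry (m + 1) j - 1)) := by
    rw [sgn_prod]
    refine Finset.prod_congr rfl fun j hj => ?_
    rw [Finset.mem_Ico] at hj
    have hz : P.nu (m + 1) j - P.nu n i - 1 =
        ((shiftedRow P.intEntry n i - shiftedRow P.intEntry (m + 1) j - 1 : ℤ) : ℝ) := by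
      rw [hnu hj.2 hm, hnu hin le_rfl]; push_cast; ring
    have h1 := hx.lower_sub_pos hg (show i < j by omega) (show j ≤ m by omega) hm
    have h2 := hx.row_sub_le hg hi hm.le hj.2 hm
    rw [hz, sgn_qFall hg (w := shiftedRow P.intEntry m i - shiftedRow P.intEntry (m + 1) j - 1)
      (by omega) (by omega) (by omega)]
  have e4 : sgn (∏ j ∈ Finset.Ico i (m - 1),
        qFall s (P.nu (m - 1) j - P.nu n i) (P.drop m i)) =
      ∏ j ∈ Finset.Ico i (m - 1),
        sgn (qFac s (shiftedRow P.intEntry n i - shiftedRow P.intEntry (m - 1) j)) *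
        sgn (qFac s (shiftedRow P.intEntry m i - shiftedRow P.intEntry (m - 1) j)) := by
    rw [sgn_prod]
    refine Finset.prod_congr rfl fun j hj => ?_
    rw [Finset.mem_Ico] at hj
    have hz : P.nu (m - 1) j - P.nu n i =
        ((shiftedRow P.intEntry n i - shiftedRow P.intEntry (m - 1) j : ℤ) : ℝ) := by
      rw [hnu hj.2 (by omega), hnu hin le_rfl]; push_cast; ring
    have h1 := hx.upper_sub_nonneg hg hj.1 hj.2 (show m - 1 < n by omega)
    rw [show m - 1 + 1 = m by omega] at h1
    have h2 := hx.row_sub_le hg hi hm.le hj.2 (show m - 1 ≤ n by omega)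
    rw [hz, sgn_qFall hg (w := shiftedRow P.intEntry m i - shiftedRow P.intEntry (m - 1) j)
      (by omega) (by omega) (by omega)]
  rw [e1, e2, e3, e4, rowSign]

theorem signQ_eq_sgn_patternNorm (hg : IsGenericTop n s (intTop lam))
    (hlam : ∀ i j : Fin n, (j : ℕ) = i + 1 → ∃ k : ℕ, lam i - lam j = k) (P : GTPattern lam) :
    P.signQ s = sgn (patternNorm n s P.intEntry) := by
  rw [signQ_eq_signQ', signQ'_eq_signQ'', signQ''_eq_prod_rowSign hg hlam,
    (P.isIntPattern hlam).sgn_patternNorm hg]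

end GTPattern

end

/-! ### Moving an entry of a pattern -/

/-- The array with a single entry `1`, in row `r` at position `i`. -/
def unitArray (r i : ℕ) : ℕ → ℕ → ℤ := fun m j => if m = r ∧ j = i then 1 else 0

section

variable {n : ℕ} {s : ℝ} {t : ℕ → ℤ} {x : ℕ → ℕ → ℤ}

namespace IsIntPattern

/-- Only the two upper bounds that interlacing puts on the raised entry can fail; the second is void
for i = 0. -/
theorem add_unitArray (hx : IsIntPattern n t x) {r i : ℕ} (hi : i < r) (hr : r < n)
    (h1 : x r i + 1 ≤ x (r + 1) i) (h2 : ∀ k, k + 1 = i → x r i + 1 ≤ x (r - 1) k) :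
    IsIntPattern n t (x + unitArray r i) where
  top k hk := by
    have := hx.top k hk
    simp only [Pi.add_apply, unitArray]
    split_ifs <;> omega
  upper m k hk hm := by
    have := hx.upper m k hk hm
    simp only [Pi.add_apply, unitArray]
    split_ifs with h h' h'
    · omega
    · obtain ⟨rfl, rfl⟩ := h; omega
    · omega
    · omega
  lower m k hk hm := by
    have := hx.lower m k hk hm
    simp only [Pi.add_apply, unitArray]
    split_ifs with h h' h'
    · omega
    · obtain ⟨rfl, rfl⟩ := h
      have := h2 k rfl
      rw [Nat.add_sub_cancel] at this
      omega
    · omega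
    · omega
  outside m k h := by
    have := hx.outside m k h
    simp only [Pi.add_apply, unitArray]
    split_ifs with h'
    · omega
    · omega

theorem sub_unitArray (hx : IsIntPattern n t x) {r i : ℕ} (hi : i < r) (hr : r < n)
    (h1 : x (r + 1) (i + 1) + 1 ≤ x r i) (h2 : ∀ k, k + 1 = r → i < k → x k i + 1 ≤ x r i) :
    IsIntPattern n t (x - unitArray r i) where
  top k hk := by
    have := hx.top k hk
    simp only [Pi.sub_apply, unitArray]
    split_ifs <;> omega
  upper m k hk hm := by
    have := hx.upper m k hk hm
    simp only [Pi.sub_apply, unitArray]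
    split_ifs with h h' h'
    · omega
    · omega
    · obtain ⟨h3, rfl⟩ := h'
      have := h2 m h3 hk
      subst h3
      omega
    · omega
  lower m k hk hm := by
    have := hx.lower m k hk hm
    simp only [Pi.sub_apply, unitArray]
    split_ifs with h h' h'
    · omega
    · omega
    · obtain ⟨rfl, rfl⟩ := h'
      omega
    · omega
  outside m k h := by
    have := hx.outside m k h
    simp only [Pi.sub_apply, unitArray]
    split_ifs with h'
    · omega
    · omega

/-- Lowering another entry can only tighten the upper bounds on the raised one, so bounds that hold
after both moves hold after the raise alone. -/
theorem add_of_add_sub (hx : IsIntPattern n t x) {r i r' j : ℕ} (hne : ¬(r = r' ∧ i = j))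
    (hi : i < r) (hr : r < n)
    (hy : IsIntPattern n t (x + unitArray r i - unitArray r' j)) :
    IsIntPattern n t (x + unitArray r i) := by
  refine hx.add_unitArray hi hr ?_ ?_
  · have := hy.upper r i hi hr
    simp only [Pi.add_apply, Pi.sub_apply, unitArray, and_self, if_true, and_true] at this
    split_ifs at this <;> omega
  · rintro k rfl
    have h0 : r - 1 + 1 = r := by omega
    have := hy.lower (r - 1) k (by omega) (by omega)
    simp only [Pi.add_apply, Pi.sub_apply, unitArray, h0, and_self, if_true] at this
    split_ifs at this <;> omega

theorem sub_of_add_sub (hx : IsIntPattern n t x) {r i r' j : ℕ} (hne : ¬(r = r' ∧ i = j))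
    (hj : j < r') (hr : r' < n)
    (hy : IsIntPattern n t (x + unitArray r i - unitArray r' j)) :
    IsIntPattern n t (x - unitArray r' j) := by
  refine hx.sub_unitArray hj hr ?_ ?_
  · have := hy.lower r' j hj hr
    simp only [Pi.add_apply, Pi.sub_apply, unitArray, and_self, if_true] at this
    split_ifs at this <;> omega
  · rintro k rfl hk
    have := hy.upper k j hk (by omega)
    simp only [Pi.add_apply, Pi.sub_apply, unitArray, and_self, if_true, and_true] at this
    split_ifs at this <;> omega

end IsIntPattern

theorem shiftedRow_add_of_ne {r m : ℕ} (i : ℕ) (h : m ≠ r) :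
    shiftedRow (x + unitArray r i) m = shiftedRow x m := by
  funext j
  simp [shiftedRow, unitArray, h]

theorem shiftedRow_sub_of_ne {r m : ℕ} (i : ℕ) (h : m ≠ r) :
    shiftedRow (x - unitArray r i) m = shiftedRow x m := by
  funext j
  simp [shiftedRow, unitArray, h]

theorem shiftedRow_add_same (r i : ℕ) :
    shiftedRow (x + unitArray r i) r = shiftedRow x r + Pi.single i 1 := by
  funext j
  simp only [shiftedRow, unitArray, Pi.add_apply, Pi.single_apply]
  split_ifs <;> simp_all; ring

theorem shiftedRow_sub_same (r i : ℕ) :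
    shiftedRow (x - unitArray r i) r = shiftedRow x r - Pi.single i 1 := by
  funext j
  simp only [shiftedRow, unitArray, Pi.sub_apply, Pi.single_apply]
  split_ifs <;> simp_all; ring

/-! ### The Gelfand–Tsetlin coefficients -/

/-- The product of the q-numbers `[u j - u i]` with `j ≠ i`. -/
noncomputable def rowDen (s : ℝ) (r : ℕ) (u : ℕ → ℤ) (i : ℕ) : ℝ :=
  ∏ j ∈ Finset.range r, if j = i then 1 else qInt s (u j - u i)

/-- The coefficient with which the entry `u i` of row `r` is raised; `w` is row `r + 1`. -/
noncomputable def raiseCoeff (s : ℝ) (r : ℕ) (u w : ℕ → ℤ) (i : ℕ) : ℝ :=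
  -(∏ j ∈ Finset.range (r + 1), qInt s (w j - u i)) / rowDen s r u i

/-- The coefficient with which the entry `u i` of row `r` is lowered; `v` is row `r - 1`. -/
noncomputable def lowerCoeff (s : ℝ) (r : ℕ) (v u : ℕ → ℤ) (i : ℕ) : ℝ :=
  (∏ j ∈ Finset.range (r - 1), qInt s (v j - u i)) / rowDen s r u i

theorem rowDen_eq_mul (s : ℝ) {r : ℕ} (u : ℕ → ℤ) {i j : ℕ} (hj : j < r) (hij : j ≠ i) :
    rowDen s r u i = qInt s (u j - u i) *
      ∏ k ∈ (Finset.range r).erase j, if k = i then 1 else qInt s (u k - u i) := by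
  rw [rowDen, ← Finset.mul_prod_erase _ _ (Finset.mem_range.2 hj), if_neg hij]

/-- The shifts affect only the factors for the pair i, j, and [u j - 1 - u i][u i - u j] becomes [u
i + 1 - u j][u j - u i] by two changes of sign. -/
theorem rowDen_sub_mul_rowDen (s : ℝ) {r : ℕ} (u : ℕ → ℤ) {i j : ℕ} (hi : i < r) (hj : j < r)
    (hij : i ≠ j) :
    rowDen s r (u - Pi.single j 1) i * rowDen s r u j =
      rowDen s r (u + Pi.single i 1) j * rowDen s r u i := by
  rw [rowDen_eq_mul s (u - Pi.single j 1) hj hij.symm, rowDen_eq_mul s u hi hij,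
    rowDen_eq_mul s (u + Pi.single i 1) hi hij, rowDen_eq_mul s u hj hij.symm]
  have h1 : ∏ k ∈ (Finset.range r).erase j,
      (if k = i then 1 else qInt s ((u - Pi.single j 1 : ℕ → ℤ) k - (u - Pi.single j 1 : ℕ → ℤ) i)) =
      ∏ k ∈ (Finset.range r).erase j, (if k = i then 1 else qInt s (u k - u i)) := by
    refine Finset.prod_congr rfl fun k hk => ?_
    simp [Finset.ne_of_mem_erase hk, hij]
  have h2 : ∏ k ∈ (Finset.range r).erase i,
      (if k = j then 1 else qInt s ((u + Pi.single i 1 : ℕ → ℤ) k - (u + Pi.single i 1 : ℕ → ℤ) j)) =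
      ∏ k ∈ (Finset.range r).erase i, (if k = j then 1 else qInt s (u k - u j)) := by
    refine Finset.prod_congr rfl fun k hk => ?_
    simp [Finset.ne_of_mem_erase hk, hij.symm]
  rw [h1, h2]
  simp only [Pi.add_apply, Pi.sub_apply, Pi.single_eq_same, Pi.single_eq_of_ne hij,
    Pi.single_eq_of_ne hij.symm, sub_zero, add_zero]
  rw [qInt_sub_comm s (u j - 1), qInt_sub_comm s (u j) (u i), sub_sub_eq_add_sub]
  ring

theorem raiseCoeff_mul_lowerCoeff_same (s : ℝ) {r : ℕ} (v u w : ℕ → ℤ) {i j : ℕ} (hi : i < r)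
    (hj : j < r) (hij : i ≠ j) :
    lowerCoeff s r v u j * raiseCoeff s r (u - Pi.single j 1) w i =
      raiseCoeff s r u w i * lowerCoeff s r v (u + Pi.single i 1) j := by
  have h1 : (u - Pi.single j 1 : ℕ → ℤ) i = u i := by simp [hij]
  have h2 : (u + Pi.single i 1 : ℕ → ℤ) j = u j := by simp [hij.symm]
  rw [raiseCoeff, lowerCoeff, raiseCoeff, lowerCoeff, h1, h2, div_mul_div_comm, div_mul_div_comm,
    mul_comm (rowDen s r u j), rowDen_sub_mul_rowDen s u hi hj hij]
  rw [mul_comm (rowDen s r u i)]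
  congr 1
  ring

/-- Here the interaction is in the numerators, again only through the pair i, j, and again two signs
cancel. -/
theorem raiseCoeff_mul_lowerCoeff_succ (s : ℝ) {r : ℕ} (u w : ℕ → ℤ) {i j : ℕ} (hi : i < r)
    (hj : j < r + 1) :
    lowerCoeff s (r + 1) u w j * raiseCoeff s r u (w - Pi.single j 1) i =
      raiseCoeff s r u w i * lowerCoeff s (r + 1) (u + Pi.single i 1) w j := by
  obtain ⟨w', hw⟩ : ∃ w', w' = w - Pi.single j 1 := ⟨_, rfl⟩
  obtain ⟨u', hu⟩ : ∃ u', u' = u + Pi.single i 1 := ⟨_, rfl⟩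
  rw [← hw, ← hu, raiseCoeff, lowerCoeff, raiseCoeff, lowerCoeff, div_mul_div_comm,
    div_mul_div_comm, mul_comm (rowDen s r u i), Nat.add_sub_cancel]
  congr 1
  have hj' := Finset.mem_range.2 hj
  have hi' := Finset.mem_range.2 hi
  rw [← Finset.mul_prod_erase _ (fun k => qInt s (w k - u i)) hj',
    ← Finset.mul_prod_erase _ (fun k => qInt s (w' k - u i)) hj',
    ← Finset.mul_prod_erase _ (fun k => qInt s (u k - w j)) hi',
    ← Finset.mul_prod_erase _ (fun k => qInt s (u' k - w j)) hi']
  have h1 : ∏ k ∈ (Finset.range (r + 1)).erase j, qInt s (w' k - u i) =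
      ∏ k ∈ (Finset.range (r + 1)).erase j, qInt s (w k - u i) :=
    Finset.prod_congr rfl fun k hk => by simp [hw, Finset.ne_of_mem_erase hk]
  have h2 : ∏ k ∈ (Finset.range r).erase i, qInt s (u' k - w j) =
      ∏ k ∈ (Finset.range r).erase i, qInt s (u k - w j) :=
    Finset.prod_congr rfl fun k hk => by simp [hu, Finset.ne_of_mem_erase hk]
  have h3 : w' j = w j - 1 := by simp [hw]
  have h4 : u' i = u i + 1 := by simp [hu]
  rw [h1, h2, h3, h4, qInt_sub_comm s (w j - 1), qInt_sub_comm s (w j) (u i),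
    sub_sub_eq_add_sub]
  ring

/-- The coefficient of `x + unitArray r i` in the image of `x` under the raising operator. -/
noncomputable def patRaise (s : ℝ) (x : ℕ → ℕ → ℤ) (r i : ℕ) : ℝ :=
  raiseCoeff s r (shiftedRow x r) (shiftedRow x (r + 1)) i

/-- The coefficient of `x - unitArray r i` in the image of `x` under the lowering operator. -/
noncomputable def patLower (s : ℝ) (x : ℕ → ℕ → ℤ) (r i : ℕ) : ℝ :=
  lowerCoeff s r (shiftedRow x (r - 1)) (shiftedRow x r) i

/-- The raising coefficient depends on rows r and r + 1, the lowering coefficient on rows r' - 1 and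
r'. So a move influences the other coefficient only for r' = r and r' = r + 1. -/
theorem patLower_mul_patRaise (s : ℝ) (x : ℕ → ℕ → ℤ) {r i r' j : ℕ} (hi : i < r) (hj : j < r')
    (hne : ¬(r = r' ∧ i = j)) :
    patLower s x r' j * patRaise s (x - unitArray r' j) r i =
      patRaise s x r i * patLower s (x + unitArray r i) r' j := by
  unfold patRaise patLower
  rcases eq_or_ne r' r with rfl | h1
  · rw [shiftedRow_sub_same, shiftedRow_add_same, shiftedRow_sub_of_ne _ (by omega),
      shiftedRow_add_of_ne _ (by omega)]
    exact raiseCoeff_mul_lowerCoeff_same s _ _ _ hi hj fun h => hne ⟨rfl, h⟩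
  · rcases eq_or_ne r' (r + 1) with rfl | h2
    · rw [shiftedRow_sub_same, shiftedRow_sub_of_ne _ (by omega), Nat.add_sub_cancel,
        shiftedRow_add_same, shiftedRow_add_of_ne _ (by omega)]
      exact raiseCoeff_mul_lowerCoeff_succ s _ _ hi hj
    · rw [shiftedRow_sub_of_ne _ (by omega), shiftedRow_sub_of_ne _ (by omega),
        shiftedRow_add_of_ne _ (by omega), shiftedRow_add_of_ne _ (by omega), mul_comm]

theorem sum_prod_qInt_div (hs : Real.sin (Real.pi * s) ≠ 0) {ι : Type*} [DecidableEq ι]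
    (S : Finset ι) (y z : ι → ℤ)
    (hy : ∀ j ∈ S, ∀ k ∈ S, j ≠ k → qInt s (y j - y k) = 0 → z j = y j ∧ z k = y k) :
    ∑ k ∈ S, (∏ j ∈ S, qInt s (z j - y k)) /
        (∏ j ∈ S, if j = k then 1 else qInt s (y j - y k)) =
      qInt s (∑ j ∈ S, z j - ∑ j ∈ S, y j) := by
  have h := sum_prod_qNum_div hs S (fun j => (y j : ℝ)) (fun j => (z j : ℝ)) (by
    intro j hj k hk hjk h0
    have := hy j hj k hk hjk (by rw [qInt]; push_cast; exact h0)
    simp [this])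
  simp only [qInt]
  push_cast
  exact h

/-- The coordinate `k` of the weight of an integral pattern. -/
def intWt (x : ℕ → ℕ → ℤ) (k : ℕ) : ℤ :=
  ∑ i ∈ Finset.range (k + 1), x (k + 1) i - ∑ i ∈ Finset.range k, x k i

/-! ### The diagonal part of the commutator of raising and lowering. -/

namespace IsIntPattern

/-- A raise that leaves the patterns starts from an entry at one of its two upper bounds, and the
matching q-number is [0]. Hence forbidden positions may be included in the interpolation sum. -/
theorem not_add (hx : IsIntPattern n t x) {p i : ℕ} (hi : i < p + 1) (hr : p + 1 < n)
    (h : ¬IsIntPattern n t (x + unitArray (p + 1) i)) :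
    (∏ j ∈ Finset.range (p + 2), qInt s (shiftedRow x (p + 2) j - shiftedRow x (p + 1) i)) *
      (∏ j ∈ Finset.range p, qInt s (shiftedRow x p j - 1 - shiftedRow x (p + 1) i)) = 0 := by
  by_cases h1 : x (p + 1) i + 1 ≤ x (p + 2) i
  · have h2 : ∃ k, k + 1 = i ∧ ¬ x (p + 1) i + 1 ≤ x p k := by
      by_contra! h2
      exact h (hx.add_unitArray hi hr h1 fun k hk => by simpa using h2 k hk)
    obtain ⟨k, rfl, hk⟩ := h2
    have h3 := hx.lower p k (by omega) (by omega)
    refine mul_eq_zero_of_right _ (Finset.prod_eq_zero (i := k) (Finset.mem_range.2 (by omega)) ?_)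
    rw [show shiftedRow x p k - 1 - shiftedRow x (p + 1) (k + 1) = 0 by
      unfold shiftedRow; push_cast; omega, qInt_zero]
  · have h3 : x (p + 1) i ≤ x (p + 2) i := hx.upper (p + 1) i hi hr
    refine mul_eq_zero_of_left (Finset.prod_eq_zero (i := i) (Finset.mem_range.2 (by omega)) ?_) _
    rw [show shiftedRow x (p + 2) i - shiftedRow x (p + 1) i = 0 by
      unfold shiftedRow; omega, qInt_zero]

theorem not_sub (hx : IsIntPattern n t x) {p i : ℕ} (hi : i < p + 1) (hr : p + 1 < n)
    (h : ¬IsIntPattern n t (x - unitArray (p + 1) i)) :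
    (∏ j ∈ Finset.range (p + 2), qInt s (shiftedRow x (p + 2) j - (shiftedRow x (p + 1) i - 1))) *
      (∏ j ∈ Finset.range p, qInt s (shiftedRow x p j - shiftedRow x (p + 1) i)) = 0 := by
  by_cases h1 : x (p + 2) (i + 1) + 1 ≤ x (p + 1) i
  · have h2 : i < p ∧ ¬ x p i + 1 ≤ x (p + 1) i := by
      by_contra! h2
      refine h (hx.sub_unitArray hi hr h1 fun k hk hk' => ?_)
      obtain rfl : k = p := by omega
      exact h2 hk'
    have h3 := hx.upper p i (by omega) (by omega)
    refine mul_eq_zero_of_right _ (Finset.prod_eq_zero (i := i) (Finset.mem_range.2 h2.1) ?_)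
    rw [show shiftedRow x p i - shiftedRow x (p + 1) i = 0 by
      unfold shiftedRow; omega, qInt_zero]
  · have h3 : x (p + 2) (i + 1) ≤ x (p + 1) i := hx.lower (p + 1) i hi hr
    refine mul_eq_zero_of_left
      (Finset.prod_eq_zero (i := i + 1) (Finset.mem_range.2 (by omega)) ?_) _
    rw [show shiftedRow x (p + 2) (i + 1) - (shiftedRow x (p + 1) i - 1) = 0 by
      unfold shiftedRow; push_cast; omega, qInt_zero]

-- Interpolation with the 2(p + 1) nodes u i and u i - 1, against the p + 2 entries w j of the row
-- above and the p numbers v j - 1 from the row below. The node u i gives the path that raises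
-- first, the node u i - 1 the path that lowers first, and [∑ z - ∑ y] is, up to sign, the q-number
-- of the difference of two weight coordinates.
open scoped Classical in
theorem sum_raise_lower (hx : IsIntPattern n t x) (hg : IsGenericTop n s t) {p : ℕ}
    (hr : p + 1 < n) :
    ∑ i ∈ Finset.range (p + 1),
      ((if IsIntPattern n t (x - unitArray (p + 1) i) then
          patLower s x (p + 1) i * patRaise s (x - unitArray (p + 1) i) (p + 1) i else 0) -
        (if IsIntPattern n t (x + unitArray (p + 1) i) then
          patRaise s x (p + 1) i * patLower s (x + unitArray (p + 1) i) (p + 1) i else 0)) =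
      qInt s (intWt x p - intWt x (p + 1)) := by
  set u := shiftedRow x (p + 1) with hu
  set w := shiftedRow x (p + 2) with hw
  set v := shiftedRow x p with hv
  let y : ℕ ⊕ ℕ → ℤ := Sum.elim u (fun i => u i - 1)
  -- The pairing of z with y matters, since z = y is required where nodes collide: w i is paired
  -- with u i, v i - 1 with u i - 1, and the surplus entry w (p + 1) with u p - 1.
  let z : ℕ ⊕ ℕ → ℤ := Sum.elim w (fun i => if i = p then w (p + 1) else v i - 1)
  let S : Finset (ℕ ⊕ ℕ) := (Finset.range (p + 1)).disjSum (Finset.range (p + 1))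
  have hz0 : ∀ j, z (Sum.inl j) = w j := fun _ => rfl
  have hz1 : ∀ j ∈ Finset.range p, z (Sum.inr j) = v j - 1 := by
    intro j hj
    have : j ≠ p := (Finset.mem_range.1 hj).ne
    simp [z, this]
  have hz2 : z (Sum.inr p) = w (p + 1) := by simp [z]
  have hdiff : ∀ i j, i < j → j < p + 1 → u j + 1 ≤ u i ∧ u i ≤ u j + (t 0 - t (n - 1) + j - i) := by
    intro i j hij hj
    have h1 := hx.row_sub_pos hg hij hj hr.le
    have h2 := hx.row_sub_le hg (show i < p + 1 by omega) hr.le hj hr.le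
    rw [← hu] at h1 h2
    constructor <;> omega
  have hW : 0 ≤ t 0 - t (n - 1) := by
    have := top_anti hg (Nat.zero_le (n - 1)) (by omega)
    omega
  have huu : ∀ i j, i < p + 1 → j < p + 1 → i ≠ j → qInt s (u i - u j) ≠ 0 := by
    intro i j hi hj hij
    rcases lt_or_gt_of_ne hij with h | h
    · have := hdiff i j h hj
      exact hg.qInt_ne (by omega) (by omega) (by omega)
    · have := hdiff j i h hi
      exact hg.qInt_ne (by omega) (by omega) (by omega)
  have hud : ∀ i j, i < p + 1 → j < p + 1 → qInt s (u i - (u j - 1)) = 0 →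
      w i = u i ∧ z (Sum.inr j) = u j - 1 := by
    intro i j hi hj h0
    rcases lt_trichotomy i j with h | rfl | h
    · have h1 := hdiff i j h hj
      -- A positive difference with vanishing q-number must exceed the generic range by one. This
      -- happens only for i = 0, j = p = n - 2 and a row that reaches both extreme values of the
      -- pattern; then the top row agrees with it at both ends.
      have h2 : ¬ (u i - (u j - 1) ≤ t 0 - t (n - 1) + n - 2) := fun h2 =>
        hg.qInt_ne (by omega) h2 (by omega) h0
      have h3 := hx.le_max hg hi hr.le
      have h4 := hx.ge_min hg hj hr.le
      have h5 := hx.le_max hg (show i < p + 2 by omega) hr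
      have h6 : x (p + 1) i ≤ x (p + 2) i := hx.upper (p + 1) i hi hr
      have h7 := hx.ge_min hg (show j + 1 < p + 2 by omega) hr
      have h8 : x (p + 2) (j + 1) ≤ x (p + 1) j := hx.lower (p + 1) j hj hr
      simp only [hu, shiftedRow] at h2
      have hjp : j = p := by omega
      subst hjp
      rw [hz2, hu, hw]
      unfold shiftedRow
      push_cast at *
      omega
    · exfalso
      have h1 : qInt s 1 = 1 := by simpa [qInt] using qNum_one hg.sin_ne
      rw [sub_sub_cancel, h1] at h0
      exact one_ne_zero h0
    · have h1 := hdiff j i h hi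
      -- A genuine collision: i = j + 1 and two neighbouring entries of the row are equal, so
      -- interlacing pins the entries of the adjacent rows between them.
      have h2 : u i - (u j - 1) = 0 := by
        by_contra h2
        exact hg.qInt_ne h2 (by omega) (by omega) h0
      have hjp : j < p := by omega
      have h3 : x (p + 1) i ≤ x (p + 2) i := hx.upper (p + 1) i hi hr
      have h4 : x (p + 2) (j + 1) ≤ x (p + 1) j := hx.lower (p + 1) j hj hr
      have h5 := hx.upper p j hjp (by omega)
      have h6 := hx.lower p j hjp (by omega)
      have h7 := hx.row_anti hg (show j + 1 ≤ i by omega) hi hr.le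
      have h8 : x (p + 2) i ≤ x (p + 2) (j + 1) :=
        hx.row_anti hg (show j + 1 ≤ i by omega) (show i < p + 2 by omega) hr
      rw [hz1 j (Finset.mem_range.2 hjp), hw, hv, hu]
      simp only [hu, shiftedRow] at h2 ⊢
      omega
  have hy : ∀ j ∈ S, ∀ k ∈ S, j ≠ k → qInt s (y j - y k) = 0 → z j = y j ∧ z k = y k := by
    rintro (i | i) hi (j | j) hj hij h0 <;>
      simp only [S, Finset.inl_mem_disjSum, Finset.inr_mem_disjSum, Finset.mem_range] at hi hj
    · exact absurd h0 (huu i j hi hj fun h => hij (h ▸ rfl))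
    · exact hud i j hi hj h0
    · have := hud j i hj hi (by rw [qInt_sub_comm]; exact neg_eq_zero.2 h0)
      exact ⟨this.2, this.1⟩
    · refine absurd h0 ?_
      have : y (Sum.inr i) - y (Sum.inr j) = u i - u j := by simp [y]
      rw [this]
      exact huu i j hi hj fun h => hij (h ▸ rfl)
  have key := sum_prod_qInt_div hg.sin_ne S y z hy
  have hprodz : ∀ c : ℤ, ∏ j ∈ S, qInt s (z j - c) =
      (∏ j ∈ Finset.range (p + 2), qInt s (w j - c)) *
        ∏ j ∈ Finset.range p, qInt s (v j - 1 - c) := by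
    intro c
    have h1 : ∏ j ∈ Finset.range p, qInt s (z (Sum.inr j) - c) =
        ∏ j ∈ Finset.range p, qInt s (v j - 1 - c) :=
      Finset.prod_congr rfl fun j hj => by rw [hz1 j hj]
    rw [Finset.prod_disjSum, Finset.prod_range_succ (fun j => qInt s (z (Sum.inr j) - c)), hz2,
      h1, Finset.prod_range_succ (fun j => qInt s (w j - c)) (p + 1)]
    simp only [hz0]
    ring
  have hsumz : ∑ j ∈ S, z j = ∑ j ∈ Finset.range (p + 2), w j +
      ∑ j ∈ Finset.range p, (v j - 1) := by
    rw [Finset.sum_disjSum, Finset.sum_range_succ (fun j => z (Sum.inr j)), hz2,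
      Finset.sum_congr rfl hz1, Finset.sum_range_succ w (p + 1)]
    simp only [hz0]
    ring
  -- The minus sign is the factor [(u i - 1) - u i] = [-1].
  have hden1 : ∀ i ∈ Finset.range (p + 1),
      (∏ j ∈ S, if j = Sum.inl i then 1 else qInt s (y j - y (Sum.inl i))) =
      -(rowDen s (p + 1) u i * rowDen s (p + 1) (u + Pi.single i 1) i) := by
    intro i hi
    obtain ⟨u', hu'⟩ : ∃ u', u' = u + Pi.single i 1 := ⟨_, rfl⟩
    rw [← hu', Finset.prod_disjSum, rowDen, rowDen, neg_eq_neg_one_mul, mul_left_comm]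
    congr 1
    · exact Finset.prod_congr rfl fun j _ => by simp [y]
    · rw [← Finset.mul_prod_erase _ _ hi, ← Finset.mul_prod_erase (Finset.range (p + 1))
        (fun j => if j = i then 1 else qInt s (u' j - u' i)) hi]
      simp only [if_true, one_mul]
      congr 1
      · have h1 : qInt s 1 = 1 := by simpa [qInt] using qNum_one hg.sin_ne
        simp [y, qInt_neg, h1]
      · refine Finset.prod_congr rfl fun j hj => ?_
        have := Finset.ne_of_mem_erase hj
        simp [y, hu', this, sub_sub, add_comm]
  have hden2 : ∀ i ∈ Finset.range (p + 1),
      (∏ j ∈ S, if j = Sum.inr i then 1 else qInt s (y j - y (Sum.inr i))) =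
      rowDen s (p + 1) (u - Pi.single i 1) i * rowDen s (p + 1) u i := by
    intro i hi
    obtain ⟨u', hu'⟩ : ∃ u', u' = u - Pi.single i 1 := ⟨_, rfl⟩
    rw [← hu', Finset.prod_disjSum, rowDen, rowDen]
    congr 1
    · rw [← Finset.mul_prod_erase _ _ hi, ← Finset.mul_prod_erase (Finset.range (p + 1))
        (fun j => if j = i then 1 else qInt s (u' j - u' i)) hi]
      simp only [if_true]
      congr 1
      · have h1 : qInt s 1 = 1 := by simpa [qInt] using qNum_one hg.sin_ne
        simp [y, h1]
      · refine Finset.prod_congr rfl fun j hj => ?_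
        have := Finset.ne_of_mem_erase hj
        simp [y, hu', this]
    · exact Finset.prod_congr rfl fun j _ => by simp [y]
  rw [Finset.sum_disjSum, hsumz] at key
  have hS2 : ∑ j ∈ S, y j = 2 * ∑ j ∈ Finset.range (p + 1), u j - (p + 1) := by
    rw [Finset.sum_disjSum]
    simp only [y, Sum.elim_inl, Sum.elim_inr, Finset.sum_sub_distrib, Finset.sum_const,
      Finset.card_range]
    simp; ring
  have hrow : ∀ m, ∑ j ∈ Finset.range m, shiftedRow x m j =
      ∑ j ∈ Finset.range m, x m j - ∑ j ∈ Finset.range m, (j : ℤ) := by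
    intro m
    simp only [shiftedRow, Finset.sum_sub_distrib]
  have hrhs : ∑ j ∈ Finset.range (p + 2), w j + ∑ j ∈ Finset.range p, (v j - 1) - ∑ j ∈ S, y j =
      -(intWt x p - intWt x (p + 1)) := by
    rw [hS2, Finset.sum_sub_distrib, hu, hv, hw, hrow, hrow, hrow, intWt, intWt,
      Finset.sum_range_succ (fun j => (j : ℤ)) (p + 1), Finset.sum_range_succ (fun j => (j : ℤ)) p]
    simp
    ring
  rw [hrhs, qInt_neg] at key
  rw [← neg_neg (qInt s (intWt x p - intWt x (p + 1))), ← key, neg_add_rev,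
    ← Finset.sum_neg_distrib, ← Finset.sum_neg_distrib, ← Finset.sum_add_distrib]
  refine Finset.sum_congr rfl fun i hi => ?_
  rw [hden1 i hi, hden2 i hi, hprodz, hprodz, sub_eq_add_neg]
  have hi' := Finset.mem_range.1 hi
  congr 1
  · split_ifs with h
    · rw [patLower, patRaise, shiftedRow_sub_same, shiftedRow_sub_of_ne _ (by omega), raiseCoeff,
        lowerCoeff, Nat.add_sub_cancel, ← hu, ← hv, ← hw]
      simp only [y, Sum.elim_inr, Pi.sub_apply, Pi.single_eq_same, sub_sub_sub_cancel_right]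
      rw [div_mul_div_comm, mul_comm (rowDen s (p + 1) u i), ← neg_div]
      congr 1
      ring
    · have := hx.not_sub (s := s) hi' hr h
      simp only [y, Sum.elim_inr, sub_sub_sub_cancel_right]
      rw [this, zero_div, neg_zero]
  · split_ifs with h
    · rw [patLower, patRaise, shiftedRow_add_same, shiftedRow_add_of_ne _ (by omega), raiseCoeff,
        lowerCoeff, Nat.add_sub_cancel, ← hu, ← hv, ← hw]
      simp only [y, Sum.elim_inl, Pi.add_apply, Pi.single_eq_same]
      rw [div_mul_div_comm, div_neg, neg_neg, ← neg_div]
      congr 1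
      rw [neg_mul, neg_neg]
      congr 1
      exact Finset.prod_congr rfl fun j _ => by rw [sub_sub, add_comm 1]
    · have := hx.not_add (s := s) hi' hr h
      simp only [y, Sum.elim_inl]
      rw [this, zero_div, neg_zero]

end IsIntPattern

end

/-! ### The norm of a pattern under raising -/

section

variable {n : ℕ} {s : ℝ} {t : ℕ → ℤ} {x : ℕ → ℕ → ℤ}

theorem prod_prod_ite_fst {M : Type*} [CommMonoid M] (p i : ℕ) (T : ℕ → Finset ℕ) (h : ℕ → M) :
    ∏ a ∈ Finset.range p, ∏ b ∈ T a, (if a = i then h b else 1) =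
      if i < p then ∏ b ∈ T i, h b else 1 := by
  have : ∀ a ∈ Finset.range p, ∏ b ∈ T a, (if a = i then h b else 1) =
      if a = i then ∏ b ∈ T a, h b else 1 := by
    intro a _
    split_ifs <;> simp
  rw [Finset.prod_congr rfl this, Finset.prod_ite_eq']
  simp

theorem prod_prod_ite_snd {M : Type*} [CommMonoid M] (p i : ℕ) (T : ℕ → Finset ℕ) (h : ℕ → M) :
    ∏ a ∈ Finset.range p, ∏ b ∈ T a, (if b = i then h a else 1) =
      ∏ a ∈ (Finset.range p).filter (fun a => i ∈ T a), h a := by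
  rw [Finset.prod_filter]
  refine Finset.prod_congr rfl fun a _ => ?_
  rw [Finset.prod_ite_eq']

theorem prod_range_split {M : Type*} [CommMonoid M] {r i : ℕ} (hi : i ≤ r) (h : ℕ → M) :
    ∏ j ∈ Finset.range r, h j = (∏ j ∈ Finset.range i, h j) * ∏ j ∈ Finset.Ico i r, h j := by
  rw [Finset.range_eq_Ico, Finset.range_eq_Ico,
    Finset.prod_Ico_consecutive h (Nat.zero_le i) hi]

theorem prod_qInt_sub_comm (s : ℝ) (S : Finset ℕ) (f g : ℕ → ℤ) :
    ∏ j ∈ S, qInt s (f j - g j) = (-1) ^ S.card * ∏ j ∈ S, qInt s (g j - f j) := by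
  rw [← Finset.prod_const, ← Finset.prod_mul_distrib]
  exact Finset.prod_congr rfl fun j _ => by rw [qInt_sub_comm, neg_one_mul]

theorem rowDen_eq (s : ℝ) {r i : ℕ} (hi : i < r) (u : ℕ → ℤ) :
    rowDen s r u i = (-1) ^ (r - (i + 1)) * ((∏ j ∈ Finset.range i, qInt s (u j - u i)) *
      ∏ j ∈ Finset.Ico (i + 1) r, qInt s (u i - u j)) := by
  rw [rowDen, prod_range_split hi.le, Finset.prod_eq_prod_Ico_succ_bot hi, if_pos rfl, one_mul]
  have h1 : ∏ j ∈ Finset.range i, (if j = i then 1 else qInt s (u j - u i)) =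
      ∏ j ∈ Finset.range i, qInt s (u j - u i) :=
    Finset.prod_congr rfl fun j hj => if_neg (Finset.mem_range.1 hj).ne
  have h2 : ∏ j ∈ Finset.Ico (i + 1) r, (if j = i then 1 else qInt s (u j - u i)) =
      ∏ j ∈ Finset.Ico (i + 1) r, qInt s (u j - u i) :=
    Finset.prod_congr rfl fun j hj => if_neg (by have := Finset.mem_Ico.1 hj; omega)
  rw [h1, h2, prod_qInt_sub_comm s (Finset.Ico (i + 1) r) u, Nat.card_Ico]
  ring

/-- The row `u` with the entry at position `i` raised by one. -/
def raiseRow (u : ℕ → ℤ) (i : ℕ) : ℕ → ℤ := fun j => if j = i then u i + 1 else u j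

theorem raiseRow_eq (u : ℕ → ℤ) (i : ℕ) : u + Pi.single i 1 = raiseRow u i := by
  funext j
  simp only [raiseRow, Pi.add_apply, Pi.single_apply]
  split_ifs with h
  · rw [h]
  · simp

theorem upperProd_raise_fst (s : ℝ) (p i : ℕ) (u v : ℕ → ℤ)
    (h : ∀ b ∈ Finset.Ico i p, 0 ≤ u i - v b) :
    upperProd s p (raiseRow u i) v =
      upperProd s p u v * ∏ b ∈ Finset.Ico i p, qInt s (u i + 1 - v b) := by
  have h1 := prod_prod_ite_fst p i (fun a => Finset.Ico a p) (fun b => qInt s (u i + 1 - v b))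
  have h2 : (if i < p then ∏ b ∈ Finset.Ico i p, qInt s (u i + 1 - v b) else 1) =
      ∏ b ∈ Finset.Ico i p, qInt s (u i + 1 - v b) := by
    split_ifs with hip
    · rfl
    · rw [Finset.Ico_eq_empty (by omega), Finset.prod_empty]
  rw [← h2, ← h1, upperProd, upperProd, ← Finset.prod_mul_distrib]
  refine Finset.prod_congr rfl fun a _ => ?_
  rw [← Finset.prod_mul_distrib]
  refine Finset.prod_congr rfl fun b hb => ?_
  simp only [raiseRow]
  split_ifs with hai
  · subst hai
    rw [show u a + 1 - v b = u a - v b + 1 by ring, qFac_succ s (h b hb), mul_comm]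
  · rw [mul_one]

theorem lowerProd_raise_snd (s : ℝ) {p i : ℕ} (hi : i ≤ p) (u v : ℕ → ℤ)
    (h : ∀ a, a < i → 2 ≤ v a - u i) :
    lowerProd s p v (raiseRow u i) * ∏ a ∈ Finset.range i, qInt s (v a - u i - 1) =
      lowerProd s p v u := by
  have h1 := prod_prod_ite_snd p i (fun a => Finset.Ico (a + 1) (p + 1))
    (fun a => qInt s (v a - u i - 1))
  have h2 : (Finset.range p).filter (fun a => i ∈ Finset.Ico (a + 1) (p + 1)) =
      Finset.range i := by
    ext a
    simp only [Finset.mem_filter, Finset.mem_range, Finset.mem_Ico]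
    omega
  rw [← h2, ← h1, lowerProd, lowerProd, ← Finset.prod_mul_distrib]
  refine Finset.prod_congr rfl fun a _ => ?_
  rw [← Finset.prod_mul_distrib]
  refine Finset.prod_congr rfl fun b hb => ?_
  simp only [raiseRow]
  split_ifs with hbi
  · subst hbi
    rw [Finset.mem_Ico] at hb
    have := h a (by omega)
    rw [qFac_eq_mul s (z := v a - u b - 1) (by omega), mul_comm]
    congr 2
    ring
  · rw [mul_one]

theorem upperProd_raise_snd (s : ℝ) {r i : ℕ} (hi : i < r) (w u : ℕ → ℤ)
    (h : ∀ a, a ≤ i → 1 ≤ w a - u i) :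
    upperProd s r w (raiseRow u i) * ∏ a ∈ Finset.range (i + 1), qInt s (w a - u i) =
      upperProd s r w u := by
  have h1 := prod_prod_ite_snd r i (fun a => Finset.Ico a r) (fun a => qInt s (w a - u i))
  have h2 : (Finset.range r).filter (fun a => i ∈ Finset.Ico a r) = Finset.range (i + 1) := by
    ext a
    simp only [Finset.mem_filter, Finset.mem_range, Finset.mem_Ico]
    omega
  rw [← h2, ← h1, upperProd, upperProd, ← Finset.prod_mul_distrib]
  refine Finset.prod_congr rfl fun a _ => ?_
  rw [← Finset.prod_mul_distrib]
  refine Finset.prod_congr rfl fun b hb => ?_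
  simp only [raiseRow]
  split_ifs with hbi
  · subst hbi
    rw [Finset.mem_Ico] at hb
    rw [qFac_eq_mul s (h a hb.1), mul_comm]
    congr 2
    ring
  · rw [mul_one]

theorem lowerProd_raise_fst (s : ℝ) {r i : ℕ} (hi : i < r) (u w : ℕ → ℤ)
    (h : ∀ b ∈ Finset.Ico (i + 1) (r + 1), 1 ≤ u i - w b) :
    lowerProd s r (raiseRow u i) w =
      lowerProd s r u w * ∏ b ∈ Finset.Ico (i + 1) (r + 1), qInt s (u i - w b) := by
  have h1 := prod_prod_ite_fst r i (fun a => Finset.Ico (a + 1) (r + 1))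
    (fun b => qInt s (u i - w b))
  rw [if_pos hi] at h1
  rw [← h1, lowerProd, lowerProd, ← Finset.prod_mul_distrib]
  refine Finset.prod_congr rfl fun a _ => ?_
  rw [← Finset.prod_mul_distrib]
  refine Finset.prod_congr rfl fun b hb => ?_
  simp only [raiseRow]
  split_ifs with hai
  · subst hai
    have := h b hb
    rw [show u a + 1 - w b - 1 = u a - w b by ring, qFac_eq_mul s this, mul_comm]
  · rw [mul_one]

/-- Up to a sign independent of the row, `rowDen` is the part of `rowProd` that involves position i,
and the rest is unaffected by the raise. -/
theorem rowProd_raise (s : ℝ) {r i : ℕ} (hi : i < r) (u : ℕ → ℤ) :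
    rowProd s r (raiseRow u i) * rowDen s r u i = rowProd s r u * rowDen s r (raiseRow u i) i := by
  rw [rowDen_eq s hi, rowDen_eq s hi]
  have hf : (Finset.range r).filter (fun a => i ∈ Finset.Ico (a + 1) r) = Finset.range i := by
    ext a
    simp only [Finset.mem_filter, Finset.mem_range, Finset.mem_Ico]
    omega
  have key : ∀ g h : ℕ → ℝ, (∏ a ∈ Finset.range i, g a) * ∏ b ∈ Finset.Ico (i + 1) r, h b =
      ∏ a ∈ Finset.range r, ∏ b ∈ Finset.Ico (a + 1) r,
        ((if b = i then g a else 1) * (if a = i then h b else 1)) := by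
    intro g h
    simp only [Finset.prod_mul_distrib]
    rw [prod_prod_ite_fst r i (fun a => Finset.Ico (a + 1) r) h, if_pos hi,
      prod_prod_ite_snd r i (fun a => Finset.Ico (a + 1) r) g, hf]
  rw [mul_left_comm, mul_left_comm (rowProd s r u)]
  congr 1
  rw [key, key, rowProd, rowProd, ← Finset.prod_mul_distrib, ← Finset.prod_mul_distrib]
  refine Finset.prod_congr rfl fun a _ => ?_
  rw [← Finset.prod_mul_distrib, ← Finset.prod_mul_distrib]
  refine Finset.prod_congr rfl fun b hb => ?_
  rw [Finset.mem_Ico] at hb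
  simp only [raiseRow]
  by_cases hb' : b = i
  · subst hb'
    have : a ≠ b := by omega
    simp [this, mul_comm]
  · by_cases ha : a = i
    · subst ha
      simp [hb', mul_comm]
    · simp [ha, hb']

/-- The entries v b with b ≥ i contribute a gained factor of `upperProd`, those with b < i a lost
factor of `lowerProd`. Together they form the numerator of the lowering coefficient of the raised
row, up to a sign. -/
theorem normFactor_raise_snd (s : ℝ) {p i : ℕ} (hi : i ≤ p) (v u : ℕ → ℤ)
    (h1 : ∀ b ∈ Finset.Ico i p, 0 ≤ u i - v b) (h2 : ∀ a, a < i → 2 ≤ v a - u i)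
    (h3 : lowerProd s p v u ≠ 0) :
    normFactor s p v (raiseRow u i) = normFactor s p v u * ((-1) ^ (p - i) *
      ∏ j ∈ Finset.range p, qInt s (v j - (u i + 1))) := by
  have e2 := lowerProd_raise_snd s hi u v h2
  have hne : lowerProd s p v (raiseRow u i) ≠ 0 := by
    intro h
    rw [h, zero_mul] at e2
    exact h3 e2.symm
  have hne2 : ∏ a ∈ Finset.range i, qInt s (v a - u i - 1) ≠ 0 := by
    intro h
    rw [h, mul_zero] at e2
    exact h3 e2.symm
  have e3 : ∏ j ∈ Finset.range i, qInt s (v j - (u i + 1)) =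
      ∏ a ∈ Finset.range i, qInt s (v a - u i - 1) :=
    Finset.prod_congr rfl fun j _ => by rw [sub_sub]
  rw [normFactor, normFactor, upperProd_raise_fst s p i u v h1, ← e2, prod_range_split hi, e3,
    prod_qInt_sub_comm s (Finset.Ico i p) v, Nat.card_Ico]
  have hsq : ((-1 : ℝ) ^ (p - i)) * (-1) ^ (p - i) = 1 := by
    rw [← mul_pow]; simp
  generalize (-1 : ℝ) ^ (p - i) = e at hsq
  generalize lowerProd s p v (raiseRow u i) = L at hne
  generalize ∏ a ∈ Finset.range i, qInt s (v a - u i - 1) = A at hne2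
  field_simp
  linear_combination (-(upperProd s p u v) * (∏ x ∈ Finset.Ico i p, qInt s (u i + 1 - v x)) *
    (rowProd s p v)⁻¹) * hsq

/-- The changes in `upperProd` and `lowerProd` make up the numerator of the raising coefficient;
what is left is the denominator of the lowering coefficient of the raised row. The sign is the one
in `normFactor_raise_snd` for p = r - 1. -/
theorem normFactor_raise_fst (s : ℝ) {r i : ℕ} (hi : i < r) (u w : ℕ → ℤ)
    (h1 : ∀ a, a ≤ i → 1 ≤ w a - u i)
    (h2 : ∀ b ∈ Finset.Ico (i + 1) (r + 1), 1 ≤ u i - w b)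
    (h3 : upperProd s r w u ≠ 0) (h4 : lowerProd s r (raiseRow u i) w ≠ 0)
    (h5 : rowProd s r u ≠ 0) (h6 : rowProd s r (raiseRow u i) ≠ 0)
    (h7 : rowDen s r u i ≠ 0) (h8 : rowDen s r (raiseRow u i) i ≠ 0) :
    normFactor s r (raiseRow u i) w * raiseCoeff s r u w i * (-1) ^ (r - 1 - i) =
      normFactor s r u w * (rowDen s r (raiseRow u i) i)⁻¹ := by
  have e1 := upperProd_raise_snd s hi w u h1
  have e2 := lowerProd_raise_fst s hi u w h2
  have e3 := rowProd_raise s hi u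
  rw [e2] at h4
  have hsplit := prod_range_split (show i + 1 ≤ r + 1 by omega) (fun j => qInt s (w j - u i))
  rw [prod_qInt_sub_comm s (Finset.Ico (i + 1) (r + 1)) w, Nat.card_Ico] at hsplit
  rw [normFactor, normFactor, raiseCoeff, hsplit, e2, ← e1]
  have hsq : ((-1 : ℝ) ^ (r + 1 - (i + 1))) * (-1) ^ (r - 1 - i) = -1 := by
    obtain ⟨k, rfl⟩ : ∃ k, r = i + k + 1 := ⟨r - i - 1, by omega⟩
    rw [show i + k + 1 + 1 - (i + 1) = k + 1 by omega, show i + k + 1 - 1 - i = k by omega,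
      pow_succ, mul_right_comm, ← mul_pow]
    simp
  generalize (-1 : ℝ) ^ (r + 1 - (i + 1)) = e at hsq ⊢
  generalize (-1 : ℝ) ^ (r - 1 - i) = e' at hsq ⊢
  have h9 := left_ne_zero_of_mul h4
  have h10 := right_ne_zero_of_mul h4
  generalize lowerProd s r u w = L at *
  generalize ∏ b ∈ Finset.Ico (i + 1) (r + 1), qInt s (u i - w b) = A at *
  generalize ∏ a ∈ Finset.range (i + 1), qInt s (w a - u i) = A' at *
  generalize upperProd s r w (raiseRow u i) = U at *
  generalize rowDen s r (raiseRow u i) i = D' at *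
  generalize rowDen s r u i = D at *
  generalize rowProd s r (raiseRow u i) = R' at *
  generalize rowProd s r u = R at *
  field_simp
  linear_combination (-(U * A' * R * D')) * hsq - U * A' * e3

theorem IsIntPattern.rowDen_ne (hx : IsIntPattern n t x) (hg : IsGenericTop n s t) {r i : ℕ}
    (hi : i < r) (hr : r < n) : rowDen s r (shiftedRow x r) i ≠ 0 := by
  refine Finset.prod_ne_zero_iff.2 fun j hj => ?_
  rw [Finset.mem_range] at hj
  split_ifs with h
  · exact one_ne_zero
  · have h1 := hx.row_sub_le hg hi hr.le hj hr.le
    have h2 := hx.row_sub_le hg hj hr.le hi hr.le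
    rcases lt_or_gt_of_ne h with h | h
    · have := hx.row_sub_pos hg h hi hr.le
      exact hg.qInt_ne (by omega) (by omega) (by omega)
    · have := hx.row_sub_pos hg h hj hr.le
      exact hg.qInt_ne (by omega) (by omega) (by omega)

/-- The adjointness of raising and lowering, read on matrix entries; `patternNorm` is designed as a
solution of this recursion. Only the two norm factors that contain row r change. -/
theorem IsIntPattern.patternNorm_add (hx : IsIntPattern n t x) (hg : IsGenericTop n s t)
    {r i : ℕ} (hi : i < r) (hr : r < n) (hy : IsIntPattern n t (x + unitArray r i)) :
    patternNorm n s (x + unitArray r i) * patRaise s x r i =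
      patLower s (x + unitArray r i) r i * patternNorm n s x := by
  obtain ⟨p, rfl⟩ : ∃ p, r = p + 1 := ⟨r - 1, by omega⟩
  set y := x + unitArray (p + 1) i with hydef
  have hrow : shiftedRow y (p + 1) = raiseRow (shiftedRow x (p + 1)) i := by
    rw [hydef, shiftedRow_add_same, raiseRow_eq]
  have hrow' : ∀ m, m ≠ p + 1 → shiftedRow y m = shiftedRow x m := fun m hm =>
    shiftedRow_add_of_ne i hm
  have hyi : shiftedRow y (p + 1) i = shiftedRow x (p + 1) i + 1 := by
    rw [hrow, raiseRow, if_pos rfl]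
  have hprod : ∀ z : ℕ → ℕ → ℤ,
      ∏ m ∈ Finset.range n, normFactor s m (shiftedRow z m) (shiftedRow z (m + 1)) =
      normFactor s p (shiftedRow z p) (shiftedRow z (p + 1)) *
      (normFactor s (p + 1) (shiftedRow z (p + 1)) (shiftedRow z (p + 2)) *
      ∏ m ∈ ((Finset.range n).erase p).erase (p + 1),
        normFactor s m (shiftedRow z m) (shiftedRow z (m + 1))) := by
    intro z
    rw [← Finset.mul_prod_erase _ _ (show p ∈ Finset.range n by rw [Finset.mem_range]; omega),
      ← Finset.mul_prod_erase _ _ (show p + 1 ∈ (Finset.range n).erase p by simp; omega)]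
  have hrest : ∏ m ∈ ((Finset.range n).erase p).erase (p + 1),
        normFactor s m (shiftedRow y m) (shiftedRow y (m + 1)) =
      ∏ m ∈ ((Finset.range n).erase p).erase (p + 1),
        normFactor s m (shiftedRow x m) (shiftedRow x (m + 1)) := by
    refine Finset.prod_congr rfl fun m hm => ?_
    simp only [Finset.mem_erase] at hm
    rw [hrow' m hm.1, hrow' (m + 1) (by omega)]
  -- The strict bounds needed here and for `f2` come from interlacing of the raised pattern `y`.
  have f1 := normFactor_raise_snd s (show i ≤ p by omega) (shiftedRow x p)
    (shiftedRow x (p + 1)) (fun b hb => by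
      rw [Finset.mem_Ico] at hb
      exact hx.upper_sub_nonneg hg hb.1 hb.2 (by omega)) (fun a ha => by
      have := hy.lower_sub_pos hg ha (show i ≤ p by omega) (by omega)
      rw [hyi, hrow' p (by omega)] at this
      omega) (hx.lowerProd_ne hg (by omega))
  have f2 := normFactor_raise_fst s hi (shiftedRow x (p + 1)) (shiftedRow x (p + 2))
    (fun a ha => by
      have := hy.upper_sub_nonneg hg ha hi hr
      rw [hyi, hrow' (p + 1 + 1) (by omega)] at this
      rw [show p + 2 = p + 1 + 1 from rfl]
      omega) (fun b hb => by
      rw [Finset.mem_Ico] at hb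
      exact hx.lower_sub_pos hg (show i < b by omega) (by omega) hr)
    (hx.upperProd_ne hg hr)
    (by
      have := hy.lowerProd_ne hg hr
      rwa [hrow, hrow' (p + 1 + 1) (by omega)] at this)
    (hx.rowProd_ne hg hr)
    (by have := hy.rowProd_ne hg hr; rwa [hrow] at this)
    (hx.rowDen_ne hg hi hr)
    (by have := hy.rowDen_ne hg hi hr; rwa [hrow] at this)
  rw [patternNorm, patternNorm, hprod y, hprod x, hrest, hrow' p (by omega),
    hrow' (p + 2) (by omega), hrow' n (by omega), hrow, f1, patRaise, patLower, lowerCoeff,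
    Nat.add_sub_cancel, hrow, hrow' p (by omega), raiseRow, if_pos rfl]
  change _ = _ / rowDen s (p + 1) (raiseRow (shiftedRow x (p + 1)) i) i * _
  rw [show p + 1 + 1 = p + 2 from rfl] at *
  rw [Nat.add_sub_cancel] at f2
  rw [div_eq_mul_inv]
  linear_combination (normFactor s p (shiftedRow x p) (shiftedRow x (p + 1)) *
    (∏ j ∈ Finset.range p, qInt s (shiftedRow x p j - (shiftedRow x (p + 1) i + 1))) *
    (∏ m ∈ ((Finset.range n).erase p).erase (p + 1),
        normFactor s m (shiftedRow x m) (shiftedRow x (m + 1))) *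
    ∏ i ∈ Finset.range n, ∏ j ∈ Finset.Ico (i + 1) n,
      qFac s (shiftedRow x n i - shiftedRow x n j - 1)) * f2

end

/-! ### The Gelfand–Tsetlin model -/

section

variable {n : ℕ} {s : ℝ} {t : ℕ → ℤ}

/-- The space with basis the integral patterns with top row `t`. -/
abbrev PatternSpace (n : ℕ) (t : ℕ → ℤ) : Type := IntPattern n t →₀ ℂ

open scoped Classical in
/-- The basis vector of an array, which is `0` if the array is not a pattern. -/
noncomputable def patVec (n : ℕ) (t : ℕ → ℤ) (x : ℕ → ℕ → ℤ) : PatternSpace n t :=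
  if h : IsIntPattern n t x then Finsupp.single ⟨x, h⟩ 1 else 0

theorem patVec_of {x : ℕ → ℕ → ℤ} (h : IsIntPattern n t x) :
    patVec n t x = Finsupp.single ⟨x, h⟩ 1 := dif_pos h

theorem patVec_of_not {x : ℕ → ℕ → ℤ} (h : ¬IsIntPattern n t x) : patVec n t x = 0 := dif_neg h

theorem patVec_coe (P : IntPattern n t) : patVec n t P.1 = Finsupp.single P 1 := patVec_of P.2

theorem patternSpace_ext {W : Type*} [AddCommGroup W] [Module ℂ W]
    {A B : PatternSpace n t →ₗ[ℂ] W}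
    (h : ∀ x, IsIntPattern n t x → A (patVec n t x) = B (patVec n t x)) : A = B := by
  refine Finsupp.lhom_ext' fun P => LinearMap.ext_ring ?_
  have := h P.1 P.2
  rw [patVec_coe] at this
  exact this

/-- The operator that raises an entry of row `r`. -/
noncomputable def raiseOp (n : ℕ) (s : ℝ) (t : ℕ → ℤ) (r : ℕ) :
    PatternSpace n t →ₗ[ℂ] PatternSpace n t :=
  Finsupp.linearCombination ℂ fun P : IntPattern n t =>
    ∑ i ∈ Finset.range r, (patRaise s P.1 r i : ℂ) • patVec n t (P.1 + unitArray r i)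

/-- The operator that lowers an entry of row `r`. -/
noncomputable def lowerOp (n : ℕ) (s : ℝ) (t : ℕ → ℤ) (r : ℕ) :
    PatternSpace n t →ₗ[ℂ] PatternSpace n t :=
  Finsupp.linearCombination ℂ fun P : IntPattern n t =>
    ∑ i ∈ Finset.range r, (patLower s P.1 r i : ℂ) • patVec n t (P.1 - unitArray r i)

/-- The operator that is diagonal in the basis of patterns. -/
noncomputable def diagOp (n : ℕ) (t : ℕ → ℤ) (f : (ℕ → ℕ → ℤ) → ℂ) :
    PatternSpace n t →ₗ[ℂ] PatternSpace n t :=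
  Finsupp.linearCombination ℂ fun P : IntPattern n t => f P.1 • patVec n t P.1

theorem raiseOp_patVec {x : ℕ → ℕ → ℤ} (hx : IsIntPattern n t x) (r : ℕ) :
    raiseOp n s t r (patVec n t x) =
      ∑ i ∈ Finset.range r, (patRaise s x r i : ℂ) • patVec n t (x + unitArray r i) := by
  rw [patVec_of hx, raiseOp, Finsupp.linearCombination_single, one_smul]

theorem lowerOp_patVec {x : ℕ → ℕ → ℤ} (hx : IsIntPattern n t x) (r : ℕ) :
    lowerOp n s t r (patVec n t x) =
      ∑ i ∈ Finset.range r, (patLower s x r i : ℂ) • patVec n t (x - unitArray r i) := by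
  rw [patVec_of hx, lowerOp, Finsupp.linearCombination_single, one_smul]

theorem diagOp_patVec (f : (ℕ → ℕ → ℤ) → ℂ) (x : ℕ → ℕ → ℤ) :
    diagOp n t f (patVec n t x) = f x • patVec n t x := by
  by_cases hx : IsIntPattern n t x
  · rw [patVec_of hx, diagOp, Finsupp.linearCombination_single, one_smul, patVec_of hx]
  · rw [patVec_of_not hx, map_zero, smul_zero]

-- With the coefficient set to 0 off the patterns the formula holds for every array, so operators
-- can be composed without case distinctions.
open scoped Classical in
theorem raiseOp_patVec' (x : ℕ → ℕ → ℤ) (r : ℕ) :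
    raiseOp n s t r (patVec n t x) = ∑ i ∈ Finset.range r,
      ((if IsIntPattern n t x then patRaise s x r i else 0 : ℝ) : ℂ) •
        patVec n t (x + unitArray r i) := by
  by_cases hx : IsIntPattern n t x
  · simp only [if_pos hx, raiseOp_patVec hx]
  · simp [if_neg hx, patVec_of_not hx]

open scoped Classical in
theorem lowerOp_patVec' (x : ℕ → ℕ → ℤ) (r : ℕ) :
    lowerOp n s t r (patVec n t x) = ∑ i ∈ Finset.range r,
      ((if IsIntPattern n t x then patLower s x r i else 0 : ℝ) : ℂ) •
        patVec n t (x - unitArray r i) := by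
  by_cases hx : IsIntPattern n t x
  · simp only [if_pos hx, lowerOp_patVec hx]
  · simp [if_neg hx, patVec_of_not hx]

/-- The part of the commutator of a raising and a lowering operator that comes from one pair of
entries. -/
noncomputable def pathTerm (n : ℕ) (s : ℝ) (t : ℕ → ℤ) (x : ℕ → ℕ → ℤ) (r i r' j : ℕ) :
    PatternSpace n t :=
  open scoped Classical in
  (((if IsIntPattern n t (x - unitArray r' j) then
      patLower s x r' j * patRaise s (x - unitArray r' j) r i else 0) -
    (if IsIntPattern n t (x + unitArray r i) then
      patRaise s x r i * patLower s (x + unitArray r i) r' j else 0) : ℝ) : ℂ) •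
    patVec n t (x + unitArray r i - unitArray r' j)

theorem raise_lower_patVec {x : ℕ → ℕ → ℤ} (hx : IsIntPattern n t x) (r r' : ℕ) :
    raiseOp n s t r (lowerOp n s t r' (patVec n t x)) -
      lowerOp n s t r' (raiseOp n s t r (patVec n t x)) =
      ∑ i ∈ Finset.range r, ∑ j ∈ Finset.range r', pathTerm n s t x r i r' j := by
  classical
  rw [lowerOp_patVec hx, raiseOp_patVec hx, map_sum, map_sum]
  simp only [map_smul, raiseOp_patVec', lowerOp_patVec', Finset.smul_sum, smul_smul]
  rw [Finset.sum_comm, ← Finset.sum_sub_distrib]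
  refine Finset.sum_congr rfl fun i _ => ?_
  rw [← Finset.sum_sub_distrib]
  refine Finset.sum_congr rfl fun j _ => ?_
  rw [pathTerm, ← sub_add_eq_add_sub, ← sub_smul]
  congr 1
  push_cast
  split_ifs <;> simp

/-- If the end point is a pattern, so are both intermediate arrays, and the two paths cancel;
otherwise the end vector is 0. Only returning through the same entry is different. -/
theorem pathTerm_eq_zero {x : ℕ → ℕ → ℤ} (hx : IsIntPattern n t x) {r i r' j : ℕ} (hi : i < r)
    (hr : r < n) (hj : j < r') (hr' : r' < n) (hne : ¬(r = r' ∧ i = j)) :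
    pathTerm n s t x r i r' j = 0 := by
  by_cases hy : IsIntPattern n t (x + unitArray r i - unitArray r' j)
  · rw [pathTerm, if_pos (hx.sub_of_add_sub hne hj hr' hy), if_pos (hx.add_of_add_sub hne hi hr hy),
      patLower_mul_patRaise s x hi hj hne, sub_self, Complex.ofReal_zero, zero_smul]
  · rw [pathTerm, patVec_of_not hy, smul_zero]

theorem raiseOp_lowerOp_of_ne {r r' : ℕ} (h : r ≠ r') (hr : r < n) (hr' : r' < n) :
    raiseOp n s t r ∘ₗ lowerOp n s t r' = lowerOp n s t r' ∘ₗ raiseOp n s t r := by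
  refine patternSpace_ext fun x hx => ?_
  rw [LinearMap.comp_apply, LinearMap.comp_apply, ← sub_eq_zero, raise_lower_patVec hx]
  exact Finset.sum_eq_zero fun i hi => Finset.sum_eq_zero fun j hj =>
    pathTerm_eq_zero hx (Finset.mem_range.1 hi) hr (Finset.mem_range.1 hj) hr' fun h' => h h'.1

theorem raiseOp_lowerOp_same (hg : IsGenericTop n s t) {p : ℕ} (hr : p + 1 < n) :
    raiseOp n s t (p + 1) ∘ₗ lowerOp n s t (p + 1) -
      lowerOp n s t (p + 1) ∘ₗ raiseOp n s t (p + 1) =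
      diagOp n t fun x => (qInt s (intWt x p - intWt x (p + 1)) : ℂ) := by
  refine patternSpace_ext fun x hx => ?_
  rw [LinearMap.sub_apply, LinearMap.comp_apply, LinearMap.comp_apply, raise_lower_patVec hx,
    diagOp_patVec, ← hx.sum_raise_lower hg hr, Complex.ofReal_sum, Finset.sum_smul]
  refine Finset.sum_congr rfl fun i hi => ?_
  rw [Finset.sum_eq_single_of_mem i hi fun j hj hji => pathTerm_eq_zero hx
    (Finset.mem_range.1 hi) hr (Finset.mem_range.1 hj) hr fun h => hji h.2.symm, pathTerm,
    add_sub_cancel_right]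

/-- The change of the coordinate `k` of the weight under raising an entry of row `r`. -/
def rootCoord (r k : ℕ) : ℤ := (if k + 1 = r then 1 else 0) - if k = r then 1 else 0

theorem sum_unitArray (r i m q : ℕ) :
    ∑ a ∈ Finset.range q, unitArray r i m a = if m = r ∧ i < q then 1 else 0 := by
  by_cases h : m = r <;> simp [unitArray, h]

theorem intWt_add (x : ℕ → ℕ → ℤ) {r i : ℕ} (hi : i < r) (k : ℕ) :
    intWt (x + unitArray r i) k = intWt x k + rootCoord r k := by
  simp only [intWt, Pi.add_apply, Finset.sum_add_distrib, sum_unitArray, rootCoord]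
  have h1 : (k + 1 = r ∧ i < k + 1) ↔ k + 1 = r := by omega
  have h2 : (k = r ∧ i < k) ↔ k = r := by omega
  simp only [h1, h2]
  ring

theorem intWt_sub (x : ℕ → ℕ → ℤ) {r i : ℕ} (hi : i < r) (k : ℕ) :
    intWt (x - unitArray r i) k = intWt x k - rootCoord r k := by
  have := intWt_add (x - unitArray r i) hi k
  rw [sub_add_cancel] at this
  rw [this]; ring

theorem diagOp_comp (f g : (ℕ → ℕ → ℤ) → ℂ) :
    diagOp n t f ∘ₗ diagOp n t g = diagOp n t fun x => f x * g x := by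
  refine patternSpace_ext fun x hx => ?_
  rw [LinearMap.comp_apply, diagOp_patVec, map_smul, diagOp_patVec, diagOp_patVec, smul_smul,
    mul_comm]

theorem diagOp_one : diagOp n t (fun _ => 1) = LinearMap.id := by
  refine patternSpace_ext fun x hx => ?_
  rw [diagOp_patVec, one_smul, LinearMap.id_apply]

/-- The operators by which the `K_k` (`e = 1`) and their inverses (`e = -1`) act. -/
noncomputable def weightOp (n : ℕ) (s : ℝ) (t : ℕ → ℤ) (c e : ℝ) (k : ℕ) :
    PatternSpace n t →ₗ[ℂ] PatternSpace n t :=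
  diagOp n t fun x => qPow s (e * (c + intWt x k))

theorem weightOp_raiseOp (c e : ℝ) (r k : ℕ) :
    weightOp n s t c e k ∘ₗ raiseOp n s t r =
      qPow s (e * rootCoord r k) • (raiseOp n s t r ∘ₗ weightOp n s t c e k) := by
  refine patternSpace_ext fun x hx => ?_
  rw [LinearMap.smul_apply, LinearMap.comp_apply, LinearMap.comp_apply, raiseOp_patVec hx,
    weightOp, diagOp_patVec, map_smul, raiseOp_patVec hx, map_sum, smul_smul, Finset.smul_sum]
  refine Finset.sum_congr rfl fun i hi => ?_
  rw [map_smul, diagOp_patVec, intWt_add x (Finset.mem_range.1 hi), ← qPow_add, smul_comm]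
  congr 3
  push_cast; ring

theorem weightOp_lowerOp (c e : ℝ) (r k : ℕ) :
    weightOp n s t c e k ∘ₗ lowerOp n s t r =
      qPow s (-(e * rootCoord r k)) • (lowerOp n s t r ∘ₗ weightOp n s t c e k) := by
  refine patternSpace_ext fun x hx => ?_
  rw [LinearMap.smul_apply, LinearMap.comp_apply, LinearMap.comp_apply, lowerOp_patVec hx,
    weightOp, diagOp_patVec, map_smul, lowerOp_patVec hx, map_sum, smul_smul, Finset.smul_sum]
  refine Finset.sum_congr rfl fun i hi => ?_
  rw [map_smul, diagOp_patVec, intWt_sub x (Finset.mem_range.1 hi), ← qPow_add, smul_comm]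
  congr 3
  push_cast; ring

/-! ### The contravariant form of the model -/

/-- The Hermitian form for which the patterns are orthogonal with norm `patternNorm`. -/
noncomputable def patternForm (n : ℕ) (s : ℝ) (t : ℕ → ℤ) :
    PatternSpace n t →ₗ⋆[ℂ] PatternSpace n t →ₗ[ℂ] ℂ where
  toFun v := Finsupp.linearCombination ℂ fun P : IntPattern n t =>
    conj (v P) * (patternNorm n s P.1 : ℂ)
  map_add' v w := by
    refine Finsupp.lhom_ext' fun P => LinearMap.ext_ring ?_
    simp [add_mul]
  map_smul' a v := by
    refine Finsupp.lhom_ext' fun P => LinearMap.ext_ring ?_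
    simp [mul_assoc]

theorem patternForm_single (v : PatternSpace n t) (P : IntPattern n t) :
    patternForm n s t v (Finsupp.single P 1) = conj (v P) * (patternNorm n s P.1 : ℂ) := by
  simp [patternForm]

theorem patternForm_patVec {x y : ℕ → ℕ → ℤ} (hx : IsIntPattern n t x)
    (hy : IsIntPattern n t y) : patternForm n s t (patVec n t x) (patVec n t y) =
      open scoped Classical in if x = y then (patternNorm n s x : ℂ) else 0 := by
  classical
  rw [patVec_of hx, patVec_of hy, patternForm_single, Finsupp.single_apply]
  by_cases h : x = y
  · subst h; simp
  · simp [h]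

theorem sesq_ext {A B : PatternSpace n t →ₗ⋆[ℂ] PatternSpace n t →ₗ[ℂ] ℂ}
    (h : ∀ x y, IsIntPattern n t x → IsIntPattern n t y →
      A (patVec n t x) (patVec n t y) = B (patVec n t x) (patVec n t y)) : A = B := by
  refine LinearMap.ext fun v => ?_
  refine patternSpace_ext fun y hy => ?_
  induction v using Finsupp.induction_linear with
  | zero => simp
  | add f g hf hg => rw [map_add, map_add, LinearMap.add_apply, LinearMap.add_apply, hf, hg]
  | single P a =>
    have := h P.1 y P.2 hy
    rw [patVec_coe] at this
    rw [← mul_one a, ← smul_eq_mul, ← Finsupp.smul_single, LinearMap.map_smulₛₗ,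
      LinearMap.map_smulₛₗ, LinearMap.smul_apply, LinearMap.smul_apply, this]

theorem patternForm_hermitian (v w : PatternSpace n t) :
    patternForm n s t w v = conj (patternForm n s t v w) := by
  classical
  induction v using Finsupp.induction_linear with
  | zero => simp
  | add f g hf hg => rw [map_add, map_add, LinearMap.add_apply, map_add, hf, hg]
  | single P a =>
    induction w using Finsupp.induction_linear with
    | zero => simp
    | add f g hf hg => rw [map_add, map_add, LinearMap.add_apply, map_add, hf, hg]
    | single Q b =>
      rw [← mul_one a, ← mul_one b, ← smul_eq_mul, ← smul_eq_mul, ← Finsupp.smul_single,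
        ← Finsupp.smul_single]
      simp only [LinearMap.map_smulₛₗ, LinearMap.smul_apply, patternForm_single,
        Finsupp.single_apply, smul_eq_mul, RingHom.id_apply]
      by_cases h : P = Q
      · subst h; simp; ring
      · simp [h, Ne.symm h]

/-- The coefficients are real, so conjugation plays no role, and on patterns the claim is
`patternNorm_add` or 0 = 0. -/
theorem patternForm_raiseOp (hg : IsGenericTop n s t) {r : ℕ} (hr : r < n)
    (v w : PatternSpace n t) :
    patternForm n s t (raiseOp n s t r v) w = patternForm n s t v (lowerOp n s t r w) := by
  classical
  have key : (patternForm n s t).comp (raiseOp n s t r) =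
      (patternForm n s t).compl₂ (lowerOp n s t r) := by
    refine sesq_ext fun x y hx hy => ?_
    rw [LinearMap.comp_apply, LinearMap.compl₂_apply, raiseOp_patVec hx, lowerOp_patVec hy,
      map_sum, map_sum, LinearMap.sum_apply]
    refine Finset.sum_congr rfl fun i hi => ?_
    rw [Finset.mem_range] at hi
    rw [LinearMap.map_smulₛₗ, map_smul, LinearMap.smul_apply, Complex.conj_ofReal]
    by_cases h : x + unitArray r i = y
    · have h' : x = y - unitArray r i := by rw [← h, add_sub_cancel_right]
      rw [h, ← h', patternForm_patVec hy hy, patternForm_patVec hx hx, if_pos rfl, if_pos rfl]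
      have := hx.patternNorm_add hg hi hr (h ▸ hy)
      rw [h] at this
      rw [smul_eq_mul, smul_eq_mul, ← Complex.ofReal_mul, ← Complex.ofReal_mul, mul_comm, this]
    · have h' : x ≠ y - unitArray r i := fun h' => h (by rw [h', sub_add_cancel])
      have h1 : patternForm n s t (patVec n t (x + unitArray r i)) (patVec n t y) = 0 := by
        by_cases hx' : IsIntPattern n t (x + unitArray r i)
        · rw [patternForm_patVec hx' hy, if_neg h]
        · rw [patVec_of_not hx', map_zero, LinearMap.zero_apply]
      have h2 : patternForm n s t (patVec n t x) (patVec n t (y - unitArray r i)) = 0 := by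
        by_cases hy' : IsIntPattern n t (y - unitArray r i)
        · rw [patternForm_patVec hx hy', if_neg h']
        · rw [patVec_of_not hy', map_zero]
      rw [h1, h2, smul_zero, smul_zero]
  have := LinearMap.congr_fun (LinearMap.congr_fun key v) w
  simpa using this

theorem patternForm_lowerOp (hg : IsGenericTop n s t) {r : ℕ} (hr : r < n)
    (v w : PatternSpace n t) :
    patternForm n s t (lowerOp n s t r v) w = patternForm n s t v (raiseOp n s t r w) := by
  rw [patternForm_hermitian, ← patternForm_raiseOp hg hr, ← patternForm_hermitian]

theorem patternForm_weightOp (c : ℝ) (k : ℕ) (v w : PatternSpace n t) :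
    patternForm n s t (weightOp n s t c 1 k v) w =
      patternForm n s t v (weightOp n s t c (-1) k w) := by
  classical
  have key : (patternForm n s t).comp (weightOp n s t c 1 k) =
      (patternForm n s t).compl₂ (weightOp n s t c (-1) k) := by
    refine sesq_ext fun x y hx hy => ?_
    rw [LinearMap.comp_apply, LinearMap.compl₂_apply, weightOp, weightOp, diagOp_patVec,
      diagOp_patVec, LinearMap.map_smulₛₗ, map_smul, LinearMap.smul_apply,
      patternForm_patVec hx hy, conj_qPow]
    by_cases h : x = y
    · subst h; simp
    · simp [h]
  have := LinearMap.congr_fun (LinearMap.congr_fun key v) w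
  simpa using this

end

/-! ### Blocks of patterns with the same upper rows -/

section

variable {n : ℕ} {s : ℝ} {t : ℕ → ℤ} {x y : ℕ → ℕ → ℤ}

/-- The rows `m, m + 1, …` of two arrays agree. -/
def AgreeFrom (m : ℕ) (x y : ℕ → ℕ → ℤ) : Prop := ∀ k i, m ≤ k → x k i = y k i

/-- The rows below row `m` are as large as possible. -/
def IsMaxBelow (m : ℕ) (x : ℕ → ℕ → ℤ) : Prop := ∀ k i, i < k → k < m → x k i = x (k + 1) i

/-- The array with the same rows `m, m + 1, …` whose lower rows are as large as possible. -/
def maxBelow (m : ℕ) (x : ℕ → ℕ → ℤ) : ℕ → ℕ → ℤ :=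
  fun k i => if k < m ∧ i < k then x m i else x k i

theorem agreeFrom_maxBelow (m : ℕ) (x : ℕ → ℕ → ℤ) : AgreeFrom m (maxBelow m x) x := by
  intro k i hk
  rw [maxBelow, if_neg (by omega)]

theorem isMaxBelow_maxBelow (m : ℕ) (x : ℕ → ℕ → ℤ) : IsMaxBelow m (maxBelow m x) := by
  intro k i hi hk
  rw [maxBelow, maxBelow, if_pos ⟨hk, hi⟩]
  split_ifs with h
  · rfl
  · obtain rfl : m = k + 1 := by omega
    rfl

theorem IsMaxBelow.eq_row {m : ℕ} (h : IsMaxBelow m x) (c : ℕ) {k i : ℕ} (hk : k + c = m)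
    (hi : i < k) : x k i = x m i := by
  induction c generalizing k with
  | zero => obtain rfl : k = m := by omega
            rfl
  | succ c ih => rw [h k i hi (by omega), ih (by omega) (by omega)]

theorem IsMaxBelow.eq_of_agreeFrom {m : ℕ} (hx : IsIntPattern n t x) (hy : IsIntPattern n t y)
    (hmx : IsMaxBelow m x) (hmy : IsMaxBelow m y) (h : AgreeFrom m x y) : x = y := by
  funext k i
  by_cases hk : m ≤ k
  · exact h k i hk
  · by_cases hi : i < k
    · rw [hmx.eq_row (m - k) (by omega) hi, hmy.eq_row (m - k) (by omega) hi, h m i le_rfl]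
    · rw [hx.outside k i (by omega), hy.outside k i (by omega)]

theorem IsIntPattern.maxBelow (hx : IsIntPattern n t x) (hg : IsGenericTop n s t) {m : ℕ}
    (hm : m ≤ n) : IsIntPattern n t (maxBelow m x) where
  top i hi := by
    rw [_root_.maxBelow, if_neg (by omega)]
    exact hx.top i hi
  upper k i hi hk := by
    simp only [_root_.maxBelow]
    split_ifs with h1 h2 h2
    · exact le_rfl
    · obtain rfl : m = k + 1 := by omega
      exact le_rfl
    · omega
    · exact hx.upper k i hi hk
  lower k i hi hk := by
    simp only [_root_.maxBelow]
    split_ifs with h1 h2 h2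
    · exact hx.row_succ hg (by omega) hm
    · omega
    · obtain rfl : m = k + 1 := by omega
      exact hx.row_succ hg (by omega) hm
    · exact hx.lower k i hi hk
  outside k i h := by
    rw [_root_.maxBelow, if_neg (by omega)]
    exact hx.outside k i h

/-- Interlacing of the pattern before and after the raise keeps all arguments in the numerator
nonzero and in the generic range. -/
theorem IsIntPattern.patRaise_ne (hx : IsIntPattern n t x) (hg : IsGenericTop n s t) {r i : ℕ}
    (hi : i < r) (hr : r < n) (hy : IsIntPattern n t (x + unitArray r i)) :
    patRaise s x r i ≠ 0 := by
  have hrow : shiftedRow (x + unitArray r i) r i = shiftedRow x r i + 1 := by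
    rw [shiftedRow_add_same]; simp
  have hrow' : shiftedRow (x + unitArray r i) (r + 1) = shiftedRow x (r + 1) :=
    shiftedRow_add_of_ne i (by omega)
  refine div_ne_zero (neg_ne_zero.2 (Finset.prod_ne_zero_iff.2 fun j hj => ?_))
    (hx.rowDen_ne hg hi hr)
  rw [Finset.mem_range] at hj
  rcases le_or_gt j i with h | h
  · have h1 := hy.upper_sub_nonneg hg h hi hr
    have h2 := hx.row_sub_le hg hj hr hi hr.le
    rw [hrow, hrow'] at h1
    exact hg.qInt_ne (by omega) (by omega) (by omega)
  · have h1 := hx.lower_sub_pos hg h (by omega) hr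
    have h2 := hy.row_sub_le hg hi hr.le hj hr
    rw [hrow, hrow'] at h2
    exact hg.qInt_ne (by omega) (by omega) (by omega)

/-! ### Supports, and vectors killed by raising operators. -/

theorem patVec_apply (x : ℕ → ℕ → ℤ) (R : IntPattern n t) :
    patVec n t x R = open scoped Classical in if x = R.1 then 1 else 0 := by
  classical
  by_cases hx : IsIntPattern n t x
  · rw [patVec_of hx, Finsupp.single_apply]
    simp [Subtype.ext_iff]
  · rw [patVec_of_not hx, if_neg fun h : x = R.1 => hx (by rw [h]; exact R.2)]
    rfl

theorem raiseOp_apply (w : PatternSpace n t) (r : ℕ) (R : IntPattern n t) :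
    raiseOp n s t r w R = w.sum fun P c => c * ∑ i ∈ Finset.range r,
      (patRaise s P.1 r i : ℂ) *
        open scoped Classical in if P.1 + unitArray r i = R.1 then 1 else 0 := by
  rw [raiseOp, Finsupp.linearCombination_apply, Finsupp.sum, Finsupp.sum, Finsupp.finsetSum_apply]
  refine Finset.sum_congr rfl fun P _ => ?_
  rw [Finsupp.smul_apply, Finsupp.finsetSum_apply, smul_eq_mul]
  congr 1
  refine Finset.sum_congr rfl fun i _ => ?_
  rw [Finsupp.smul_apply, patVec_apply, smul_eq_mul]

theorem lowerOp_apply (w : PatternSpace n t) (r : ℕ) (R : IntPattern n t) :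
    lowerOp n s t r w R = w.sum fun P c => c * ∑ i ∈ Finset.range r,
      (patLower s P.1 r i : ℂ) *
        open scoped Classical in if P.1 - unitArray r i = R.1 then 1 else 0 := by
  rw [lowerOp, Finsupp.linearCombination_apply, Finsupp.sum, Finsupp.sum, Finsupp.finsetSum_apply]
  refine Finset.sum_congr rfl fun P _ => ?_
  rw [Finsupp.smul_apply, Finsupp.finsetSum_apply, smul_eq_mul]
  congr 1
  refine Finset.sum_congr rfl fun i _ => ?_
  rw [Finsupp.smul_apply, patVec_apply, smul_eq_mul]

theorem exists_of_raiseOp_apply_ne {w : PatternSpace n t} {r : ℕ} {R : IntPattern n t}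
    (h : raiseOp n s t r w R ≠ 0) :
    ∃ P ∈ w.support, ∃ i, i < r ∧ P.1 + unitArray r i = R.1 := by
  rw [raiseOp_apply] at h
  obtain ⟨P, hP, h1⟩ := Finset.exists_ne_zero_of_sum_ne_zero h
  obtain ⟨i, hi, h2⟩ := Finset.exists_ne_zero_of_sum_ne_zero (right_ne_zero_of_mul h1)
  refine ⟨P, hP, i, Finset.mem_range.1 hi, ?_⟩
  by_contra h3
  exact h2 (by rw [if_neg h3, mul_zero])

theorem exists_of_lowerOp_apply_ne {w : PatternSpace n t} {r : ℕ} {R : IntPattern n t}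
    (h : lowerOp n s t r w R ≠ 0) :
    ∃ P ∈ w.support, ∃ i, i < r ∧ P.1 - unitArray r i = R.1 := by
  rw [lowerOp_apply] at h
  obtain ⟨P, hP, h1⟩ := Finset.exists_ne_zero_of_sum_ne_zero h
  obtain ⟨i, hi, h2⟩ := Finset.exists_ne_zero_of_sum_ne_zero (right_ne_zero_of_mul h1)
  refine ⟨P, hP, i, Finset.mem_range.1 hi, ?_⟩
  by_contra h3
  exact h2 (by rw [if_neg h3, mul_zero])

/-- Maximality below row m copies the first m - 1 entries of row m into row m - 1, where the two
arrays agree. So their rows m can differ only in the last entry, which rules out different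
positions. -/
theorem IsMaxBelow.eq_of_add_eq_add {m i i' : ℕ} (hx : IsMaxBelow m x) (hy : IsMaxBelow m y)
    (hi : i < m) (hi' : i' < m) (h : y + unitArray m i' = x + unitArray m i) : i' = i := by
  by_contra hne
  have hval : ∀ k j, y k j + unitArray m i' k j = x k j + unitArray m i k j := fun k j =>
    congrFun (congrFun h k) j
  have key : ∀ j, j < m - 1 → y m j = x m j := by
    intro j hj
    have h1 := hval (m - 1) j
    have e1 := hx (m - 1) j hj (by omega)
    have e2 := hy (m - 1) j hj (by omega)
    rw [show m - 1 + 1 = m by omega] at e1 e2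
    simp only [unitArray] at h1
    rw [if_neg (by omega), if_neg (by omega)] at h1
    omega
  have h1 := hval m i
  have h2 := hval m i'
  simp only [unitArray, true_and, if_true, if_neg hne, if_neg (Ne.symm hne)] at h1 h2
  have h3 := key i
  have h4 := key i'
  omega

/-- Induction on m. If a pattern in the support had an entry of row m below its bound, it could be
raised there. By the induction hypothesis and `eq_of_add_eq_add` the result arises from no other
pattern of the support, so its coefficient cannot cancel. -/
theorem isMaxBelow_of_raiseOp_eq_zero (hg : IsGenericTop n s t) {w : PatternSpace n t} {m : ℕ}
    (hm : m ≤ n) (hw : ∀ r, 1 ≤ r → r < m → raiseOp n s t r w = 0) :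
    ∀ P ∈ w.support, IsMaxBelow m P.1 := by
  classical
  induction m with
  | zero => intro P _ k i _ hk; omega
  | succ m ih =>
    have IH := ih (by omega) fun r h1 h2 => hw r h1 (by omega)
    intro Q hQ k i hi hk
    by_cases hkm : k < m
    · exact IH Q hQ k i hi hkm
    obtain rfl : k = m := by omega
    by_contra hne
    have hQm := IH Q hQ
    have hup := Q.2.upper k i hi (by omega)
    have hpat : IsIntPattern n t (Q.1 + unitArray k i) := by
      refine Q.2.add_unitArray hi (by omega) (by omega) fun j hj => ?_
      subst hj
      have h1 := hQm (k - 1) j (by omega) (by omega)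
      have h2 := Q.2.lower k j (by omega) (by omega)
      rw [show k - 1 + 1 = k by omega] at h1
      omega
    have h0 : raiseOp n s t k w ⟨_, hpat⟩ = 0 := by rw [hw k (by omega) (by omega)]; rfl
    -- The coefficient of the raised pattern has a single contribution, from `Q` at position `i`.
    rw [raiseOp_apply, Finsupp.sum, Finset.sum_eq_single_of_mem Q hQ,
      Finset.sum_eq_single_of_mem i (Finset.mem_range.2 hi), if_pos rfl, mul_one] at h0
    · rcases mul_eq_zero.1 h0 with h | h
      · exact Finsupp.mem_support_iff.1 hQ h
      · exact Q.2.patRaise_ne hg hi (by omega) hpat (by exact_mod_cast h)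
    · intro j hj hji
      rw [if_neg, mul_zero]
      intro h
      exact hji (hQm.eq_of_add_eq_add hQm hi (Finset.mem_range.1 hj) h)
    · intro P hP hPQ
      refine mul_eq_zero_of_right _ (Finset.sum_eq_zero fun j hj => ?_)
      rw [if_neg, mul_zero]
      intro h
      have hji := hQm.eq_of_add_eq_add (IH P hP) hi (Finset.mem_range.1 hj) h
      subst hji
      exact hPQ (Subtype.ext (add_right_cancel h))

/-- The span of the patterns whose rows `m, m + 1, …` are those of `x`. -/
noncomputable def blockSpace (n : ℕ) (t : ℕ → ℤ) (m : ℕ) (x : ℕ → ℕ → ℤ) :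
    Submodule ℂ (PatternSpace n t) :=
  Finsupp.supported ℂ ℂ {Q : IntPattern n t | AgreeFrom m Q.1 x}

theorem mem_blockSpace {m : ℕ} {w : PatternSpace n t} :
    w ∈ blockSpace n t m x ↔ ∀ P ∈ w.support, AgreeFrom m P.1 x := by
  rw [blockSpace, Finsupp.mem_supported]
  rfl

theorem patVec_mem_blockSpace {m : ℕ} (h : AgreeFrom m y x) : patVec n t y ∈ blockSpace n t m x := by
  classical
  rw [mem_blockSpace]
  intro P hP
  rw [Finsupp.mem_support_iff, patVec_apply] at hP
  have : y = P.1 := by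
    by_contra h'
    exact hP (if_neg h')
  rwa [← this]

theorem raiseOp_mem_blockSpace {m r : ℕ} (hr : r < m) {w : PatternSpace n t}
    (hw : w ∈ blockSpace n t m x) : raiseOp n s t r w ∈ blockSpace n t m x := by
  rw [mem_blockSpace] at hw ⊢
  intro R hR
  obtain ⟨P, hP, i, -, h⟩ := exists_of_raiseOp_apply_ne (Finsupp.mem_support_iff.1 hR)
  intro k j hk
  rw [← hw P hP k j hk, ← h]
  simp only [Pi.add_apply, unitArray]
  rw [if_neg (by omega), add_zero]

theorem lowerOp_mem_blockSpace {m r : ℕ} (hr : r < m) {w : PatternSpace n t}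
    (hw : w ∈ blockSpace n t m x) : lowerOp n s t r w ∈ blockSpace n t m x := by
  rw [mem_blockSpace] at hw ⊢
  intro R hR
  obtain ⟨P, hP, i, -, h⟩ := exists_of_lowerOp_apply_ne (Finsupp.mem_support_iff.1 hR)
  intro k j hk
  rw [← hw P hP k j hk, ← h]
  simp only [Pi.sub_apply, unitArray]
  rw [if_neg (by omega), sub_zero]

theorem eq_smul_patVec_of_support {w : PatternSpace n t}
    (h : ∀ P ∈ w.support, P.1 = y) : ∃ c : ℂ, w = c • patVec n t y := by
  classical
  by_cases hy : IsIntPattern n t y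
  · refine ⟨w ⟨y, hy⟩, ?_⟩
    ext P
    rw [Finsupp.smul_apply, patVec_apply]
    split_ifs with hP
    · subst hP; simp
    · simp only [smul_zero]
      by_contra h0
      exact hP (h P (Finsupp.mem_support_iff.2 h0)).symm
  · refine ⟨0, ?_⟩
    rw [zero_smul]
    ext P
    by_contra h0
    exact hy (h P (Finsupp.mem_support_iff.2 h0) ▸ P.2)

theorem eq_smul_of_raiseOp_eq_zero (hg : IsGenericTop n s t) (hx : IsIntPattern n t x)
    {w : PatternSpace n t} {m : ℕ} (hm : m ≤ n) (hwB : w ∈ blockSpace n t m x)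
    (hw : ∀ r, 1 ≤ r → r < m → raiseOp n s t r w = 0) :
    ∃ c : ℂ, w = c • patVec n t (maxBelow m x) := by
  refine eq_smul_patVec_of_support fun P hP => ?_
  refine IsMaxBelow.eq_of_agreeFrom P.2 (hx.maxBelow hg hm)
    (isMaxBelow_of_raiseOp_eq_zero hg hm hw P hP) (isMaxBelow_maxBelow m x) fun k i hk => ?_
  rw [mem_blockSpace.1 hwB P hP k i hk, agreeFrom_maxBelow m x k i hk]

theorem raiseOp_maxBelow (m r : ℕ) (hr : r < m) (hx : IsIntPattern n t x)
    (hg : IsGenericTop n s t) (hm : m ≤ n) :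
    raiseOp n s t r (patVec n t (maxBelow m x)) = 0 := by
  rw [raiseOp_patVec (hx.maxBelow hg hm)]
  refine Finset.sum_eq_zero fun i hi => ?_
  rw [patVec_of_not, smul_zero]
  intro h
  have h1 := h.upper r i (Finset.mem_range.1 hi) (by omega)
  have h2 := isMaxBelow_maxBelow m x r i (Finset.mem_range.1 hi) hr
  simp only [Pi.add_apply, unitArray, and_self, if_true] at h1
  rw [if_neg (by omega)] at h1
  omega

/-- The sum of the entries below the top row. -/
def entrySum (n : ℕ) (x : ℕ → ℕ → ℤ) : ℤ := ∑ k ∈ Finset.range n, ∑ i ∈ Finset.range k, x k i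

theorem entrySum_add {r i : ℕ} (hi : i < r) (hr : r < n) :
    entrySum n (x + unitArray r i) = entrySum n x + 1 := by
  simp only [entrySum, Pi.add_apply, Finset.sum_add_distrib, sum_unitArray]
  congr 1
  rw [Finset.sum_eq_single_of_mem r (Finset.mem_range.2 hr)]
  · simp [hi]
  · intro k _ hk
    simp [hk]

/-- Each raise increases the sum of the entries by 1. A vector of W whose smallest entry sum is as
large as possible is therefore killed by every admissible raise. -/
theorem exists_raiseOp_eq_zero [Finite (IntPattern n t)] {W : Submodule ℂ (PatternSpace n t)}
    (hW : W ≠ ⊥) {m : ℕ} (hm : m ≤ n)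
    (hst : ∀ r, 1 ≤ r → r < m → ∀ w ∈ W, raiseOp n s t r w ∈ W) :
    ∃ w ∈ W, w ≠ 0 ∧ ∀ r, 1 ≤ r → r < m → raiseOp n s t r w = 0 := by
  let T : Set (IntPattern n t) :=
    {Q | ∃ w ∈ W, Q ∈ w.support ∧ ∀ R ∈ w.support, entrySum n Q.1 ≤ entrySum n R.1}
  have hT : ∀ w ∈ W, w ≠ 0 → ∃ Q ∈ T, Q ∈ w.support ∧
      ∀ R ∈ w.support, entrySum n Q.1 ≤ entrySum n R.1 := by
    intro w hw hw0
    obtain ⟨Q, hQ, h⟩ := Finset.exists_min_image w.support (fun R => entrySum n R.1)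
      (Finsupp.support_nonempty_iff.2 hw0)
    exact ⟨Q, ⟨w, hw, hQ, h⟩, hQ, h⟩
  obtain ⟨w0, hw0, hne⟩ := Submodule.exists_mem_ne_zero_of_ne_bot hW
  obtain ⟨Q0, hQ0, -⟩ := hT w0 hw0 hne
  obtain ⟨Q, ⟨w, hw, hQ, hmin⟩, hmax⟩ :=
    Set.exists_max_image T (fun R => entrySum n R.1) (Set.toFinite T) ⟨Q0, hQ0⟩
  refine ⟨w, hw, fun h => by simp [h] at hQ, fun r h1 h2 => ?_⟩
  by_contra h0
  obtain ⟨R, hRT, hR, -⟩ := hT _ (hst r h1 h2 w hw) h0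
  obtain ⟨P, hP, i, hi, h⟩ := exists_of_raiseOp_apply_ne (Finsupp.mem_support_iff.1 hR)
  have e1 := hmin P hP
  have e2 := hmax R hRT
  have e3 := entrySum_add (n := n) (x := P.1) hi (by omega)
  rw [h] at e3
  omega

/-- Otherwise the orthogonal complement of W in the block is nonzero. It is stable under raising, by
adjointness, so it contains a vector killed by the raising operators, that is, a multiple of the
maximal pattern. But this pattern lies in W and has nonzero norm. The form need not be definite, so
W is not claimed to split off. -/
theorem blockSpace_le_of_lowerOp [Finite (IntPattern n t)] (hg : IsGenericTop n s t)
    (hx : IsIntPattern n t x) {m : ℕ} (hm : m ≤ n) {W : Submodule ℂ (PatternSpace n t)}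
    (hst : ∀ r, 1 ≤ r → r < m → ∀ w ∈ W, lowerOp n s t r w ∈ W)
    (hmax : patVec n t (maxBelow m x) ∈ W) : blockSpace n t m x ≤ W := by
  classical
  have := Fintype.ofFinite (IntPattern n t)
  by_contra hle
  obtain ⟨b, hb, hbW⟩ := SetLike.not_le_iff_exists.1 hle
  obtain ⟨f, hfb, hfW⟩ := Submodule.exists_le_ker_of_notMem hbW
  -- The vector of the block that represents `f` through the diagonal form; it shows that the
  -- complement is nonzero.
  let u : PatternSpace n t := Finsupp.equivFunOnFinite.symm fun Q =>
    if AgreeFrom m Q.1 x then conj (f (patVec n t Q.1) / patternNorm n s Q.1) else 0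
  have huB : u ∈ blockSpace n t m x := by
    rw [mem_blockSpace]
    intro P hP
    rw [Finsupp.mem_support_iff] at hP
    by_contra h
    exact hP (if_neg h)
  have hu : ∀ v ∈ blockSpace n t m x, patternForm n s t u v = f v := by
    intro v hv
    rw [mem_blockSpace] at hv
    conv_rhs => rw [← Finsupp.sum_single v]
    change Finsupp.linearCombination ℂ _ v = _
    rw [Finsupp.linearCombination_apply, Finsupp.sum, Finsupp.sum, map_sum]
    refine Finset.sum_congr rfl fun P hP => ?_
    have h1 : u P = conj (f (patVec n t P.1) / patternNorm n s P.1) := if_pos (hv P hP)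
    have h2 : (patternNorm n s P.1 : ℂ) ≠ 0 := by exact_mod_cast P.2.patternNorm_ne hg
    rw [h1, Complex.conj_conj, div_mul_cancel₀ _ h2, patVec_coe, ← map_smul, Finsupp.smul_single,
      smul_eq_mul, mul_one]
  let W' : Submodule ℂ (PatternSpace n t) :=
    blockSpace n t m x ⊓ ⨅ w : ↥(W ⊓ blockSpace n t m x), LinearMap.ker (patternForm n s t w.1)
  have hW' : ∀ v, v ∈ W' ↔ v ∈ blockSpace n t m x ∧
      ∀ w ∈ W, w ∈ blockSpace n t m x → patternForm n s t w v = 0 := by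
    intro v
    simp [W', Submodule.mem_iInf]
  have huW' : u ∈ W' := by
    rw [hW']
    refine ⟨huB, fun w hw hwB => ?_⟩
    rw [patternForm_hermitian, hu w hwB, LinearMap.mem_ker.1 (hfW hw), map_zero]
  have hne : W' ≠ ⊥ := by
    intro h
    rw [h, Submodule.mem_bot] at huW'
    apply hfb
    rw [← hu b hb, huW', map_zero, LinearMap.zero_apply]
  obtain ⟨w, hw, hw0, hkill⟩ := exists_raiseOp_eq_zero (s := s) hne hm (by
    intro r h1 h2 v hv
    rw [hW'] at hv ⊢
    refine ⟨raiseOp_mem_blockSpace h2 hv.1, fun w hw hwB => ?_⟩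
    rw [← patternForm_lowerOp hg (by omega)]
    exact hv.2 _ (hst r h1 h2 w hw) (lowerOp_mem_blockSpace h2 hwB))
  rw [hW'] at hw
  obtain ⟨c, rfl⟩ := eq_smul_of_raiseOp_eq_zero hg hx hm hw.1 hkill
  have hpat := hx.maxBelow hg hm
  have h1 := hw.2 _ hmax (patVec_mem_blockSpace (agreeFrom_maxBelow m x))
  rw [map_smul, patternForm_patVec hpat hpat, if_pos rfl, smul_eq_mul] at h1
  have h2 : (patternNorm n s (maxBelow m x) : ℂ) ≠ 0 := by exact_mod_cast hpat.patternNorm_ne hg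
  have h3 : c = 0 := (mul_eq_zero.1 h1).resolve_right h2
  exact hw0 (by rw [h3, zero_smul])

theorem patVec_maxBelow_mem [Finite (IntPattern n t)] (hg : IsGenericTop n s t)
    (hx : IsIntPattern n t x) {m : ℕ} (hm : m ≤ n) {W : Submodule ℂ (PatternSpace n t)}
    (hWB : W ≤ blockSpace n t m x) (hW : W ≠ ⊥)
    (hst : ∀ r, 1 ≤ r → r < m → ∀ w ∈ W, raiseOp n s t r w ∈ W) :
    patVec n t (maxBelow m x) ∈ W := by
  obtain ⟨w, hw, hw0, hkill⟩ := exists_raiseOp_eq_zero (s := s) hW hm hst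
  obtain ⟨c, rfl⟩ := eq_smul_of_raiseOp_eq_zero hg hx hm (hWB hw) hkill
  have hc : c ≠ 0 := by
    rintro rfl
    exact hw0 (zero_smul _ _)
  exact (Submodule.smul_mem_iff W hc).1 hw

/-- Irreducibility of blocks, stated for the operators alone: there is no action of U_q yet, and
`blockSpace_le_of_lowerOp` will serve to prove the Serre relations. -/
theorem eq_blockSpace [Finite (IntPattern n t)] (hg : IsGenericTop n s t)
    (hx : IsIntPattern n t x) {m : ℕ} (hm : m ≤ n) {W : Submodule ℂ (PatternSpace n t)}
    (hWB : W ≤ blockSpace n t m x) (hW : W ≠ ⊥)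
    (hr : ∀ r, 1 ≤ r → r < m → ∀ w ∈ W, raiseOp n s t r w ∈ W)
    (hl : ∀ r, 1 ≤ r → r < m → ∀ w ∈ W, lowerOp n s t r w ∈ W) :
    W = blockSpace n t m x :=
  le_antisymm hWB
    (blockSpace_le_of_lowerOp hg hx hm hl (patVec_maxBelow_mem hg hx hm hWB hW hr))

end

/-! ### Serre elements -/

section SerreAlgebra

variable {A : Type*} [Ring A] [Algebra ℂ A] {q q' d : ℂ} {a b f k k' : A}

/-- The q-Serre element of `a` and `b`. -/
def serreElt (c : ℂ) (a b : A) : A := a * a * b - c • (a * b * a) + b * a * a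

/-- Moving f, the partner of b, through leaves multiples of a a k and a a k', with coefficients
proportional to 1 - (q + q')q' + q'² and 1 - (q + q')q + q², both 0 since q q' = 1. -/
theorem serreElt_mul_comm_snd (hqq : q * q' = 1) (haf : a * f = f * a)
    (hbf : b * f - f * b = d • (k - k')) (hka : k * a = q' • (a * k)) (hka' : k' * a = q • (a * k')) :
    serreElt (q + q') a b * f = f * serreElt (q + q') a b := by
  have e0 : b * f = f * b + d • (k - k') := by rw [← hbf]; abel
  have e1 : a * a * b * f = f * (a * a * b) + d • (a * a * k - a * a * k') := by
    rw [mul_assoc _ b f, e0, mul_add, ← mul_assoc _ f b, mul_assoc a a f, haf, ← mul_assoc a f a,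
      haf, mul_smul_comm, mul_sub]
    simp only [mul_assoc]
  have e2 : a * b * a * f = f * (a * b * a) + d • (q' • (a * a * k) - q • (a * a * k')) := by
    rw [mul_assoc _ a f, haf, ← mul_assoc _ f a, mul_assoc a b f, e0, mul_add, add_mul,
      ← mul_assoc a f b, haf, mul_smul_comm, smul_mul_assoc, mul_sub, sub_mul, mul_assoc a k a, hka,
      mul_assoc a k' a, hka', mul_smul_comm, mul_smul_comm]
    simp only [mul_assoc]
  have e3 : b * a * a * f =
      f * (b * a * a) + d • ((q' * q') • (a * a * k) - (q * q) • (a * a * k')) := by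
    rw [mul_assoc _ a f, haf, ← mul_assoc _ f a, mul_assoc b a f, haf, ← mul_assoc b f a, e0,
      add_mul, add_mul, smul_mul_assoc, smul_mul_assoc, sub_mul, sub_mul, hka, hka',
      smul_mul_assoc, smul_mul_assoc, mul_assoc a k a, mul_assoc a k' a, hka, hka', mul_smul_comm,
      mul_smul_comm, smul_smul, smul_smul]
    simp only [mul_assoc]
  rw [serreElt, add_mul, sub_mul, smul_mul_assoc, e1, e2, e3, mul_add, mul_sub, mul_smul_comm]
  match_scalars <;> first | ring1 | linear_combination (-d) * hqq | linear_combination d * hqq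

/-- Now f is the partner of a. The coefficients of a b k, a b k', b a k and b a k' vanish
separately, by q q' = 1. -/
theorem serreElt_mul_comm_fst (hqq : q * q' = 1) (haf : a * f - f * a = d • (k - k'))
    (hbf : b * f = f * b) (hka : k * a = (q * q) • (a * k)) (hka' : k' * a = (q' * q') • (a * k'))
    (hkb : k * b = q' • (b * k)) (hkb' : k' * b = q • (b * k')) :
    serreElt (q + q') a b * f = f * serreElt (q + q') a b := by
  have e0 : a * f = f * a + d • (k - k') := by rw [← haf]; abel
  have hab : (k - k') * a * b = (q * q * q') • (a * b * k) - (q' * q' * q) • (a * b * k') := by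
    rw [sub_mul, sub_mul, hka, hka', smul_mul_assoc, smul_mul_assoc, mul_assoc a k, mul_assoc a k',
      hkb, hkb', mul_smul_comm, mul_smul_comm, smul_smul, smul_smul, mul_assoc a b k,
      mul_assoc a b k']
  have hagb : a * (k - k') * b = q' • (a * b * k) - q • (a * b * k') := by
    rw [mul_sub, sub_mul, mul_assoc a k, mul_assoc a k', hkb, hkb', mul_smul_comm, mul_smul_comm,
      mul_assoc a b k, mul_assoc a b k']
  have hba : (k - k') * b * a = (q * q * q') • (b * a * k) - (q' * q' * q) • (b * a * k') := by
    rw [sub_mul, sub_mul, hkb, hkb', smul_mul_assoc, smul_mul_assoc, mul_assoc b k, mul_assoc b k',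
      hka, hka', mul_smul_comm, mul_smul_comm, smul_smul, smul_smul, mul_assoc b a k,
      mul_assoc b a k', mul_comm q', mul_comm q (q' * q')]
  have hbga : b * (k - k') * a = (q * q) • (b * a * k) - (q' * q') • (b * a * k') := by
    rw [mul_sub, sub_mul, mul_assoc b k, mul_assoc b k', hka, hka', mul_smul_comm, mul_smul_comm,
      mul_assoc b a k, mul_assoc b a k']
  have e1 : a * a * b * f = f * (a * a * b) + d • ((k - k') * a * b) + d • (a * (k - k') * b) := by
    rw [mul_assoc _ b f, hbf, ← mul_assoc, mul_assoc a a f, e0, mul_add, ← mul_assoc a f, e0,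
      mul_smul_comm, add_mul, add_mul, add_mul, smul_mul_assoc, smul_mul_assoc, smul_mul_assoc]
    simp only [mul_assoc]
  have e2 : a * b * a * f = f * (a * b * a) + d • ((k - k') * b * a) +
      d • (a * b * k - a * b * k') := by
    rw [mul_assoc _ a f, e0, mul_add, ← mul_assoc _ f a, mul_assoc a b f, hbf, ← mul_assoc a f b,
      e0, add_mul, add_mul, mul_smul_comm, smul_mul_assoc, smul_mul_assoc, mul_sub]
    simp only [mul_assoc]
  have e3 : b * a * a * f = f * (b * a * a) + d • (b * (k - k') * a) +
      d • (b * a * k - b * a * k') := by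
    rw [mul_assoc _ a f, e0, mul_add, ← mul_assoc _ f a, mul_assoc b a f, e0, mul_add,
      ← mul_assoc b f a, hbf, add_mul, mul_smul_comm, smul_mul_assoc, mul_smul_comm, mul_sub]
    simp only [mul_assoc, mul_sub]
  rw [serreElt, add_mul, sub_mul, smul_mul_assoc, e1, e2, e3, hab, hagb, hba, hbga, mul_add,
    mul_sub, mul_smul_comm]
  have hq2 : q * q * q' = q := by linear_combination q * hqq
  have hq3 : q' * q' * q = q' := by linear_combination q' * hqq
  rw [hq2, hq3]
  match_scalars <;> first | ring1 | linear_combination (-d) * hqq | linear_combination d * hqq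

theorem commutator_mul_comm (haf : a * f - f * a = d • (k - k')) (hbf : b * f = f * b)
    (hkb : k * b = b * k) (hkb' : k' * b = b * k') :
    (a * b - b * a) * f = f * (a * b - b * a) := by
  have e0 : a * f = f * a + d • (k - k') := by rw [← haf]; abel
  rw [sub_mul, mul_assoc, hbf, ← mul_assoc, e0, mul_assoc b a f, e0, mul_add, add_mul,
    ← mul_assoc b f a, hbf, smul_mul_assoc, mul_smul_comm, sub_mul, mul_sub, hkb, hkb', mul_sub,
    mul_assoc f a b, mul_assoc f b a]
  abel

theorem commutator_mul_comm_symm (haf : a * f - f * a = d • (k - k')) (hbf : b * f = f * b)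
    (hkb : k * b = b * k) (hkb' : k' * b = b * k') :
    (b * a - a * b) * f = f * (b * a - a * b) := by
  rw [← neg_sub, neg_mul, commutator_mul_comm haf hbf hkb hkb', mul_neg]

theorem serreElt_mul_comm (c : ℂ) (haf : a * f = f * a) (hbf : b * f = f * b) :
    serreElt c a b * f = f * serreElt c a b := by
  have ha : Commute a f := haf
  have hb : Commute b f := hbf
  exact ((((ha.mul_left ha).mul_left hb).sub_left
    (((ha.mul_left hb).mul_left ha).smul_left c)).add_left ((hb.mul_left ha).mul_left ha))

end SerreAlgebra

/-! ### The action of the quantum group on the model -/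

section

variable {n : ℕ} {s : ℝ} {t : ℕ → ℤ} {x : ℕ → ℕ → ℤ}

/-- The operator by which `K_{r-1} K_r⁻¹` (`e = 1`) or its inverse (`e = -1`) acts. -/
noncomputable def rootOp (n : ℕ) (s : ℝ) (t : ℕ → ℤ) (e : ℝ) (p : ℕ) :
    PatternSpace n t →ₗ[ℂ] PatternSpace n t :=
  diagOp n t fun x => qPow s (e * (intWt x p - intWt x (p + 1) : ℤ))

theorem rootOp_eq (c e : ℝ) (p : ℕ) :
    rootOp n s t e p = weightOp n s t c e p ∘ₗ weightOp n s t c (-e) (p + 1) := by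
  rw [weightOp, weightOp, diagOp_comp, rootOp]
  congr 1
  funext x
  rw [← qPow_add]
  congr 1
  push_cast
  ring

theorem rootOp_raiseOp (e : ℝ) (p r : ℕ) :
    rootOp n s t e p ∘ₗ raiseOp n s t r =
      qPow s (e * (rootCoord r p - rootCoord r (p + 1) : ℤ)) •
        (raiseOp n s t r ∘ₗ rootOp n s t e p) := by
  rw [rootOp_eq 0 e p, LinearMap.comp_assoc, weightOp_raiseOp, LinearMap.comp_smul,
    ← LinearMap.comp_assoc, weightOp_raiseOp, LinearMap.smul_comp, smul_smul, ← qPow_add,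
    LinearMap.comp_assoc]
  congr 2
  push_cast
  ring

theorem raiseOp_lowerOp_sub (hg : IsGenericTop n s t) {p : ℕ} (hr : p + 1 < n) :
    raiseOp n s t (p + 1) * lowerOp n s t (p + 1) -
      lowerOp n s t (p + 1) * raiseOp n s t (p + 1) =
      (qPow s 1 - qPow s (-1))⁻¹ • (rootOp n s t 1 p - rootOp n s t (-1) p) := by
  refine (raiseOp_lowerOp_same hg hr).trans (patternSpace_ext fun x _ => ?_)
  rw [LinearMap.smul_apply, LinearMap.sub_apply, rootOp, rootOp, diagOp_patVec, diagOp_patVec,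
    diagOp_patVec, ← sub_smul, smul_smul, one_mul, neg_one_mul, qInt, qNum_eq, div_eq_inv_mul]

theorem blockSpace_top (hx : IsIntPattern n t x) (y : IntPattern n t) :
    AgreeFrom n y.1 x := by
  intro k i hk
  by_cases h : i < n ∧ k = n
  · obtain ⟨hi, rfl⟩ := h
    rw [hx.top i hi, y.2.top i hi]
  · rw [hx.outside k i (by omega), y.2.outside k i (by omega)]

theorem blockSpace_eq_top (hx : IsIntPattern n t x) : blockSpace n t n x = ⊤ := by
  rw [eq_top_iff]
  intro w _
  exact mem_blockSpace.2 fun P _ => blockSpace_top hx P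

/-- The kernel of S is stable under lowering and contains the maximal pattern, which generates
everything. -/
theorem eq_zero_of_comm_lowerOp [Finite (IntPattern n t)] (hg : IsGenericTop n s t)
    {S : Module.End ℂ (PatternSpace n t)}
    (hcomm : ∀ r, 1 ≤ r → r < n → S * lowerOp n s t r = lowerOp n s t r * S)
    (hmax : ∀ x, IsIntPattern n t x → S (patVec n t (maxBelow n x)) = 0) : S = 0 := by
  refine patternSpace_ext fun x hx => ?_
  have h := blockSpace_le_of_lowerOp (s := s) hg hx le_rfl (W := LinearMap.ker S) (by
    intro r h1 h2 w hw
    rw [LinearMap.mem_ker] at hw ⊢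
    have := LinearMap.congr_fun (hcomm r h1 h2) w
    rw [Module.End.mul_apply, Module.End.mul_apply, hw, map_zero] at this
    exact this) (hmax x hx)
  rw [blockSpace_eq_top hx] at h
  exact LinearMap.mem_ker.1 (h Submodule.mem_top)

theorem serreElt_raiseOp [Finite (IntPattern n t)] (hg : IsGenericTop n s t) {p p' : ℕ}
    (hp : p + 1 < n) (hp' : p' + 1 < n) (h : p + 1 = p' ∨ p' + 1 = p) :
    serreElt (qPow s 1 + qPow s (-1)) (raiseOp n s t (p + 1)) (raiseOp n s t (p' + 1)) = 0 := by
  have hqq := qPow_mul_neg s 1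
  have hrel : ∀ e p r z, (rootCoord r p - rootCoord r (p + 1)) = z →
      rootOp n s t e p * raiseOp n s t r = qPow s (e * z) • (raiseOp n s t r * rootOp n s t e p) := by
    rintro e p r z rfl
    exact rootOp_raiseOp e p r
  refine eq_zero_of_comm_lowerOp hg (fun r h1 h2 => ?_) fun x hx => ?_
  · obtain ⟨m, rfl⟩ : ∃ m, r = m + 1 := ⟨r - 1, by omega⟩
    by_cases hm : m = p
    · subst hm
      refine serreElt_mul_comm_fst hqq (raiseOp_lowerOp_sub hg hp)
        (raiseOp_lowerOp_of_ne (by omega) hp' hp) ?_ ?_ ?_ ?_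
      · rw [hrel 1 m (m + 1) 2 (by simp [rootCoord]), ← qPow_add]; norm_num
      · rw [hrel (-1) m (m + 1) 2 (by simp [rootCoord]), ← qPow_add]; norm_num
      · rw [hrel 1 m (p' + 1) (-1) (by simp only [rootCoord]; split_ifs <;> omega)]; norm_num
      · rw [hrel (-1) m (p' + 1) (-1) (by simp only [rootCoord]; split_ifs <;> omega)]; norm_num
    · by_cases hm' : m = p'
      · subst hm'
        refine serreElt_mul_comm_snd hqq (raiseOp_lowerOp_of_ne (by omega) hp hp')
          (raiseOp_lowerOp_sub hg hp') ?_ ?_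
        · rw [hrel 1 m (p + 1) (-1) (by simp only [rootCoord]; split_ifs <;> omega)]; norm_num
        · rw [hrel (-1) m (p + 1) (-1) (by simp only [rootCoord]; split_ifs <;> omega)]; norm_num
      · exact serreElt_mul_comm _ (raiseOp_lowerOp_of_ne (by omega) hp h2)
          (raiseOp_lowerOp_of_ne (by omega) hp' h2)
  · have e1 := raiseOp_maxBelow (s := s) n (p + 1) hp hx hg le_rfl
    have e2 := raiseOp_maxBelow (s := s) n (p' + 1) hp' hx hg le_rfl
    simp only [serreElt, LinearMap.add_apply, LinearMap.sub_apply, LinearMap.smul_apply,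
      Module.End.mul_apply, e1, e2, map_zero, smul_zero, sub_zero, add_zero]

theorem raiseOp_far [Finite (IntPattern n t)] (hg : IsGenericTop n s t) {p p' : ℕ}
    (hp' : p' + 1 < n) (h : p + 1 < p') :
    raiseOp n s t (p + 1) * raiseOp n s t (p' + 1) =
      raiseOp n s t (p' + 1) * raiseOp n s t (p + 1) := by
  have hrel : ∀ e p r, (rootCoord r p - rootCoord r (p + 1)) = 0 →
      rootOp n s t e p * raiseOp n s t r = raiseOp n s t r * rootOp n s t e p := by
    intro e p r hz
    have := rootOp_raiseOp (n := n) (s := s) (t := t) e p r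
    rw [hz, Int.cast_zero, mul_zero, qPow_zero, one_smul] at this
    exact this
  rw [← sub_eq_zero]
  refine eq_zero_of_comm_lowerOp hg (fun r h1 h2 => ?_) fun x hx => ?_
  · obtain ⟨m, rfl⟩ : ∃ m, r = m + 1 := ⟨r - 1, by omega⟩
    by_cases hm : m = p
    · subst hm
      have hz : rootCoord (p' + 1) m - rootCoord (p' + 1) (m + 1) = 0 := by
        simp only [rootCoord]; split_ifs <;> omega
      exact commutator_mul_comm (A := Module.End ℂ (PatternSpace n t)) (raiseOp_lowerOp_sub hg h2)
        (raiseOp_lowerOp_of_ne (by omega) hp' h2) (hrel 1 m (p' + 1) hz)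
        (hrel (-1) m (p' + 1) hz)
    · by_cases hm' : m = p'
      · subst hm'
        have hz : rootCoord (p + 1) m - rootCoord (p + 1) (m + 1) = 0 := by
          simp only [rootCoord]; split_ifs <;> omega
        exact commutator_mul_comm_symm (A := Module.End ℂ (PatternSpace n t)) (raiseOp_lowerOp_sub hg h2)
          (raiseOp_lowerOp_of_ne (r := p + 1) (by omega) (by omega) h2) (hrel 1 m (p + 1) hz)
          (hrel (-1) m (p + 1) hz)
      · have c1 : Commute (raiseOp n s t (p + 1)) (lowerOp n s t (m + 1)) :=
          raiseOp_lowerOp_of_ne (by omega) (by omega) h2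
        have c2 : Commute (raiseOp n s t (p' + 1)) (lowerOp n s t (m + 1)) :=
          raiseOp_lowerOp_of_ne (by omega) hp' h2
        exact Commute.sub_left (R := Module.End ℂ (PatternSpace n t)) (c1.mul_left c2)
          (c2.mul_left c1)
  · have e1 := raiseOp_maxBelow (s := s) n (p + 1) (by omega) hx hg le_rfl
    have e2 := raiseOp_maxBelow (s := s) n (p' + 1) hp' hx hg le_rfl
    simp only [LinearMap.sub_apply, Module.End.mul_apply, e1, e2, map_zero, sub_zero]

theorem eq_zero_of_patternForm (hg : IsGenericTop n s t) {w : PatternSpace n t}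
    (h : ∀ v, patternForm n s t v w = 0) : w = 0 := by
  ext P
  have h1 := h (Finsupp.single P 1)
  rw [patternForm_hermitian, patternForm_single, map_mul, Complex.conj_conj,
    Complex.conj_ofReal] at h1
  have h2 : (patternNorm n s P.1 : ℂ) ≠ 0 := by exact_mod_cast P.2.patternNorm_ne hg
  exact (mul_eq_zero.1 h1).resolve_right h2

/-- The Serre element is symmetric under reversing words and its coefficient q + q⁻¹ is real, so it
is adjoint to the one in the raising operators, which is 0; the form is nondegenerate. -/
theorem serreElt_lowerOp [Finite (IntPattern n t)] (hg : IsGenericTop n s t) {p p' : ℕ}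
    (hp : p + 1 < n) (hp' : p' + 1 < n) (h : p + 1 = p' ∨ p' + 1 = p) :
    serreElt (qPow s 1 + qPow s (-1)) (lowerOp n s t (p + 1)) (lowerOp n s t (p' + 1)) = 0 := by
  refine LinearMap.ext fun w => eq_zero_of_patternForm hg fun v => ?_
  have hS := LinearMap.congr_fun (serreElt_raiseOp hg hp hp' h) v
  have hc : conj (qPow s 1 + qPow s (-1)) = qPow s 1 + qPow s (-1) := by
    rw [map_add, conj_qPow, conj_qPow, neg_neg, add_comm]
  have : patternForm n s t v (serreElt (qPow s 1 + qPow s (-1)) (lowerOp n s t (p + 1))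
      (lowerOp n s t (p' + 1)) w) = patternForm n s t (serreElt (qPow s 1 + qPow s (-1))
        (raiseOp n s t (p + 1)) (raiseOp n s t (p' + 1)) v) w := by
    simp only [serreElt, LinearMap.add_apply, LinearMap.sub_apply, LinearMap.smul_apply,
      Module.End.mul_apply, map_add, map_sub, map_smul, LinearMap.map_smulₛₗ, hc,
      patternForm_raiseOp hg hp, patternForm_raiseOp hg hp']
    ring
  rw [this, hS, LinearMap.zero_apply, map_zero, LinearMap.zero_apply]

theorem lowerOp_far [Finite (IntPattern n t)] (hg : IsGenericTop n s t) {p p' : ℕ}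
    (hp' : p' + 1 < n) (h : p + 1 < p') :
    lowerOp n s t (p + 1) * lowerOp n s t (p' + 1) =
      lowerOp n s t (p' + 1) * lowerOp n s t (p + 1) := by
  have hp : p + 1 < n := by omega
  refine LinearMap.ext fun w => ?_
  rw [← sub_eq_zero]
  refine eq_zero_of_patternForm hg fun v => ?_
  have hS := LinearMap.congr_fun (raiseOp_far hg hp' h) v
  simp only [Module.End.mul_apply] at hS ⊢
  rw [map_sub, ← patternForm_raiseOp hg hp, ← patternForm_raiseOp hg hp',
    ← patternForm_raiseOp hg hp', ← patternForm_raiseOp hg hp, hS, sub_self]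

/-- The operators by which the generators act on the model. -/
noncomputable def genOp (n : ℕ) (s : ℝ) (t : ℕ → ℤ) (c : ℝ) :
    UqGen n → Module.End ℂ (PatternSpace n t)
  | UqGen.E i => raiseOp n s t (i + 1)
  | UqGen.F i => lowerOp n s t (i + 1)
  | UqGen.K j => weightOp n s t c 1 j
  | UqGen.Kinv j => weightOp n s t c (-1) j

theorem weightOp_mul (c e e' : ℝ) (j l : ℕ) :
    weightOp n s t c e j * weightOp n s t c e' l = weightOp n s t c e' l * weightOp n s t c e j := by
  change weightOp n s t c e j ∘ₗ weightOp n s t c e' l = weightOp n s t c e' l ∘ₗ weightOp n s t c e j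
  rw [weightOp, weightOp, diagOp_comp, diagOp_comp]
  congr 1
  funext x
  exact mul_comm _ _

theorem weightOp_mul_inv (c e e' : ℝ) (j : ℕ) (h : e + e' = 0) :
    weightOp n s t c e j * weightOp n s t c e' j = 1 := by
  change weightOp n s t c e j ∘ₗ weightOp n s t c e' j = 1
  rw [weightOp, weightOp, diagOp_comp]
  refine Eq.trans ?_ diagOp_one
  congr 1
  funext x
  rw [← qPow_add, ← add_mul, h, zero_mul, qPow_zero]

theorem simpleRoot_eq_rootCoord (i : Fin (n - 1)) (j : Fin n) :
    simpleRoot i j = (rootCoord (i + 1) j : ℝ) := by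
  simp only [simpleRoot, Pi.sub_apply, Pi.single_apply, Fin.ext_iff, lowPos, highPos, rootCoord,
    Nat.add_right_cancel_iff]
  push_cast
  rfl

/-- The representation of the quantum group on the model. -/
noncomputable def patternRep [Finite (IntPattern n t)] (hg : IsGenericTop n s t) (c : ℝ) :
    Uq n s →ₐ[ℂ] Module.End ℂ (PatternSpace n t) :=
  RingQuot.liftAlgHom ℂ ⟨FreeAlgebra.lift ℂ (genOp n s t c), by
    intro a b h
    have key : ∀ g, FreeAlgebra.lift ℂ (genOp n s t c) (FreeAlgebra.ι ℂ g) = genOp n s t c g :=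
      fun g => FreeAlgebra.lift_ι_apply _ _
    cases h with
    | k_kinv j =>
      simp only [UqGen.k, UqGen.kinv, map_mul, key, map_one, genOp]
      exact weightOp_mul_inv c _ _ _ (by norm_num)
    | kinv_k j =>
      simp only [UqGen.k, UqGen.kinv, map_mul, key, map_one, genOp]
      exact weightOp_mul_inv c _ _ _ (by norm_num)
    | k_comm j l =>
      simp only [UqGen.k, map_mul, key, genOp]
      exact weightOp_mul c _ _ _ _
    | k_e j i =>
      simp only [UqGen.k, UqGen.e, map_mul, map_smul, key, genOp]
      have := weightOp_raiseOp (n := n) (s := s) (t := t) c 1 (i + 1) j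
      rw [one_mul, ← simpleRoot_eq_rootCoord] at this
      exact this
    | k_f j i =>
      simp only [UqGen.k, UqGen.f, map_mul, map_smul, key, genOp]
      have := weightOp_lowerOp (n := n) (s := s) (t := t) c 1 (i + 1) j
      rw [one_mul, ← simpleRoot_eq_rootCoord] at this
      exact this
    | e_f_same i =>
      simp only [UqGen.e, UqGen.f, UqGen.k, UqGen.kinv, map_mul, map_sub, map_smul, key, genOp]
      rw [raiseOp_lowerOp_sub hg (by omega), rootOp_eq c, rootOp_eq c, neg_neg]
      rfl
    | e_f_ne i j hij =>
      simp only [UqGen.e, UqGen.f, map_mul, key, genOp]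
      exact raiseOp_lowerOp_of_ne (fun h => hij (Fin.ext (by omega))) (by omega) (by omega)
    | e_far i j hij =>
      simp only [UqGen.e, map_mul, key, genOp]
      exact raiseOp_far hg (by omega) hij
    | f_far i j hij =>
      simp only [UqGen.f, map_mul, key, genOp]
      exact lowerOp_far hg (by omega) hij
    | e_serre i j hij =>
      simp only [UqGen.e, map_mul, map_sub, map_add, map_smul, key, genOp, map_zero]
      exact serreElt_raiseOp hg (by omega) (by omega) hij
    | f_serre i j hij =>
      simp only [UqGen.f, map_mul, map_sub, map_add, map_smul, key, genOp, map_zero]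
      exact serreElt_lowerOp hg (by omega) (by omega) hij⟩

theorem patternRep_gen [Finite (IntPattern n t)] (hg : IsGenericTop n s t) (c : ℝ) (g : UqGen n) :
    patternRep hg c (Uq.gen s g) = genOp n s t c g := by
  rw [Uq.gen, Uq.mk]
  unfold patternRep
  erw [RingQuot.liftAlgHom_mkAlgHom_apply]
  exact FreeAlgebra.lift_ι_apply _ _

end

/-! ### Highest weight vectors -/

section

variable {n : ℕ} {s : ℝ} {V : Type*} [AddCommGroup V] [Module ℂ V] [Module (Uq n s) V]

namespace Uq

theorem mk_rel {a b : FreeAlgebra ℂ (UqGen n)} (h : UqRel n s a b) : mk n s a = mk n s b :=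
  RingQuot.mkAlgHom_rel ℂ h

theorem mk_surjective : Function.Surjective (mk n s) := RingQuot.mkAlgHom_surjective ℂ _

theorem Kinv_mul_K (j : Fin n) : Kinv s j * K s j = 1 := by
  have := mk_rel (s := s) (UqRel.kinv_k j)
  rwa [map_mul, map_one] at this

theorem K_mul_F (j : Fin n) (i : Fin (n - 1)) :
    K s j * F s i = qPow s (-simpleRoot i j) • (F s i * K s j) := by
  have := mk_rel (s := s) (UqRel.k_f j i)
  rwa [map_mul, map_smul, map_mul] at this

theorem E_mul_F_same (i : Fin (n - 1)) :
    E s i * F s i - F s i * E s i = (qPow s 1 - qPow s (-1))⁻¹ •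
      (K s (lowPos i) * Kinv s (highPos i) - Kinv s (lowPos i) * K s (highPos i)) := by
  have := mk_rel (s := s) (UqRel.e_f_same i)
  rwa [map_sub, map_mul, map_mul, map_smul, map_sub, map_mul, map_mul] at this

theorem E_mul_F_ne {i j : Fin (n - 1)} (h : i ≠ j) : E s i * F s j = F s j * E s i := by
  have := mk_rel (s := s) (UqRel.e_f_ne i j h)
  rwa [map_mul, map_mul] at this

theorem smul_mem_of_gen [IsScalarTower ℂ (Uq n s) V] {W : Submodule ℂ V}
    (h : ∀ g : UqGen n, ∀ x ∈ W, gen s g • x ∈ W) (a : Uq n s) {x : V} (hx : x ∈ W) : a • x ∈ W := by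
  obtain ⟨a, rfl⟩ := mk_surjective a
  induction a using FreeAlgebra.induction generalizing x with
  | grade0 r =>
    rw [AlgHom.commutes, algebraMap_smul]
    exact W.smul_mem r hx
  | grade1 g => exact h g x hx
  | mul a b ha hb =>
    rw [map_mul, mul_smul]
    exact ha (hb hx)
  | add a b ha hb =>
    rw [map_add, add_smul]
    exact W.add_mem (ha hx) (hb hx)

theorem sub_smul_mem [IsScalarTower ℂ (Uq n s) V] {m : ℕ} {W : Submodule ℂ V}
    (hE : ∀ i : Fin (n - 1), (i : ℕ) + 1 < m → ∀ x ∈ W, E s i • x ∈ W)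
    (hF : ∀ i : Fin (n - 1), (i : ℕ) + 1 < m → ∀ x ∈ W, F s i • x ∈ W)
    (hK : ∀ j : Fin n, (j : ℕ) < m → ∀ x ∈ W, K s j • x ∈ W)
    (hKinv : ∀ j : Fin n, (j : ℕ) < m → ∀ x ∈ W, Kinv s j • x ∈ W)
    (a : sub n s m) {x : V} (hx : x ∈ W) : a • x ∈ W := by
  obtain ⟨a, ha⟩ := a
  change a • x ∈ W
  rw [sub] at ha
  induction ha using Algebra.adjoin_induction generalizing x with
  | mem a h =>
    rcases h with ⟨i, hi, rfl | rfl⟩ | ⟨j, hj, rfl | rfl⟩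
    · exact hE i hi x hx
    · exact hF i hi x hx
    · exact hK j hj x hx
    · exact hKinv j hj x hx
  | algebraMap r =>
    rw [algebraMap_smul]
    exact W.smul_mem r hx
  | add a b _ _ ha hb =>
    rw [add_smul]
    exact W.add_mem (ha hx) (hb hx)
  | mul a b _ _ ha hb =>
    rw [mul_smul]
    exact ha (hb hx)

end Uq

/-- The span of the vectors `f_{i_1} ⋯ f_{i_r} v`. -/
def lowerSpan (s : ℝ) (v : V) [Module (Uq n s) V] : Submodule ℂ V :=
  Submodule.span ℂ {x | ∃ l : List (Fin (n - 1)), x = (l.map (Uq.F s)).prod • v}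

theorem F_smul_lowerSpan [IsScalarTower ℂ (Uq n s) V] (v : V) (i : Fin (n - 1)) {x : V}
    (hx : x ∈ lowerSpan (n := n) s v) : Uq.F s i • x ∈ lowerSpan (n := n) s v := by
  induction hx using Submodule.span_induction with
  | mem x h =>
    obtain ⟨l, rfl⟩ := h
    exact Submodule.subset_span ⟨i :: l, by rw [List.map_cons, List.prod_cons, mul_smul]⟩
  | zero => rw [smul_zero]; exact zero_mem _
  | add x y _ _ hx hy => rw [smul_add]; exact add_mem hx hy
  | smul r x _ hx => rw [smul_comm]; exact Submodule.smul_mem _ r hx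

theorem IsIrreducibleHighestWeight.exists_smul_eq {lam : Fin n → ℝ} {v : V}
    (h : IsIrreducibleHighestWeight s lam V v) {x : V} (hx : x ≠ 0) (y : V) :
    ∃ a : Uq n s, a • x = y := by
  have := h.simple
  exact IsSimpleModule.toSpanSingleton_surjective (Uq n s) hx y

namespace IsStandardForm

variable {v : V} {B : V →ₗ⋆[ℂ] V →ₗ[ℂ] ℂ}

theorem adjoint_f (h : IsStandardForm n s v B) (i : Fin (n - 1)) (x y : V) :
    B (Uq.F s i • x) y = B x (Uq.E s i • y) := by
  rw [h.hermitian, ← h.adjoint_e, ← h.hermitian]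

theorem self_ne (h : IsStandardForm n s v B) : B v v ≠ 0 := by
  intro h0
  have := h.pos
  rw [h0] at this
  simp at this

theorem self_eq (h : IsStandardForm n s v B) : B v v = ((B v v).re : ℂ) :=
  (Complex.conj_eq_iff_real.1 (h.hermitian v v).symm).elim fun r hr => by rw [hr, Complex.ofReal_re]

end IsStandardForm

variable [IsScalarTower ℂ (Uq n s) V] {v : V} {mu : Fin n → ℝ}

theorem Kinv_smul {j : Fin n} {x : V} {a : ℝ} (h : Uq.K s j • x = qPow s a • x) :
    Uq.Kinv s j • x = qPow s (-a) • x := by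
  have h1 : Uq.Kinv s j • Uq.K s j • x = x := by rw [← mul_smul, Uq.Kinv_mul_K, one_smul]
  rw [h, smul_comm] at h1
  conv_rhs => rw [← h1]
  rw [smul_smul, mul_comm, qPow_mul_neg, one_smul]

theorem K_smul_lower (hK : ∀ j, Uq.K s j • v = qPow s (mu j) • v) (l : List (Fin (n - 1)))
    (j : Fin n) : Uq.K s j • (l.map (Uq.F s)).prod • v =
      qPow s ((mu - (l.map simpleRoot).sum) j) • (l.map (Uq.F s)).prod • v := by
  induction l with
  | nil => simpa using hK j
  | cons i l ih =>
    rw [List.map_cons, List.prod_cons, mul_smul, ← mul_smul (Uq.K s j), Uq.K_mul_F, smul_assoc,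
      mul_smul, ih, smul_comm (Uq.F s i), smul_smul, ← qPow_add, List.map_cons, List.sum_cons]
    congr 2
    simp only [Pi.sub_apply, Pi.add_apply]
    ring

theorem E_smul_lower (hE : ∀ i : Fin (n - 1), Uq.E s i • v = 0)
    (hK : ∀ j, Uq.K s j • v = qPow s (mu j) • v) (i : Fin (n - 1)) (l : List (Fin (n - 1))) :
    Uq.E s i • (l.map (Uq.F s)).prod • v ∈ lowerSpan (n := n) s v := by
  induction l with
  | nil =>
    rw [List.map_nil, List.prod_nil, one_smul, hE]
    exact zero_mem _
  | cons j l ih =>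
    rw [List.map_cons, List.prod_cons, mul_smul, ← mul_smul (Uq.E s i)]
    by_cases h : i = j
    · subst h
      have h1 := Uq.E_mul_F_same (s := s) i
      rw [sub_eq_iff_eq_add] at h1
      rw [h1, add_smul, smul_assoc, sub_smul, mul_smul, mul_smul, mul_smul,
        Kinv_smul (K_smul_lower hK l _), K_smul_lower hK, smul_comm (Uq.K s (lowPos i)),
        smul_comm (Uq.Kinv s (lowPos i)), K_smul_lower hK, Kinv_smul (K_smul_lower hK l _)]
      have hl : (l.map (Uq.F s)).prod • v ∈ lowerSpan (n := n) s v :=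
        Submodule.subset_span ⟨l, rfl⟩
      exact add_mem (Submodule.smul_mem _ _ (sub_mem
        (Submodule.smul_mem _ _ (Submodule.smul_mem _ _ hl))
        (Submodule.smul_mem _ _ (Submodule.smul_mem _ _ hl)))) (F_smul_lowerSpan v i ih)
    · rw [Uq.E_mul_F_ne h, mul_smul]
      exact F_smul_lowerSpan v j ih

/-- Irreducibility is deliberately not assumed: `form_smul_eq` applies this to a pair of highest
weight vectors in a product of two modules. -/
theorem smul_mem_lowerSpan (hE : ∀ i : Fin (n - 1), Uq.E s i • v = 0)
    (hK : ∀ j, Uq.K s j • v = qPow s (mu j) • v) (a : Uq n s) :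
    a • v ∈ lowerSpan (n := n) s v := by
  have hv : v ∈ lowerSpan (n := n) s v :=
    Submodule.subset_span ⟨[], by rw [List.map_nil, List.prod_nil, one_smul]⟩
  refine Uq.smul_mem_of_gen (fun g x hx => ?_) a hv
  cases g with
  | F i => exact F_smul_lowerSpan v i hx
  | E i =>
    change Uq.E s i • x ∈ _
    induction hx using Submodule.span_induction with
    | mem x h =>
      obtain ⟨l, rfl⟩ := h
      exact E_smul_lower hE hK i l
    | zero => rw [smul_zero]; exact zero_mem _
    | add x y _ _ hx hy => rw [smul_add]; exact add_mem hx hy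
    | smul r x _ hx => rw [smul_comm]; exact Submodule.smul_mem _ r hx
  | K j =>
    change Uq.K s j • x ∈ _
    induction hx using Submodule.span_induction with
    | mem x h =>
      obtain ⟨l, rfl⟩ := h
      rw [K_smul_lower hK]
      exact Submodule.smul_mem _ _ (Submodule.subset_span ⟨l, rfl⟩)
    | zero => rw [smul_zero]; exact zero_mem _
    | add x y _ _ hx hy => rw [smul_add]; exact add_mem hx hy
    | smul r x _ hx => rw [smul_comm]; exact Submodule.smul_mem _ r hx
  | Kinv j =>
    change Uq.Kinv s j • x ∈ _
    induction hx using Submodule.span_induction with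
    | mem x h =>
      obtain ⟨l, rfl⟩ := h
      rw [Kinv_smul (K_smul_lower hK l j)]
      exact Submodule.smul_mem _ _ (Submodule.subset_span ⟨l, rfl⟩)
    | zero => rw [smul_zero]; exact zero_mem _
    | add x y _ _ hx hy => rw [smul_add]; exact add_mem hx hy
    | smul r x _ hx => rw [smul_comm]; exact Submodule.smul_mem _ r hx

namespace IsIrreducibleHighestWeight

variable {lam : Fin n → ℝ}

theorem lowerSpan_eq_top (h : IsIrreducibleHighestWeight s lam V v) :
    lowerSpan (n := n) s v = ⊤ := by
  rw [eq_top_iff]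
  intro x _
  obtain ⟨a, rfl⟩ := h.exists_smul_eq h.ne_zero x
  exact smul_mem_lowerSpan h.e_smul h.k_smul a

theorem iSup_weightSpace (h : IsIrreducibleHighestWeight s lam V v) :
    ⨆ mu, weightSpace s lam v mu = ⊤ := by
  rw [eq_top_iff, ← h.lowerSpan_eq_top, lowerSpan, Submodule.span_le]
  rintro x ⟨l, rfl⟩
  exact Submodule.mem_iSup_of_mem (lam - (l.map simpleRoot).sum)
    (Submodule.subset_span ⟨l, rfl, rfl⟩)

end IsIrreducibleHighestWeight

/-! ### Uniqueness of the module together with its form. -/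

variable {lam : Fin n → ℝ} {V' : Type*} [AddCommGroup V'] [Module ℂ V'] [Module (Uq n s) V']
  [IsScalarTower ℂ (Uq n s) V'] {v' : V'} {B : V →ₗ⋆[ℂ] V →ₗ[ℂ] ℂ} {B' : V' →ₗ⋆[ℂ] V' →ₗ[ℂ] ℂ}

/-- The matrix coefficients of the highest weight vectors agree. -/
theorem form_smul_eq (h : IsIrreducibleHighestWeight s lam V v)
    (h' : IsIrreducibleHighestWeight s lam V' v') (hB : IsStandardForm n s v B)
    (hB' : IsStandardForm n s v' B') (a : Uq n s) :
    B v (a • v) * B' v' v' = B' v' (a • v') * B v v := by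
  -- In the product module a • (v', v) is a combination of words in the f_i applied to (v', v). The
  -- functional `C` kills (v', v), and on a nonempty word adjointness moves an e_i onto the highest
  -- weight vectors.
  have hmem := smul_mem_lowerSpan (s := s) (n := n) (v := (v', v)) (mu := lam)
    (fun i => by rw [Prod.smul_mk, h.e_smul, h'.e_smul]; rfl)
    (fun j => by rw [Prod.smul_mk, h.k_smul, h'.k_smul, Prod.smul_mk]) a
  let C : V' × V →ₗ[ℂ] ℂ := (B' v' v') • (B v ∘ₗ LinearMap.snd ℂ V' V) -
    (B v v) • (B' v' ∘ₗ LinearMap.fst ℂ V' V)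
  have hC : lowerSpan (n := n) s (v', v) ≤ LinearMap.ker C := by
    refine Submodule.span_le.2 ?_
    rintro x ⟨l, rfl⟩
    rw [SetLike.mem_coe, LinearMap.mem_ker]
    simp only [C, LinearMap.sub_apply, LinearMap.smul_apply, LinearMap.comp_apply,
      LinearMap.snd_apply, LinearMap.fst_apply, Prod.smul_mk, smul_eq_mul]
    cases l with
    | nil => simp [mul_comm]
    | cons i l =>
      rw [List.map_cons, List.prod_cons, mul_smul, mul_smul, ← hB.adjoint_e, ← hB'.adjoint_e,
        h.e_smul, h'.e_smul, map_zero, map_zero, LinearMap.zero_apply, LinearMap.zero_apply]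
      simp
  have := LinearMap.mem_ker.1 (hC hmem)
  simp only [C, LinearMap.sub_apply, LinearMap.smul_apply, LinearMap.comp_apply,
      LinearMap.snd_apply, LinearMap.fst_apply, Prod.smul_mk, smul_eq_mul] at this
  linear_combination this

/-- If a v ≠ 0, irreducibility gives b with b a v = v, and then b a has a nonzero matrix coefficient
on V but a zero one on V'. -/
theorem smul_eq_zero_of_form (h : IsIrreducibleHighestWeight s lam V v)
    (h' : IsIrreducibleHighestWeight s lam V' v') (hB : IsStandardForm n s v B)
    (hB' : IsStandardForm n s v' B') {a : Uq n s} (ha : a • v' = 0) : a • v = 0 := by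
  by_contra hne
  obtain ⟨b, hb⟩ := h.exists_smul_eq hne v
  have := form_smul_eq h h' hB hB' (b * a)
  rw [mul_smul, mul_smul, ha, smul_zero, hb, map_zero, zero_mul] at this
  exact mul_ne_zero hB.self_ne hB'.self_ne this

/-- Both modules are quotients of U_q by the annihilator of the highest weight vector, and the two
annihilators coincide. The forms are compared on words in the f_i, whose letters move across as e_i.
-/
theorem exists_isometry (h : IsIrreducibleHighestWeight s lam V v)
    (h' : IsIrreducibleHighestWeight s lam V' v') (hB : IsStandardForm n s v B)
    (hB' : IsStandardForm n s v' B') :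
    ∃ f : V' ≃ₗ[Uq n s] V, f v' = v ∧ ∀ x y, B (f x) (f y) * B' v' v' = B' x y * B v v := by
  have hker : LinearMap.ker (LinearMap.toSpanSingleton (Uq n s) V' v') =
      LinearMap.ker (LinearMap.toSpanSingleton (Uq n s) V v) := by
    ext a
    rw [LinearMap.mem_ker, LinearMap.mem_ker, LinearMap.toSpanSingleton_apply,
      LinearMap.toSpanSingleton_apply]
    exact ⟨smul_eq_zero_of_form h h' hB hB', smul_eq_zero_of_form h' h hB' hB⟩
  let e' := LinearMap.quotKerEquivOfSurjective (LinearMap.toSpanSingleton (Uq n s) V' v')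
    fun y => h'.exists_smul_eq h'.ne_zero y
  let e := LinearMap.quotKerEquivOfSurjective (LinearMap.toSpanSingleton (Uq n s) V v)
    fun y => h.exists_smul_eq h.ne_zero y
  let f : V' ≃ₗ[Uq n s] V := e'.symm ≪≫ₗ Submodule.quotEquivOfEq _ _ hker ≪≫ₗ e
  have hf : f v' = v := by
    have h1 : e' (Submodule.Quotient.mk 1) = v' := by
      change LinearMap.toSpanSingleton (Uq n s) V' v' 1 = v'
      rw [LinearMap.toSpanSingleton_apply, one_smul]
    have h2 : e'.symm v' = Submodule.Quotient.mk 1 := e'.symm_apply_eq.2 h1.symm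
    simp only [f, LinearEquiv.trans_apply, h2, Submodule.quotEquivOfEq_mk]
    change LinearMap.toSpanSingleton (Uq n s) V v 1 = v
    rw [LinearMap.toSpanSingleton_apply, one_smul]
  have hsmul : ∀ (r : ℂ) x, f (r • x) = r • f x := by
    intro r x
    rw [← algebraMap_smul (Uq n s) r x, map_smul, algebraMap_smul]
  refine ⟨f, hf, fun x y => ?_⟩
  have hx : x ∈ lowerSpan (n := n) s v' := by rw [h'.lowerSpan_eq_top]; trivial
  induction hx using Submodule.span_induction generalizing y with
  | mem x hx =>
    obtain ⟨l, rfl⟩ := hx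
    induction l generalizing y with
    | nil =>
      obtain ⟨a, rfl⟩ := h'.exists_smul_eq h'.ne_zero y
      rw [List.map_nil, List.prod_nil, one_smul, map_smul, hf]
      exact form_smul_eq h h' hB hB' a
    | cons i l ih =>
      rw [List.map_cons, List.prod_cons, mul_smul, map_smul, hB.adjoint_f, hB'.adjoint_f,
        ← map_smul, ih]
  | zero => simp
  | add x x' _ _ hx hx' =>
    rw [map_add, map_add, map_add, LinearMap.add_apply, LinearMap.add_apply, add_mul, hx, hx',
      add_mul]
  | smul r x _ hx =>
    rw [hsmul, LinearMap.map_smulₛₗ, LinearMap.map_smulₛₗ, LinearMap.smul_apply,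
      LinearMap.smul_apply, smul_mul_assoc, hx, smul_mul_assoc]

end

/-! ### The model is an irreducible highest weight module -/

section

variable {n : ℕ} {s : ℝ} {t : ℕ → ℤ} {x : ℕ → ℕ → ℤ}

/-- The pattern all of whose rows are as large as possible. -/
def topPattern (n : ℕ) (t : ℕ → ℤ) (m i : ℕ) : ℤ := if i < m ∧ m ≤ n then t i else 0

theorem topPattern_eq {m i : ℕ} (hi : i < m) (hm : m ≤ n) : topPattern n t m i = t i :=
  if_pos ⟨hi, hm⟩

theorem isIntPattern_topPattern (hg : IsGenericTop n s t) : IsIntPattern n t (topPattern n t) where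
  top i hi := topPattern_eq hi le_rfl
  upper m i hi hm := by rw [topPattern_eq hi hm.le, topPattern_eq (by omega) hm]
  lower m i hi hm := by
    rw [topPattern_eq hi hm.le, topPattern_eq (by omega) hm]
    exact hg.anti i (by omega)
  outside m i h := if_neg h

theorem maxBelow_topPattern : maxBelow n (topPattern n t) = topPattern n t := by
  funext m i
  rw [maxBelow]
  split_ifs with h
  · rw [topPattern_eq (by omega) le_rfl, topPattern_eq h.2 h.1.le]
  · rfl

theorem intWt_topPattern {k : ℕ} (hk : k < n) : intWt (topPattern n t) k = t k := by
  rw [intWt, Finset.sum_range_succ, topPattern_eq (by omega) hk, add_sub_right_comm,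
    Finset.sum_congr rfl fun i hi => ?_, sub_self, zero_add]
  rw [Finset.mem_range] at hi
  rw [topPattern_eq (by omega) hk, topPattern_eq hi hk.le]

/-- In the top pattern the shifted entries of row m are those of row n, so in `rowSign` the paired
signs coincide and every factor is a square. -/
theorem patternNorm_topPattern (hg : IsGenericTop n s t) :
    0 < patternNorm n s (topPattern n t) := by
  have hx := isIntPattern_topPattern hg
  have hrow : ∀ {m i}, i < m → m < n →
      shiftedRow (topPattern n t) m i = shiftedRow (topPattern n t) n i := by
    intro m i hi hm
    rw [shiftedRow, shiftedRow, topPattern_eq hi hm.le, topPattern_eq (by omega) le_rfl]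
  have h0 : 0 ≤ sgn (patternNorm n s (topPattern n t)) := by
    rw [hx.sgn_patternNorm hg]
    refine Finset.prod_nonneg fun m hm => Finset.prod_nonneg fun i hi => ?_
    rw [Finset.mem_range] at hm hi
    rw [rowSign, hrow hi hm, sub_self, qFac_zero, sgn_one, mul_one]
    exact mul_nonneg (mul_nonneg (Finset.prod_nonneg fun j _ => mul_self_nonneg _)
      (Finset.prod_nonneg fun j _ => mul_self_nonneg _))
      (Finset.prod_nonneg fun j _ => mul_self_nonneg _)
  refine pos_of_sgn_eq_one ((sgn_eq_one_or (hx.patternNorm_ne hg)).resolve_right fun h => ?_)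
  rw [h] at h0
  norm_num at h0

theorem patVec_ne_zero (hx : IsIntPattern n t x) : patVec n t x ≠ 0 := by
  rw [patVec_of hx]
  exact Finsupp.single_ne_zero.2 one_ne_zero

variable [Finite (IntPattern n t)]

/-- The model as a module over the quantum group. -/
@[reducible] noncomputable def patternModule (hg : IsGenericTop n s t) (c : ℝ) :
    Module (Uq n s) (PatternSpace n t) :=
  Module.compHom _ (patternRep hg c).toRingHom

theorem patternModule_isScalarTower (hg : IsGenericTop n s t) (c : ℝ) :
    letI := patternModule hg c
    IsScalarTower ℂ (Uq n s) (PatternSpace n t) := by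
  let _ := patternModule hg c
  refine ⟨fun r a w => ?_⟩
  change patternRep hg c (r • a) w = r • patternRep hg c a w
  rw [map_smul, LinearMap.smul_apply]

theorem patternModule_gen_smul (hg : IsGenericTop n s t) (c : ℝ) (g : UqGen n)
    (w : PatternSpace n t) :
    letI := patternModule hg c
    Uq.gen s g • w = genOp n s t c g w := by
  rw [← patternRep_gen hg c g]
  rfl

theorem isIrreducibleHighestWeight_patternModule (hg : IsGenericTop n s t) {c : ℝ}
    {lam : Fin n → ℝ} (hlam : ∀ j : Fin n, lam j = c + t j) :
    letI := patternModule hg c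
    IsIrreducibleHighestWeight s lam (PatternSpace n t) (patVec n t (topPattern n t)) := by
  let _ := patternModule hg c
  have := patternModule_isScalarTower hg c
  have hx := isIntPattern_topPattern hg
  refine ⟨?_, patVec_ne_zero hx, fun i => ?_, fun j => ?_⟩
  · have : Nontrivial (PatternSpace n t) := ⟨⟨_, 0, patVec_ne_zero hx⟩⟩
    rw [isSimpleModule_iff]
    refine { eq_bot_or_eq_top := fun W => or_iff_not_imp_left.2 fun hW => ?_ }
    -- For m = n the block is the whole space.
    have h := eq_blockSpace (n := n) (s := s) (W := W.restrictScalars ℂ) hg hx le_rfl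
      (by rw [blockSpace_eq_top hx]; exact le_top)
      (fun h => hW ((Submodule.restrictScalars_eq_bot_iff ℂ (Uq n s) _).1 h))
      (fun r h1 h2 w hw => by
        obtain ⟨r, rfl⟩ : ∃ p, r = p + 1 := ⟨r - 1, by omega⟩
        have := W.smul_mem (Uq.gen s (UqGen.E ⟨r, by omega⟩)) hw
        rw [patternModule_gen_smul hg c] at this
        exact this)
      (fun r h1 h2 w hw => by
        obtain ⟨r, rfl⟩ : ∃ p, r = p + 1 := ⟨r - 1, by omega⟩
        have := W.smul_mem (Uq.gen s (UqGen.F ⟨r, by omega⟩)) hw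
        rw [patternModule_gen_smul hg c] at this
        exact this)
    rw [blockSpace_eq_top hx] at h
    exact (Submodule.restrictScalars_eq_top_iff ℂ (Uq n s) _).1 h
  · rw [Uq.E, patternModule_gen_smul hg c, genOp]
    have := raiseOp_maxBelow (s := s) n (i + 1) (by omega) hx hg le_rfl
    rwa [maxBelow_topPattern] at this
  · rw [Uq.K, patternModule_gen_smul hg c, genOp, weightOp, diagOp_patVec, intWt_topPattern j.2,
      hlam, one_mul]

theorem isStandardForm_patternForm (hg : IsGenericTop n s t) (c : ℝ) :
    letI := patternModule hg c
    IsStandardForm n s (patVec n t (topPattern n t)) (patternForm n s t) := by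
  let _ := patternModule hg c
  refine ⟨patternForm_hermitian, fun i x y => ?_, fun j x y => ?_, ?_⟩
  · rw [Uq.E, Uq.F, patternModule_gen_smul hg c, patternModule_gen_smul hg c]
    exact patternForm_raiseOp hg (by omega) x y
  · rw [Uq.K, Uq.Kinv, patternModule_gen_smul hg c, patternModule_gen_smul hg c]
    exact patternForm_weightOp c j x y
  · have hx := isIntPattern_topPattern hg
    rw [patternForm_patVec hx hx, if_pos rfl, Complex.ofReal_re]
    exact patternNorm_topPattern hg

end

/-- An identification of the module `V` with the model that is isometric up to a positive factor. -/
structure PatternModel {n : ℕ} (s : ℝ) (t : ℕ → ℤ) (c : ℝ) {V : Type*} [AddCommGroup V]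
    [Module ℂ V] [Module (Uq n s) V] (v : V) (B : V →ₗ⋆[ℂ] V →ₗ[ℂ] ℂ) where
  /-- The identification. -/
  equiv : PatternSpace n t ≃ₗ[ℂ] V
  /-- The factor by which the forms differ. -/
  scale : ℝ
  scale_pos : 0 < scale
  gen_smul : ∀ g w, Uq.gen s g • equiv w = equiv (genOp n s t c g w)
  top : equiv (patVec n t (topPattern n t)) = v
  form : ∀ x y, B (equiv x) (equiv y) = scale * patternForm n s t x y

theorem nonempty_patternModel {n : ℕ} {s : ℝ} {t : ℕ → ℤ} {c : ℝ} {lam : Fin n → ℝ}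
    {V : Type*} [AddCommGroup V] [Module ℂ V] [Module (Uq n s) V] [IsScalarTower ℂ (Uq n s) V]
    {v : V} {B : V →ₗ⋆[ℂ] V →ₗ[ℂ] ℂ} [Finite (IntPattern n t)] (hg : IsGenericTop n s t)
    (hlam : ∀ j : Fin n, lam j = c + t j) (h : IsIrreducibleHighestWeight s lam V v)
    (hB : IsStandardForm n s v B) : Nonempty (PatternModel (n := n) s t c v B) := by
  let _ := patternModule hg c
  have := patternModule_isScalarTower hg c
  have h' := isIrreducibleHighestWeight_patternModule hg hlam
  have hB' := isStandardForm_patternForm hg c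
  obtain ⟨f, hf, hform⟩ := exists_isometry h h' hB hB'
  have hx := isIntPattern_topPattern hg
  have hpos := patternNorm_topPattern hg
  rw [patternForm_patVec hx hx, if_pos rfl] at hform
  exact ⟨{
    equiv := { f with
      map_smul' := fun r w => by
        change f (r • w) = r • f w
        rw [← algebraMap_smul (Uq n s) r w, map_smul, algebraMap_smul] }
    scale := (B v v).re / patternNorm n s (topPattern n t)
    scale_pos := div_pos hB.pos hpos
    gen_smul := fun g w => by
      change Uq.gen s g • f w = f (genOp n s t c g w)
      rw [← map_smul, patternModule_gen_smul hg c]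
    top := hf
    form := fun x y => by
      change B (f x) (f y) = _
      have hne : (patternNorm n s (topPattern n t) : ℂ) ≠ 0 := by exact_mod_cast hpos.ne'
      have := hform x y
      rw [hB.self_eq] at this
      rw [Complex.ofReal_div, div_mul_eq_mul_div, eq_div_iff hne, this, mul_comm] }⟩

/-! ### Weights of patterns -/

section

variable {n : ℕ} {s : ℝ} {t : ℕ → ℤ} {x y : ℕ → ℕ → ℤ}

theorem IsIntPattern.intWt_le (hx : IsIntPattern n t x) (hg : IsGenericTop n s t) {k : ℕ}
    (hk : k < n) : intWt x k ≤ t 0 := by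
  have h1 : ∑ i ∈ Finset.range k, x (k + 1) (i + 1) ≤ ∑ i ∈ Finset.range k, x k i :=
    Finset.sum_le_sum fun i hi => hx.lower k i (Finset.mem_range.1 hi) hk
  have h2 := hx.le_max hg (show 0 < k + 1 by omega) hk
  rw [intWt, Finset.sum_range_succ']
  omega

theorem IsIntPattern.le_intWt (hx : IsIntPattern n t x) (hg : IsGenericTop n s t) {k : ℕ}
    (hk : k < n) : t (n - 1) ≤ intWt x k := by
  have h1 : ∑ i ∈ Finset.range k, x k i ≤ ∑ i ∈ Finset.range k, x (k + 1) i :=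
    Finset.sum_le_sum fun i hi => hx.upper k i (Finset.mem_range.1 hi) hk
  have h2 := hx.ge_min hg (show k < k + 1 by omega) hk
  rw [intWt, Finset.sum_range_succ]
  omega

theorem qInt_eq_zero_of_qPow_eq {c : ℝ} {a b : ℤ} (h : qPow s (c + a) = qPow s (c + b)) :
    qInt s (a - b) = 0 := by
  have h1 : qPow s (a - b : ℤ) = 1 := by
    have : ((a - b : ℤ) : ℝ) = (c + a) + -(c + b) := by push_cast; ring
    rw [this, qPow_add, h, qPow_mul_neg]
  have h2 : qPow s (-(a - b : ℤ)) = 1 := by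
    have := qPow_mul_neg s (a - b : ℤ)
    rwa [h1, one_mul] at this
  have h3 : ((qInt s (a - b) : ℝ) : ℂ) = 0 := by
    rw [qInt, qNum_eq, h1, h2, sub_self, zero_div]
  exact_mod_cast h3

/-- K-eigenvalues separate the integers between the extreme entries of the top row. For n ≥ 2
differences of such integers lie in the generic range; for n ≤ 1 there is only one such integer. -/
theorem IsGenericTop.eq_of_qPow_eq (hg : IsGenericTop n s t) {c : ℝ} {a b : ℤ}
    (ha : t (n - 1) ≤ a ∧ a ≤ t 0) (hb : t (n - 1) ≤ b ∧ b ≤ t 0)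
    (h : qPow s (c + a) = qPow s (c + b)) : a = b := by
  by_contra hne
  have h2 : 2 ≤ n := by
    by_contra h2
    obtain h0 : n - 1 = 0 := by omega
    rw [h0] at ha hb
    omega
  exact hg.qInt_ne (sub_ne_zero.2 hne) (by omega) (by omega) (qInt_eq_zero_of_qPow_eq h)

theorem IsMaxBelow.intWt_eq {m : ℕ} (h : IsMaxBelow m x) {k : ℕ} (hk : k < m) :
    intWt x k = x m k := by
  rw [intWt, Finset.sum_range_succ, add_sub_right_comm,
    Finset.sum_congr rfl fun i hi => (h k i (Finset.mem_range.1 hi) hk).symm, sub_self, zero_add,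
    h.eq_row (m - (k + 1)) (by omega) (by omega)]

theorem diagOp_apply (f : (ℕ → ℕ → ℤ) → ℂ) (w : PatternSpace n t) (P : IntPattern n t) :
    diagOp n t f w P = f P.1 * w P := by
  classical
  have key : (Finsupp.lapply P : PatternSpace n t →ₗ[ℂ] ℂ) ∘ₗ diagOp n t f =
      f P.1 • Finsupp.lapply P := by
    refine patternSpace_ext fun x hx => ?_
    rw [LinearMap.comp_apply, diagOp_patVec, map_smul, LinearMap.smul_apply, Finsupp.lapply_apply,
      patVec_apply]
    split_ifs with h
    · rw [h]
    · rw [smul_zero, smul_zero]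
  exact LinearMap.congr_fun key w

theorem weightOp_mem_blockSpace {m : ℕ} (c e : ℝ) (k : ℕ) {w : PatternSpace n t}
    (hw : w ∈ blockSpace n t m x) : weightOp n s t c e k w ∈ blockSpace n t m x := by
  rw [mem_blockSpace] at hw ⊢
  intro P hP
  refine hw P (Finsupp.mem_support_iff.2 fun h => Finsupp.mem_support_iff.1 hP ?_)
  rw [weightOp, diagOp_apply, h, mul_zero]

theorem qPow_eq_of_weightOp {c a : ℝ} {k : ℕ} {w : PatternSpace n t}
    (h : weightOp n s t c 1 k w = qPow s a • w) {P : IntPattern n t} (hP : P ∈ w.support) :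
    qPow s (c + intWt P.1 k) = qPow s a := by
  have h1 := DFunLike.congr_fun h P
  rw [weightOp, diagOp_apply, Finsupp.smul_apply, one_mul, smul_eq_mul] at h1
  exact mul_right_cancel₀ (Finsupp.mem_support_iff.1 hP) h1

/-- A vector of the block of `x` in `m + 1` rows that is a highest weight vector for the first `m`
rows lies in the block of `x` in `m` rows if it has the weight given by row `m` of `x`. -/
theorem mem_blockSpace_of_weightOp (hg : IsGenericTop n s t) (hx : IsIntPattern n t x) {c : ℝ}
    {m : ℕ} (hm : m < n) {w : PatternSpace n t} (hw : w ∈ blockSpace n t (m + 1) x)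
    (hE : ∀ r, 1 ≤ r → r < m → raiseOp n s t r w = 0)
    (hK : ∀ k, k < m → weightOp n s t c 1 k w = qPow s (c + x m k) • w) :
    w ∈ blockSpace n t m x := by
  rw [mem_blockSpace] at hw ⊢
  intro P hP k i hk
  rcases hk.eq_or_lt with rfl | hk
  · by_cases hi : i < m
    · have hmax := isMaxBelow_of_raiseOp_eq_zero hg hm.le hE P hP
      have h := qPow_eq_of_weightOp (hK i hi) hP
      rw [hmax.intWt_eq hi] at h
      exact hg.eq_of_qPow_eq ⟨P.2.ge_min hg hi hm.le, P.2.le_max hg hi hm.le⟩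
        ⟨hx.ge_min hg hi hm.le, hx.le_max hg hi hm.le⟩ h
    · rw [P.2.outside _ _ (by omega), hx.outside _ _ (by omega)]
  · exact hw P hP k i hk

theorem eq_smul_patVec_of_mem_blockSpace (hx : IsIntPattern n t x) {w : PatternSpace n t}
    (hw : w ∈ blockSpace n t 1 x) : ∃ a : ℂ, w = a • patVec n t x := by
  refine eq_smul_patVec_of_support fun P hP => ?_
  funext k i
  rcases Nat.eq_zero_or_pos k with rfl | hk
  · rw [P.2.outside _ _ (by omega), hx.outside _ _ (by omega)]
  · exact mem_blockSpace.1 hw P hP k i hk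

/-- The span of the patterns of a given weight. -/
noncomputable def weightSub (n : ℕ) (t : ℕ → ℤ) (c : ℝ) (mu : Fin n → ℝ) :
    Submodule ℂ (PatternSpace n t) :=
  Finsupp.supported ℂ ℂ {P : IntPattern n t | ∀ k : Fin n, c + intWt P.1 k = mu k}

theorem mem_weightSub {c : ℝ} {mu : Fin n → ℝ} {w : PatternSpace n t} :
    w ∈ weightSub n t c mu ↔ ∀ P ∈ w.support, ∀ k : Fin n, c + intWt P.1 k = mu k := by
  rw [weightSub, Finsupp.mem_supported]
  rfl

theorem lowerOp_mem_weightSub {c : ℝ} {mu : Fin n → ℝ} {w : PatternSpace n t}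
    (hw : w ∈ weightSub n t c mu) (i : Fin (n - 1)) :
    lowerOp n s t (i + 1) w ∈ weightSub n t c (mu - simpleRoot i) := by
  rw [mem_weightSub] at hw ⊢
  intro R hR k
  obtain ⟨P, hP, j, hj, h⟩ := exists_of_lowerOp_apply_ne (Finsupp.mem_support_iff.1 hR)
  rw [← h, intWt_sub _ hj, Pi.sub_apply, simpleRoot_eq_rootCoord, ← hw P hP k]
  push_cast
  ring

theorem iSupIndep_weightSub (c : ℝ) : iSupIndep (weightSub n t c) := by
  intro mu
  refine Disjoint.mono_right (iSup₂_le fun nu hne => Finsupp.supported_mono ?_)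
    (Finsupp.disjoint_supported_supported disjoint_compl_right)
  exact fun P hP hQ => hne (funext fun k => (hP k).symm.trans (hQ k))

theorem weightSub_eq_span (c : ℝ) (mu : Fin n → ℝ) : weightSub n t c mu =
    Submodule.span ℂ (Set.range
      fun P : {P : IntPattern n t // ∀ k : Fin n, c + intWt P.1 k = mu k} =>
        (patVec n t P.1.1 : PatternSpace n t)) := by
  rw [weightSub, Finsupp.supported_eq_span_single]
  congr 1
  ext w
  constructor
  · rintro ⟨P, hP, rfl⟩
    exact ⟨⟨P, hP⟩, patVec_coe P⟩
  · rintro ⟨P, rfl⟩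
    exact ⟨P.1, P.2, (patVec_coe P.1).symm⟩

end

/-- By the modular law, a spanning family inside an independent one fills it. Thus spans of words in
the f_i are identified with weight spaces of the model from an inclusion alone. -/
theorem Submodule.eq_of_le_of_iSupIndep {R M ι : Type*} [Ring R] [AddCommGroup M] [Module R M]
    {A B : ι → Submodule R M} (hB : iSupIndep B) (hle : ∀ i, A i ≤ B i) (hA : ⨆ i, A i = ⊤)
    (i : ι) : A i = B i := by
  refine le_antisymm (hle i) ?_
  have h1 : A i ⊔ ⨆ (j) (_ : j ≠ i), A j = ⊤ := by
    rw [eq_top_iff, ← hA]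
    refine iSup_le fun j => ?_
    by_cases h : j = i
    · rw [h]; exact le_sup_left
    · exact le_sup_of_le_right (le_iSup₂_of_le j h le_rfl)
  have h2 : (⨆ (j) (_ : j ≠ i), A j) ⊓ B i = ⊥ := by
    refine le_bot_iff.1 (le_trans ?_ (disjoint_iff.1 (hB i)).le)
    rw [inf_comm]
    exact inf_le_inf_left _ (iSup₂_mono fun j _ => hle j)
  calc B i = (A i ⊔ ⨆ (j) (_ : j ≠ i), A j) ⊓ B i := by rw [h1, top_inf_eq]
    _ = A i ⊔ (⨆ (j) (_ : j ≠ i), A j) ⊓ B i := sup_inf_assoc_of_le _ (hle i)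
    _ ≤ A i := by rw [h2, sup_bot_eq]

/-! ### Transfer from the model -/

namespace PatternModel

variable {n : ℕ} {s : ℝ} {t : ℕ → ℤ} {c : ℝ} {V : Type*} [AddCommGroup V] [Module ℂ V]
  [Module (Uq n s) V] {v : V} {B : V →ₗ⋆[ℂ] V →ₗ[ℂ] ℂ} {x : ℕ → ℕ → ℤ}

section Weights

variable {lam : Fin n → ℝ}

theorem weightSpace_le (M : PatternModel (n := n) s t c v B) (hlam : ∀ j : Fin n, lam j = c + t j)
    (mu : Fin n → ℝ) :
    weightSpace s lam v mu ≤ (weightSub n t c mu).map M.equiv.toLinearMap := by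
  refine Submodule.span_le.2 ?_
  rintro _ ⟨l, rfl, rfl⟩
  rw [SetLike.mem_coe]
  induction l with
  | nil =>
    rw [List.map_nil, List.map_nil, List.prod_nil, one_smul, List.sum_nil, sub_zero]
    refine ⟨patVec n t (topPattern n t), mem_weightSub.2 fun P hP k => ?_, M.top⟩
    classical
    rw [Finsupp.mem_support_iff, patVec_apply] at hP
    have : topPattern n t = P.1 := by
      by_contra h
      exact hP (if_neg h)
    rw [← this, intWt_topPattern k.2, hlam]
  | cons i l ih =>
    obtain ⟨w, hw, hwv⟩ := ih
    have hwv' : M.equiv w = (l.map (Uq.F s)).prod • v := hwv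
    refine ⟨lowerOp n s t (i + 1) w, ?_, ?_⟩
    · have h := lowerOp_mem_weightSub (s := s) hw i
      rwa [sub_sub, add_comm _ (simpleRoot i), ← List.sum_cons, ← List.map_cons] at h
    · rw [List.map_cons, List.prod_cons, mul_smul, ← hwv']
      exact (M.gen_smul (UqGen.F i) w).symm

theorem iSupIndep_map (M : PatternModel (n := n) s t c v B) :
    iSupIndep fun mu => (weightSub n t c mu).map M.equiv.toLinearMap :=
  (iSupIndep_weightSub c).map_orderIso (Submodule.orderIsoMapComap M.equiv)

theorem iSupIndep_weightSpace (M : PatternModel (n := n) s t c v B)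
    (hlam : ∀ j : Fin n, lam j = c + t j) : iSupIndep (weightSpace s lam v) :=
  M.iSupIndep_map.mono (M.weightSpace_le hlam)

variable [IsScalarTower ℂ (Uq n s) V]

theorem weightSpace_eq (M : PatternModel (n := n) s t c v B) (hlam : ∀ j : Fin n, lam j = c + t j)
    (h : IsIrreducibleHighestWeight s lam V v) (mu : Fin n → ℝ) :
    weightSpace s lam v mu = (weightSub n t c mu).map M.equiv.toLinearMap :=
  Submodule.eq_of_le_of_iSupIndep M.iSupIndep_map (M.weightSpace_le hlam) h.iSup_weightSpace mu

/-- A real mu that is no weight may give the same eigenvalues as a weight, hence the assumption that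
the space is nonzero. It makes mu the weight of a pattern, and `eq_of_qPow_eq` applies in each
coordinate. -/
theorem mem_weightSpace_iff (M : PatternModel (n := n) s t c v B) (hg : IsGenericTop n s t)
    (hlam : ∀ j : Fin n, lam j = c + t j) (h : IsIrreducibleHighestWeight s lam V v)
    {mu : Fin n → ℝ} (hmu : weightSpace s lam v mu ≠ ⊥) (y : V) :
    y ∈ weightSpace s lam v mu ↔ ∀ j, Uq.K s j • y = qPow s (mu j) • y := by
  obtain ⟨w, rfl⟩ := M.equiv.surjective y
  rw [M.weightSpace_eq hlam h] at hmu ⊢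
  have hmem : M.equiv w ∈ (weightSub n t c mu).map M.equiv.toLinearMap ↔
      w ∈ weightSub n t c mu :=
    ⟨fun ⟨w', hw', e⟩ => M.equiv.injective e ▸ hw', fun hw => ⟨w, hw, rfl⟩⟩
  have hK : ∀ j, Uq.K s j • M.equiv w = qPow s (mu j) • M.equiv w ↔
      weightOp n s t c 1 j w = qPow s (mu j) • w := fun j => by
    rw [Uq.K, M.gen_smul, ← map_smul, M.equiv.injective.eq_iff, genOp]
  simp only [hmem, hK]
  constructor
  · intro hw j
    ext P
    rw [weightOp, diagOp_apply, Finsupp.smul_apply, smul_eq_mul, one_mul]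
    by_cases hP : w P = 0
    · rw [hP, mul_zero, mul_zero]
    · rw [mem_weightSub.1 hw P (Finsupp.mem_support_iff.2 hP)]
  · intro hw
    obtain ⟨u, hu, hu0⟩ := (Submodule.ne_bot_iff _).1 hmu
    obtain ⟨u, hu', rfl⟩ := hu
    have hu1 : u ≠ 0 := fun e => hu0 (by rw [e, map_zero])
    obtain ⟨Q, hQ⟩ := Finsupp.support_nonempty_iff.2 hu1
    have hQmu := mem_weightSub.1 hu' Q hQ
    rw [mem_weightSub]
    intro P hP k
    have h1 := qPow_eq_of_weightOp (hw k) hP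
    rw [← hQmu k] at h1 ⊢
    rw [hg.eq_of_qPow_eq ⟨P.2.le_intWt hg k.2, P.2.intWt_le hg k.2⟩
      ⟨Q.2.le_intWt hg k.2, Q.2.intWt_le hg k.2⟩ h1]

end Weights

theorem isHighestWeightVector_maxBelow (M : PatternModel (n := n) s t c v B)
    (hg : IsGenericTop n s t) (hx : IsIntPattern n t x) {m : ℕ} (hm : m ≤ n) {mu : ℕ → ℝ}
    (hmu : ∀ j, j < m → mu j = c + x m j) :
    IsHighestWeightVector n s m mu (M.equiv (patVec n t (maxBelow m x))) where
  ne_zero h := patVec_ne_zero (hx.maxBelow hg hm) ((LinearEquiv.map_eq_zero_iff M.equiv).1 h)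
  e_smul i hi := by
    rw [Uq.E, M.gen_smul, genOp, raiseOp_maxBelow m (i + 1) hi hx hg hm, map_zero]
  k_smul j hj := by
    rw [Uq.K, M.gen_smul, genOp, weightOp, diagOp_patVec, map_smul,
      (isMaxBelow_maxBelow m x).intWt_eq hj, agreeFrom_maxBelow m x m j le_rfl, hmu j hj, one_mul]

section Blocks

variable [IsScalarTower ℂ (Uq n s) V]

theorem sub_smul_mem (M : PatternModel (n := n) s t c v B) {m : ℕ} (a : Uq.sub n s m)
    {y : V} (hy : y ∈ (blockSpace n t m x).map M.equiv.toLinearMap) :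
    a • y ∈ (blockSpace n t m x).map M.equiv.toLinearMap := by
  refine Uq.sub_smul_mem ?_ ?_ ?_ ?_ a hy
  · rintro i hi _ ⟨w, hw, rfl⟩
    exact ⟨_, raiseOp_mem_blockSpace hi hw, (M.gen_smul (UqGen.E i) w).symm⟩
  · rintro i hi _ ⟨w, hw, rfl⟩
    exact ⟨_, lowerOp_mem_blockSpace hi hw, (M.gen_smul (UqGen.F i) w).symm⟩
  · rintro j hj _ ⟨w, hw, rfl⟩
    exact ⟨_, weightOp_mem_blockSpace c 1 j hw, (M.gen_smul (UqGen.K j) w).symm⟩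
  · rintro j hj _ ⟨w, hw, rfl⟩
    exact ⟨_, weightOp_mem_blockSpace c (-1) j hw, (M.gen_smul (UqGen.Kinv j) w).symm⟩

/-- Pulled back to the model, the generated submodule is a nonzero stable subspace of the block,
hence the block by `eq_blockSpace`. -/
theorem mem_span_iff [Finite (IntPattern n t)] (M : PatternModel (n := n) s t c v B)
    (hg : IsGenericTop n s t) (hx : IsIntPattern n t x) {m : ℕ} (hm : m ≤ n)
    {u : PatternSpace n t} (hu : u ∈ blockSpace n t m x) (hu0 : u ≠ 0) (w : PatternSpace n t) :
    M.equiv w ∈ Submodule.span (Uq.sub n s m) {M.equiv u} ↔ w ∈ blockSpace n t m x := by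
  let W : Submodule ℂ (PatternSpace n t) :=
    ((Submodule.span (Uq.sub n s m) {M.equiv u}).restrictScalars ℂ).comap M.equiv.toLinearMap
  have hgen : ∀ (a : Uq n s) (_ : a ∈ Uq.sub n s m) w, w ∈ W →
      a • M.equiv w ∈ Submodule.span (Uq.sub n s m) {M.equiv u} := fun a ha w hw =>
    Submodule.smul_mem _ (⟨a, ha⟩ : Uq.sub n s m) hw
  have h : W = blockSpace n t m x := by
    refine eq_blockSpace (s := s) hg hx hm ?_ ?_ ?_ ?_
    · intro w hw
      obtain ⟨a, ha⟩ := Submodule.mem_span_singleton.1 (show M.equiv w ∈ _ from hw)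
      obtain ⟨w', hw', e⟩ := M.sub_smul_mem a (Submodule.mem_map_of_mem hu)
      have : M.equiv w' = M.equiv w := e.trans ha
      rwa [← M.equiv.injective this]
    · intro h0
      have : u ∈ W := Submodule.mem_span_singleton_self (M.equiv u)
      rw [h0] at this
      exact hu0 this
    · intro r h1 h2 w hw
      obtain ⟨r, rfl⟩ : ∃ p, r = p + 1 := ⟨r - 1, by omega⟩
      have := hgen (Uq.E s ⟨r, by omega⟩)
        (Algebra.subset_adjoin (Or.inl ⟨⟨r, by omega⟩, h2, Or.inl rfl⟩)) w hw
      rwa [Uq.E, M.gen_smul] at this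
    · intro r h1 h2 w hw
      obtain ⟨r, rfl⟩ : ∃ p, r = p + 1 := ⟨r - 1, by omega⟩
      have := hgen (Uq.F s ⟨r, by omega⟩)
        (Algebra.subset_adjoin (Or.inl ⟨⟨r, by omega⟩, h2, Or.inr rfl⟩)) w hw
      rwa [Uq.F, M.gen_smul] at this
  rw [← h]
  rfl

theorem isSimpleModule_span [Finite (IntPattern n t)] (M : PatternModel (n := n) s t c v B)
    (hg : IsGenericTop n s t) (hx : IsIntPattern n t x) {m : ℕ} (hm : m ≤ n) :
    IsSimpleModule (Uq.sub n s m)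
      (Submodule.span (Uq.sub n s m) {M.equiv (patVec n t x)}) := by
  have hmem := M.mem_span_iff hg hx hm (patVec_mem_blockSpace fun _ _ _ => rfl) (patVec_ne_zero hx)
  rw [isSimpleModule_iff_toSpanSingleton_surjective]
  refine ⟨⟨⟨⟨_, Submodule.mem_span_singleton_self _⟩, 0, fun h => ?_⟩⟩, ?_⟩
  · exact patVec_ne_zero hx
      ((LinearEquiv.map_eq_zero_iff M.equiv).1 (congrArg Subtype.val h))
  · rintro ⟨y, hy⟩ hy0 ⟨z, hz⟩
    obtain ⟨y, rfl⟩ := M.equiv.surjective y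
    obtain ⟨z, rfl⟩ := M.equiv.surjective z
    have hy1 : y ≠ 0 := by
      rintro rfl
      exact hy0 (Subtype.ext (map_zero _))
    have := (M.mem_span_iff hg hx hm ((hmem y).1 hy) hy1 z).2 ((hmem z).1 hz)
    obtain ⟨a, ha⟩ := Submodule.mem_span_singleton.1 this
    exact ⟨a, Subtype.ext ha⟩

/-- A vector that generates, for all `m`, a simple module of the highest weight given by row `m`
of the pattern `x`, is a multiple of the basis vector of `x`. -/
theorem exists_eq_smul_patVec [Finite (IntPattern n t)] (M : PatternModel (n := n) s t c v B)
    (hg : IsGenericTop n s t) (hx : IsIntPattern n t x) {mu : ℕ → ℕ → ℝ}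
    (hmu : ∀ m j, j < m → m ≤ n → mu m j = c + x m j) {u : PatternSpace n t}
    (hu : ∀ m, 1 ≤ m → m ≤ n →
      IsSimpleModule (Uq.sub n s m) (Submodule.span (Uq.sub n s m) {M.equiv u}) ∧
      ∃ w ∈ Submodule.span (Uq.sub n s m) {M.equiv u}, IsHighestWeightVector n s m (mu m) w) :
    ∃ a : ℂ, u = a • patVec n t x := by
  refine eq_smul_patVec_of_mem_blockSpace hx ?_
  -- Descending induction on m, one row of the pattern being fixed at each step.
  have key : ∀ d m, 1 ≤ m → m + d = n → u ∈ blockSpace n t m x := by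
    intro d
    induction d with
    | zero =>
      intro m _ hd
      obtain rfl : m = n := hd
      rw [blockSpace_eq_top hx]
      trivial
    | succ d ih =>
      intro m h1 hd
      have hub := ih (m + 1) (by omega) (by omega)
      obtain ⟨hsimple, w, hw, hhw⟩ := hu m h1 (by omega)
      obtain ⟨w, rfl⟩ := M.equiv.surjective w
      have hw1 : w ∈ blockSpace n t (m + 1) x := by
        obtain ⟨a, ha⟩ := Submodule.mem_span_singleton.1 hw
        have hle : Uq.sub n s m ≤ Uq.sub n s (m + 1) := by
          refine Algebra.adjoin_mono (Set.union_subset_union ?_ ?_)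
          · rintro _ ⟨i, hi, h⟩
            exact ⟨i, by omega, h⟩
          · rintro _ ⟨j, hj, h⟩
            exact ⟨j, by omega, h⟩
        obtain ⟨w', hw', e⟩ := M.sub_smul_mem (⟨a, hle a.2⟩ : Uq.sub n s (m + 1))
          (Submodule.mem_map_of_mem hub)
        have : M.equiv w' = M.equiv w := e.trans ha
        rwa [← M.equiv.injective this]
      -- The highest weight prescribes row m; then, the generated module being simple, `w` generates
      -- `u` in turn and brings it into the same block.
      have hw2 : w ∈ blockSpace n t m x := by
        refine mem_blockSpace_of_weightOp (s := s) (c := c) hg hx (by omega) hw1 ?_ ?_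
        · intro r h2 h3
          obtain ⟨r, rfl⟩ : ∃ p, r = p + 1 := ⟨r - 1, by omega⟩
          have := hhw.e_smul ⟨r, by omega⟩ h3
          rw [Uq.E, M.gen_smul] at this
          exact (LinearEquiv.map_eq_zero_iff M.equiv).1 this
        · intro k hk
          have := hhw.k_smul ⟨k, by omega⟩ hk
          rw [Uq.K, M.gen_smul, ← map_smul, M.equiv.injective.eq_iff, hmu m k hk (by omega)] at this
          exact this
      have hne : (⟨M.equiv w, hw⟩ : Submodule.span (Uq.sub n s m) {M.equiv u}) ≠ 0 :=
        fun h => hhw.ne_zero (congrArg Subtype.val h)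
      obtain ⟨a, ha⟩ := IsSimpleModule.toSpanSingleton_surjective (Uq.sub n s m) hne
        ⟨M.equiv u, Submodule.mem_span_singleton_self _⟩
      have ha' : a • M.equiv w = M.equiv u := congrArg Subtype.val ha
      obtain ⟨u', hu', e⟩ := M.sub_smul_mem a (Submodule.mem_map_of_mem hw2)
      have : M.equiv u' = M.equiv u := e.trans ha'
      rwa [← M.equiv.injective this]
  -- For n = 0 the induction does not reach m = 1, but the block for m = 0 is already the whole
  -- space.
  rcases Nat.eq_zero_or_pos n with h0 | h0
  · have : u ∈ blockSpace n t n x := by rw [blockSpace_eq_top hx]; trivial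
    rw [mem_blockSpace] at this ⊢
    exact fun P hP k i hk => this P hP k i (by omega)
  · exact key (n - 1) 1 le_rfl (by omega)

end Blocks

end PatternModel

/-! ### The Gelfand–Tsetlin basis and the signature character. -/

namespace GTPattern

variable {n : ℕ} {s : ℝ} {lam : Fin n → ℝ}

theorem wt_eq (hlam : ∀ i j : Fin n, (j : ℕ) = i + 1 → ∃ k : ℕ, lam i - lam j = k)
    (P : GTPattern lam) (k : Fin n) : P.wt k = baseEntry lam + intWt P.intEntry k := by
  have h1 : ∑ i ∈ Finset.range (k + 1), P.entry (k + 1) i =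
      ∑ i ∈ Finset.range (k + 1), (baseEntry lam + P.intEntry (k + 1) i) :=
    Finset.sum_congr rfl fun i hi => entry_eq hlam P (Finset.mem_range.1 hi) k.2
  have h2 : ∑ i ∈ Finset.range k, P.entry k i =
      ∑ i ∈ Finset.range k, (baseEntry lam + P.intEntry k i) :=
    Finset.sum_congr rfl fun i hi => entry_eq hlam P (Finset.mem_range.1 hi) k.2.le
  rw [wt, h1, h2, Finset.sum_add_distrib, Finset.sum_add_distrib, intWt, Finset.sum_const,
    Finset.sum_const, Finset.card_range, Finset.card_range, succ_nsmul]
  push_cast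
  ring

theorem wt_eq_iff (hlam : ∀ i j : Fin n, (j : ℕ) = i + 1 → ∃ k : ℕ, lam i - lam j = k)
    (P : GTPattern lam) (mu : Fin n → ℝ) :
    P.wt = mu ↔ ∀ k : Fin n, baseEntry lam + intWt (equivInt hlam P).1 k = mu k := by
  rw [funext_iff]
  exact forall_congr' fun k => by rw [wt_eq hlam]; rfl

variable {V : Type*} [AddCommGroup V] [Module ℂ V] [Module (Uq n s) V] {v : V}
  {B : V →ₗ⋆[ℂ] V →ₗ[ℂ] ℂ}

/-- The basis of a module indexed by patterns that is obtained from the model. -/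
noncomputable def modelBasis
    (hlam : ∀ i j : Fin n, (j : ℕ) = i + 1 → ∃ k : ℕ, lam i - lam j = k)
    (M : PatternModel (n := n) s (intTop lam) (baseEntry lam) v B) :
    Module.Basis (GTPattern lam) ℂ V :=
  ((Finsupp.basisSingleOne (R := ℂ) (ι := IntPattern n (intTop lam))).map M.equiv).reindex
    (equivInt hlam).symm

theorem modelBasis_apply
    (hlam : ∀ i j : Fin n, (j : ℕ) = i + 1 → ∃ k : ℕ, lam i - lam j = k)
    (M : PatternModel (n := n) s (intTop lam) (baseEntry lam) v B) (P : GTPattern lam) :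
    modelBasis hlam M P = M.equiv (patVec n (intTop lam) P.intEntry) := by
  rw [modelBasis, Module.Basis.reindex_apply, Module.Basis.map_apply, Finsupp.coe_basisSingleOne,
    Equiv.symm_symm]
  change M.equiv (Finsupp.single (equivInt hlam P) 1) = _
  rw [← patVec_coe]
  rfl

theorem form_modelBasis (hlam : ∀ i j : Fin n, (j : ℕ) = i + 1 → ∃ k : ℕ, lam i - lam j = k)
    (M : PatternModel (n := n) s (intTop lam) (baseEntry lam) v B) {P Q : GTPattern lam}
    (h : P ≠ Q) : B (modelBasis hlam M P) (modelBasis hlam M Q) = 0 := by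
  rw [modelBasis_apply, modelBasis_apply, M.form,
    patternForm_patVec (P.isIntPattern hlam) (Q.isIntPattern hlam), if_neg, mul_zero]
  exact fun e => h ((equivInt hlam).injective (Subtype.ext e))

theorem sgn_form_modelBasis (hg : IsGenericTop n s (intTop lam))
    (hlam : ∀ i j : Fin n, (j : ℕ) = i + 1 → ∃ k : ℕ, lam i - lam j = k)
    (M : PatternModel (n := n) s (intTop lam) (baseEntry lam) v B) (P : GTPattern lam) :
    sgn (B (modelBasis hlam M P) (modelBasis hlam M P)).re = P.signQ s := by
  rw [modelBasis_apply, M.form, patternForm_patVec (P.isIntPattern hlam) (P.isIntPattern hlam),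
    if_pos rfl, ← Complex.ofReal_mul, Complex.ofReal_re, sgn_mul, sgn_of_pos M.scale_pos, one_mul,
    signQ_eq_sgn_patternNorm hg hlam]

variable [IsScalarTower ℂ (Uq n s) V]

theorem isGTBasis_modelBasis (hg : IsGenericTop n s (intTop lam))
    (hlam : ∀ i j : Fin n, (j : ℕ) = i + 1 → ∃ k : ℕ, lam i - lam j = k)
    (M : PatternModel (n := n) s (intTop lam) (baseEntry lam) v B) :
    IsGTBasis s (modelBasis hlam M) := by
  have := Finite.of_equiv _ (equivInt hlam)
  intro P m _ hm
  have hx := P.isIntPattern hlam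
  rw [modelBasis_apply]
  refine ⟨M.isSimpleModule_span hg hx hm, _, ?_,
    M.isHighestWeightVector_maxBelow hg hx hm fun j hj => entry_eq hlam P hj hm⟩
  exact (M.mem_span_iff hg hx hm (patVec_mem_blockSpace fun _ _ _ => rfl) (patVec_ne_zero hx) _).2
    (patVec_mem_blockSpace (agreeFrom_maxBelow m _))

theorem exists_eq_smul_modelBasis (hg : IsGenericTop n s (intTop lam))
    (hlam : ∀ i j : Fin n, (j : ℕ) = i + 1 → ∃ k : ℕ, lam i - lam j = k)
    (M : PatternModel (n := n) s (intTop lam) (baseEntry lam) v B)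
    {b : Module.Basis (GTPattern lam) ℂ V} (hb : IsGTBasis s b) (P : GTPattern lam) :
    ∃ a : ℂ, a ≠ 0 ∧ b P = a • modelBasis hlam M P := by
  have := Finite.of_equiv _ (equivInt hlam)
  obtain ⟨u, hu⟩ := M.equiv.surjective (b P)
  have h := hb P
  rw [← hu] at h
  obtain ⟨a, rfl⟩ := M.exists_eq_smul_patVec hg (P.isIntPattern hlam)
    (fun m j hj hm => entry_eq hlam P hj hm) h
  refine ⟨a, ?_, by rw [← hu, map_smul, modelBasis_apply]⟩
  rintro rfl
  rw [zero_smul, map_zero] at hu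
  exact b.ne_zero P hu.symm

theorem weightSpace_eq_span
    (hlam : ∀ i j : Fin n, (j : ℕ) = i + 1 → ∃ k : ℕ, lam i - lam j = k)
    (M : PatternModel (n := n) s (intTop lam) (baseEntry lam) v B)
    (h : IsIrreducibleHighestWeight s lam V v) (mu : Fin n → ℝ) :
    weightSpace s lam v mu = Submodule.span ℂ
      (Set.range fun P : {P : GTPattern lam // P.wt = mu} => modelBasis hlam M P) := by
  rw [M.weightSpace_eq (fun j => lam_eq hlam j j.2) h, weightSub_eq_span, Submodule.map_span,
    ← Set.range_comp]
  congr 1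
  let e : {P : GTPattern lam // P.wt = mu} ≃ {P : IntPattern n (intTop lam) //
      ∀ k : Fin n, baseEntry lam + intWt P.1 k = mu k} :=
    (equivInt hlam).subtypeEquiv fun P => wt_eq_iff hlam P mu
  rw [← e.surjective.range_comp]
  congr 1
  funext P
  exact (modelBasis_apply hlam M P.1).symm

theorem modelBasis_mem (hlam : ∀ i j : Fin n, (j : ℕ) = i + 1 → ∃ k : ℕ, lam i - lam j = k)
    (M : PatternModel (n := n) s (intTop lam) (baseEntry lam) v B)
    (h : IsIrreducibleHighestWeight s lam V v) (P : GTPattern lam) :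
    modelBasis hlam M P ∈ weightSpace s lam v P.wt := by
  rw [weightSpace_eq_span hlam M h]
  exact Submodule.subset_span ⟨⟨P, rfl⟩, rfl⟩

/-- The patterns of weight mu give an orthogonal basis of the weight space, in which Sylvester's law
allows the signature to be computed. -/
theorem signatureCharacter_eq (hg : IsGenericTop n s (intTop lam))
    (hlam : ∀ i j : Fin n, (j : ℕ) = i + 1 → ∃ k : ℕ, lam i - lam j = k)
    (M : PatternModel (n := n) s (intTop lam) (baseEntry lam) v B)
    (h : IsIrreducibleHighestWeight s lam V v) :
    signatureCharacter s lam v B = ∑ P : GTPattern lam, P.signQ s • formalExp P.wt := by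
  classical
  funext mu
  have hli : LinearIndependent ℂ
      fun P : {P : GTPattern lam // P.wt = mu} => modelBasis hlam M P :=
    (modelBasis hlam M).linearIndependent.comp _ Subtype.val_injective
  have horth : IsOrthogonalBasis B (Module.Basis.span hli) := fun P Q hPQ => by
    rw [Module.Basis.span_apply, Module.Basis.span_apply]
    exact form_modelBasis hlam M fun e => hPQ (Subtype.ext e)
  rw [signatureCharacter, weightSpace_eq_span hlam M h, signature_eq B _ horth]
  simp only [Module.Basis.span_apply, sgn_form_modelBasis hg hlam M]
  have hterm : ∀ P : GTPattern lam,
      (P.signQ s • formalExp P.wt) mu = if P.wt = mu then P.signQ s else 0 := by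
    intro P
    rw [Pi.smul_apply, formalExp, Pi.single_apply, smul_eq_mul, mul_ite, mul_one, mul_zero]
    exact if_congr eq_comm rfl rfl
  rw [Finset.sum_apply, Finset.sum_congr rfl fun P _ => hterm P, ← Finset.sum_filter]
  exact (Finset.sum_subtype _ (fun P => by simp) _).symm

end GTPattern

/-! ### The main theorem. -/

theorem mainTheorem1 (n : ℕ) (s : ℝ) (hs0 : 0 < s) (hs2 : s < 2) (hs1 : s ≠ 1)
    (lam : Fin n → ℝ)
    (hlam : ∀ i j : Fin n, (j : ℕ) = i + 1 → ∃ k : ℕ, lam i - lam j = k)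
    (hq : ∀ (i j : Fin n) (k : ℕ), 1 ≤ k → (k : ℝ) ≤ lam i - lam j + n - 2 → qNum s k ≠ 0) :
    (∀ P : GTPattern lam, (P.signQ s = 1 ∨ P.signQ s = -1) ∧
      P.signQ s = P.signQ' s ∧ P.signQ s = P.signQ'' s) ∧
    (∃ (V : Type) (_ : AddCommGroup V) (_ : Module ℂ V) (_ : Module (Uq n s) V)
      (_ : IsScalarTower ℂ (Uq n s) V) (_ : FiniteDimensional ℂ V)
      (v : V) (B : V →ₗ⋆[ℂ] V →ₗ[ℂ] ℂ),
      IsIrreducibleHighestWeight s lam V v ∧ IsStandardForm n s v B) ∧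
    (∀ (V : Type*) [AddCommGroup V] [Module ℂ V] [Module (Uq n s) V]
      [IsScalarTower ℂ (Uq n s) V] [FiniteDimensional ℂ V]
      (v : V) (B : V →ₗ⋆[ℂ] V →ₗ[ℂ] ℂ),
      IsIrreducibleHighestWeight s lam V v → IsStandardForm n s v B →
      (iSupIndep (weightSpace s lam v) ∧ (⨆ mu, weightSpace s lam v mu) = ⊤ ∧
        ∀ mu, weightSpace s lam v mu ≠ ⊥ →
          ∀ x : V, x ∈ weightSpace s lam v mu ↔ ∀ j, Uq.K s j • x = qPow s (mu j) • x) ∧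
      (∃ b : Module.Basis (GTPattern lam) ℂ V, IsGTBasis s b) ∧
      (∀ b : Module.Basis (GTPattern lam) ℂ V, IsGTBasis s b →
        (∀ P Q, P ≠ Q → B (b P) (b Q) = 0) ∧
        (∀ P, b P ∈ weightSpace s lam v P.wt) ∧
        (∀ P, sgn (B (b P) (b P)).re = P.signQ s)) ∧
      signatureCharacter s lam v B = ∑ P : GTPattern lam, P.signQ s • formalExp P.wt) := by
  have hs : Real.sin (Real.pi * s) ≠ 0 := by
    intro h
    obtain ⟨k, hk⟩ := Real.sin_eq_zero_iff.1 h
    rw [mul_comm Real.pi] at hk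
    have hks : (k : ℝ) = s := mul_right_cancel₀ Real.pi_ne_zero hk
    have h0 : 0 < k := by exact_mod_cast hks.symm ▸ hs0
    have h2 : k < 2 := by exact_mod_cast hks.symm ▸ hs2
    obtain rfl : k = 1 := by omega
    exact hs1 (by rw [← hks, Int.cast_one])
  have hg := GTPattern.isGenericTop hs hlam hq
  have hfin := Finite.of_equiv _ (GTPattern.equivInt hlam)
  have hc : ∀ j : Fin n, lam j = GTPattern.baseEntry lam + GTPattern.intTop lam j :=
    fun j => GTPattern.lam_eq hlam j j.2
  refine ⟨fun P => ⟨?_, P.signQ_eq_signQ' s, ?_⟩, ?_, ?_⟩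
  · rw [GTPattern.signQ_eq_sgn_patternNorm hg hlam]
    exact sgn_eq_one_or ((P.isIntPattern hlam).patternNorm_ne hg)
  · rw [GTPattern.signQ_eq_signQ', GTPattern.signQ'_eq_signQ'']
  · exact ⟨PatternSpace n (GTPattern.intTop lam), inferInstance, inferInstance,
      patternModule hg (GTPattern.baseEntry lam), patternModule_isScalarTower hg _,
      inferInstance, patVec n _ (topPattern n _), patternForm n s _,
      isIrreducibleHighestWeight_patternModule hg hc, isStandardForm_patternForm hg _⟩
  · intro V _ _ _ _ _ v B h hB
    obtain ⟨M⟩ := nonempty_patternModel hg hc h hB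
    refine ⟨⟨M.iSupIndep_weightSpace hc, h.iSup_weightSpace,
      fun mu hmu x => M.mem_weightSpace_iff hg hc h hmu x⟩,
      ⟨_, GTPattern.isGTBasis_modelBasis hg hlam M⟩, fun b hb => ?_,
      GTPattern.signatureCharacter_eq hg hlam M h⟩
    -- Rescaling a basis vector by a nonzero a multiplies its norm by |a|², so all claims pass from
    -- the model basis to any Gelfand–Tsetlin basis.
    choose a ha0 ha using GTPattern.exists_eq_smul_modelBasis hg hlam M hb
    refine ⟨fun P Q hPQ => ?_, fun P => ?_, fun P => ?_⟩
    · rw [ha, ha, map_smul, LinearMap.map_smulₛₗ, LinearMap.smul_apply,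
        GTPattern.form_modelBasis hlam M hPQ, smul_zero, smul_zero]
    · rw [ha]
      exact Submodule.smul_mem _ _ (GTPattern.modelBasis_mem hlam M h P)
    · rw [ha, map_smul, LinearMap.map_smulₛₗ, LinearMap.smul_apply, smul_smul, smul_eq_mul,
        mul_comm (a P), ← Complex.normSq_eq_conj_mul_self, Complex.re_ofReal_mul, sgn_mul,
        sgn_of_pos (Complex.normSq_pos.2 (ha0 P)), one_mul,
        GTPattern.sgn_form_modelBasis hg hlam M]
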